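/- Let $\mathfrak G$ be one of the following 7-dimensional real Lie algebras with basis $X_1,\dots,X_5,X,Y$. In all of them $[X_1,X_2]=X_4$, $[X_1,X_3]=X_5$, all other brackets among $X_1,\dots,X_5$ vanish, $[X,Y]=0$, and $\operatorname{ad}_X,\operatorname{ad}_Y$ act on $\langle X_1,\dots,X_5\rangle$ as follows: * $\mathfrak G_2$: $\operatorname{ad}_X=\mathrm{diag}(1,0,0,1,1)$, $\operatorname{ad}_Y=\mathrm{diag}(0,0,1,0,1)$; * $\mathfrak G_3$: $\operatorname{ad}_X=\mathrm{diag}(0,1,0,1,0)$, $\operatorname{ad}_Y=\mathrm{diag}(0,0,1,0,1)$; * $\mathfrak G_4^{00}$: $\operatorname{ad}_X=\mathrm{diag}(1,0,0,1,1)$, $\operatorname{ad}_Y=\mathrm{diag}(0,1,0,1,0)$; * $\mathfrak G_9$: $\operatorname{ad}_X=\mathrm{diag}(0,0,1,0,1)$, $\operatorname{ad}_Y=\mathrm{diag}(0,1,0,1,0)+(X_3\mapsto X_5)$; * $\mathfrak G_{10}^{\lambda}$ ($\lambda\in\mathbb R$): $\operatorname{ad}_X=\mathrm{diag}(0,1,\lambda,1,\lambda)$,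 $\operatorname{ad}_Y=\mathrm{diag}(0,0,1,0,1)+(X_3\mapsto X_5)$. Let $G$ be the connected and simply connected Lie group with Lie algebra $\mathfrak G$, let $(x_1^*,\dots,x_5^*,x^*,y^*)$ be the coordinates on $\mathfrak G^*\cong\mathbb R^7$ with respect to the dual basis, let $V=\{x_4^*x_5^*\ne 0\}\subset\mathfrak G^*$, and let $\mathcal F_G$ be the family of the coadjoint orbits $\Omega_F$ of $G$ with $F\in V$. Then $\mathcal F_G$ forms a 6-dimensional foliation on $V$: there is a smooth integrable subbundle $D$ of rank 6 of $TV$ such that $\mathcal F_G$ is a partition of $V$ each member of which is a maximal connected integral manifold of $D$; moreover each point of $V$ lies in the domain of a foliation chart. Here a foliation chart is a smooth chart $(p,t)\in\mathbb R^6\times\mathbb R$ on an open set $U\subset V$, with image a product, such that for each leaf $L$ the connected components of $L\cap U$ (the plaques) are given by fixing $t$. This foliation is measurable in the sense of Connes, with Lebesgue measure invariant for a suitable 6-vector field. That is, there are a smooth nowhere vanishing section $\mathcal X$ of $\Lambda^6 D$ over $V$ and a transverse measure $\Lambda$ such that the following holds. 1. The Lebesgue measure $\mu$ on $V$ is $\mathcal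 X$-invariant: in every foliation chart, $\mu$ disintegrates over a measure on the transverse coordinate with conditional measures on the plaques proportional to $\mu_{\mathcal X}$, the measure on the leaves given by the volume form that takes the value $1$ on $\mathcal X$. 2. $\Lambda$ is a $\sigma$-additive map from the Borel transversals (the Borel sets $B\subset V$ with $B\cap L$ countable for each leaf $L$) to $[0,+\infty]$; $\Lambda(B_1)=\Lambda(B_2)$ whenever there is a Borel bijection $\psi:B_1\to B_2$ with $\psi(x)$ on the leaf of $x$ for all $x\in B_1$; and $\Lambda(K)<\infty$ for each compact subset $K$ of a smooth embedded submanifold $N\subset V$ with $T_xV=T_xN\oplus D_x$ for all $x\in N$. 3. $\Lambda$ is the transverse measure corresponding to $(\mathcal X,\mu)$: in every foliation chart, $\mu$ is the integral of the plaque measures $\mu_{\mathcal X}$ with respect to the measure that $\Lambda$ induces on the slices $p=\text{const}$. -/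

import Mathlib

open Set MeasureTheory
open scoped Manifold ContDiff ENNReal Matrix

/-! ### The Lie algebras -/

/-- Labels of the Lie algebras `𝔊₂`, `𝔊₃`, `𝔊₄⁰⁰`, `𝔊₉` and `𝔊₁₀^lam` (`lam` real). -/
inductive AlgLabel : Type
  | g2 : AlgLabel
  | g3 : AlgLabel
  | g4 : AlgLabel
  | g9 : AlgLabel
  | g10 (lam : ℝ) : AlgLabel

namespace AlgLabel

/-- The matrix `a_X`, the transpose of the matrix of `ad_X` on the nilradical in the basis
`X₁, …, X₅`. -/
def aX : AlgLabel → Matrix (Fin 5) (Fin 5) ℝ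
  | g2 => Matrix.diagonal ![1, 0, 0, 1, 1]
  | g3 => Matrix.diagonal ![0, 1, 0, 1, 0]
  | g4 => Matrix.diagonal ![1, 0, 0, 1, 1]
  | g9 => Matrix.diagonal ![0, 0, 1, 0, 1]
  | g10 lam => Matrix.diagonal ![0, 1, lam, 1, lam]

/-- The matrix `a_Y`, the transpose of the matrix of `ad_Y` on the nilradical in the basis
`X₁, …, X₅`; the matrix unit `E₃₅` is `Matrix.single 2 4 1`. -/
def aY : AlgLabel → Matrix (Fin 5) (Fin 5) ℝ
  | g2 => Matrix.diagonal ![0, 0, 1, 0, 1]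
  | g3 => Matrix.diagonal ![0, 0, 1, 0, 1]
  | g4 => Matrix.diagonal ![0, 1, 0, 1, 0]
  | g9 => Matrix.diagonal ![0, 1, 0, 1, 0] + Matrix.single 2 4 1
  | g10 _ => Matrix.diagonal ![0, 0, 1, 0, 1] + Matrix.single 2 4 1

/-- The 7-dimensional real vector space with basis `X₁, X₂, X₃, X₄, X₅, X, Y`; a vector is given
by its coordinates, so that the indices `0, …, 4` belong to `X₁, …, X₅`, the index `5` to `X` and
the index `6` to `Y`. -/
def Alg (_ : AlgLabel) : Type := Fin 7 → ℝ

instance (i : AlgLabel) : AddCommGroup i.Alg := inferInstanceAs (AddCommGroup (Fin 7 → ℝ))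
instance (i : AlgLabel) : Module ℝ i.Alg := inferInstanceAs (Module ℝ (Fin 7 → ℝ))

/-- The component of a vector in the nilradical. -/
def nil (u : Fin 7 → ℝ) : Fin 5 → ℝ := fun j => u (Fin.castAdd 2 j)

/-- The Lie bracket of the nilradical: `[X₁, X₂] = X₄`, `[X₁, X₃] = X₅`. -/
def nilBracket (u w : Fin 5 → ℝ) : Fin 5 → ℝ :=
  ![0, 0, 0, u 0 * w 1 - u 1 * w 0, u 0 * w 2 - u 2 * w 0]

/-- The Lie bracket with nilradical as above, with `ad_X = a_Xᵀ` and `ad_Y = a_Yᵀ` on the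
nilradical and with `[X, Y] = 0`. -/
def algBracket (i : AlgLabel) (u w : Fin 7 → ℝ) : Fin 7 → ℝ :=
  Fin.append
    (nilBracket (nil u) (nil w)
      + (u 5 • (i.aXᵀ *ᵥ nil w) - w 5 • (i.aXᵀ *ᵥ nil u))
      + (u 6 • (i.aYᵀ *ᵥ nil w) - w 6 • (i.aYᵀ *ᵥ nil u)))
    (0 : Fin 2 → ℝ)

instance (i : AlgLabel) : Bracket i.Alg i.Alg := ⟨algBracket i⟩

theorem algBracket_eq (i : AlgLabel) (u w : Fin 7 → ℝ) : algBracket i u w =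
    match i with
    | g2 => ![u 5 * w 0 - w 5 * u 0, 0, u 6 * w 2 - w 6 * u 2,
        u 0 * w 1 - u 1 * w 0 + (u 5 * w 3 - w 5 * u 3),
        u 0 * w 2 - u 2 * w 0 + (u 5 * w 4 - w 5 * u 4) + (u 6 * w 4 - w 6 * u 4), 0, 0]
    | g3 => ![0, u 5 * w 1 - w 5 * u 1, u 6 * w 2 - w 6 * u 2,
        u 0 * w 1 - u 1 * w 0 + (u 5 * w 3 - w 5 * u 3),
        u 0 * w 2 - u 2 * w 0 + (u 6 * w 4 - w 6 * u 4), 0, 0]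
    | g4 => ![u 5 * w 0 - w 5 * u 0, u 6 * w 1 - w 6 * u 1, 0,
        u 0 * w 1 - u 1 * w 0 + (u 5 * w 3 - w 5 * u 3) + (u 6 * w 3 - w 6 * u 3),
        u 0 * w 2 - u 2 * w 0 + (u 5 * w 4 - w 5 * u 4), 0, 0]
    | g9 => ![0, u 6 * w 1 - w 6 * u 1, u 5 * w 2 - w 5 * u 2,
        u 0 * w 1 - u 1 * w 0 + (u 6 * w 3 - w 6 * u 3),
        u 0 * w 2 - u 2 * w 0 + (u 5 * w 4 - w 5 * u 4) + (u 6 * w 2 - w 6 * u 2), 0, 0]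
    | g10 lam => ![0, u 5 * w 1 - w 5 * u 1,
        lam * (u 5 * w 2 - w 5 * u 2) + (u 6 * w 2 - w 6 * u 2),
        u 0 * w 1 - u 1 * w 0 + (u 5 * w 3 - w 5 * u 3),
        u 0 * w 2 - u 2 * w 0 + lam * (u 5 * w 4 - w 5 * u 4) + (u 6 * w 4 - w 6 * u 4)
          + (u 6 * w 2 - w 6 * u 2), 0, 0] := by
  have h0 : ∀ v : Fin 7 → ℝ, nil v = ![v 0, v 1, v 2, v 3, v 4] := by
    intro v; ext j; fin_cases j <;> rfl
  have e : ∀ (a : Fin 5 → ℝ), Fin.append a (0 : Fin 2 → ℝ) =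
      ![a 0, a 1, a 2, a 3, a 4, 0, 0] := by
    intro a; ext j; fin_cases j <;> rfl
  rw [algBracket, e, h0, h0]
  simp only [Pi.add_apply, Pi.sub_apply, Pi.smul_apply, Matrix.mulVec, dotProduct,
    Fin.sum_univ_five, Matrix.transpose_apply, smul_eq_mul]
  cases i <;> ext j <;> fin_cases j <;>
    simp [nilBracket, aX, aY, Matrix.diagonal, Matrix.single] <;> ring

theorem algBracket_add_left (i : AlgLabel) (x y z : Fin 7 → ℝ) :
    algBracket i (x + y) z = algBracket i x z + algBracket i y z := by
  cases i <;> simp only [algBracket_eq] <;> ext j <;> fin_cases j <;> simp <;> ring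

theorem algBracket_add_right (i : AlgLabel) (x y z : Fin 7 → ℝ) :
    algBracket i x (y + z) = algBracket i x y + algBracket i x z := by
  cases i <;> simp only [algBracket_eq] <;> ext j <;> fin_cases j <;> simp <;> ring

theorem algBracket_self (i : AlgLabel) (x : Fin 7 → ℝ) : algBracket i x x = 0 := by
  cases i <;> simp only [algBracket_eq] <;> ext j <;> fin_cases j <;> simp <;> ring

theorem algBracket_leibniz (i : AlgLabel) (x y z : Fin 7 → ℝ) :
    algBracket i x (algBracket i y z) =
      algBracket i (algBracket i x y) z + algBracket i y (algBracket i x z) := by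
  cases i <;> simp only [algBracket_eq] <;> ext j <;> fin_cases j <;> simp <;> ring

theorem algBracket_smul_right (i : AlgLabel) (t : ℝ) (x y : Fin 7 → ℝ) :
    algBracket i x (t • y) = t • algBracket i x y := by
  cases i <;> simp only [algBracket_eq] <;> ext j <;> fin_cases j <;> simp <;> ring

instance (i : AlgLabel) : LieRing i.Alg where
  add_lie := algBracket_add_left i
  lie_add := algBracket_add_right i
  lie_self := algBracket_self i
  leibniz_lie := algBracket_leibniz i

instance (i : AlgLabel) : LieAlgebra ℝ i.Alg where
  lie_smul := algBracket_smul_right i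

/-- The basis vectors `X₁, …, X₅, X, Y`. -/
def basisVec (i : AlgLabel) (j : Fin 7) : i.Alg := (Pi.single j 1 : Fin 7 → ℝ)

end AlgLabel

/-! ### Coadjoint orbits -/

instance : ENat.LEInfty (minSmoothness ℝ 3) :=
  ⟨by rw [minSmoothness_of_isRCLikeNormedField]; exact ENat.LEInfty.out⟩

section Coadjoint

variable {G : Type*} [TopologicalSpace G] [ChartedSpace (EuclideanSpace ℝ (Fin 7)) G] [Group G]

/-- The adjoint representation: `Ad g` is the differential at `1` of `h ↦ g h g⁻¹`. The tangent
space at `g 1 g⁻¹` is the tangent space at `1`. -/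
noncomputable def lieAd (g : G) : GroupLieAlgebra (𝓡 7) G →ₗ[ℝ] GroupLieAlgebra (𝓡 7) G :=
  (mfderiv (𝓡 7) (𝓡 7) (fun h : G => g * h * g⁻¹) 1 :
    EuclideanSpace ℝ (Fin 7) →L[ℝ] EuclideanSpace ℝ (Fin 7)).toLinearMap

/-- The coadjoint representation: `⟨K(g) F, U⟩ = ⟨F, Ad(g⁻¹) U⟩`. -/
noncomputable def coadjoint (g : G) (F : Module.Dual ℝ (GroupLieAlgebra (𝓡 7) G)) :
    Module.Dual ℝ (GroupLieAlgebra (𝓡 7) G) :=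
  F ∘ₗ lieAd g⁻¹

/-- The coadjoint orbit of `F`. -/
def coadjointOrbit (F : Module.Dual ℝ (GroupLieAlgebra (𝓡 7) G)) :
    Set (Module.Dual ℝ (GroupLieAlgebra (𝓡 7) G)) :=
  Set.range fun g : G => coadjoint g F

variable [LieGroup (𝓡 7) ∞ G] {i : AlgLabel}

/-- The coordinates of `F` in the basis dual to `X₁, …, X₅, X, Y`, where the Lie algebra of `G`
is identified with the one labelled by `i`. -/
noncomputable def dualCoord (e : GroupLieAlgebra (𝓡 7) G ≃ₗ⁅ℝ⁆ i.Alg)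
    (F : Module.Dual ℝ (GroupLieAlgebra (𝓡 7) G)) : Fin 7 → ℝ :=
  fun j => F (e.symm (i.basisVec j))

/-- The set `V = {x₄ x₅ ≠ 0}` in the dual of the Lie algebra, in coordinates. -/
def genericSet : Set (Fin 7 → ℝ) := {x | x 3 * x 4 ≠ 0}

/-- The family of the generic coadjoint orbits (those of the points of `V`), in coordinates. -/
def genericOrbits (e : GroupLieAlgebra (𝓡 7) G ≃ₗ⁅ℝ⁆ i.Alg) : Set (Set (Fin 7 → ℝ)) :=
  {Ω | ∃ F : Module.Dual ℝ (GroupLieAlgebra (𝓡 7) G),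
    dualCoord e F ∈ genericSet ∧ Ω = dualCoord e '' coadjointOrbit F}

end Coadjoint

/-! ### Foliations of open subsets of a finite-dimensional vector space -/

section Foliations

variable {E : Type*} [NormedAddCommGroup E] [NormedSpace ℝ E]

/-- `D` is a smooth rank `k` subbundle of the tangent bundle of the open set `V`: locally it has
a smooth frame. -/
def IsSmoothSubbundle (k : ℕ) (V : Set E) (D : E → Submodule ℝ E) : Prop :=
  ∀ x ∈ V, ∃ W : Set E, IsOpen W ∧ x ∈ W ∧ W ⊆ V ∧ ∃ Y : Fin k → E → E,
    (∀ j, ContDiffOn ℝ ∞ (Y j) W) ∧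
    ∀ y ∈ W, LinearIndependent ℝ (fun j => Y j y) ∧
      Submodule.span ℝ (Set.range fun j => Y j y) = D y

/-- `ι : M → E` is a smooth injective immersion of a `k`-manifold into `V`. -/
structure IsImmersedIn (k : ℕ) (V : Set E) {M : Type} [TopologicalSpace M]
    [ChartedSpace (EuclideanSpace ℝ (Fin k)) M] (ι : M → E) : Prop where
  isManifold : IsManifold (𝓡 k) ∞ M
  t2 : T2Space M
  secondCountable : SecondCountableTopology M
  contMDiff : ContMDiff (𝓡 k) 𝓘(ℝ, E) ∞ ι
  injective : Function.Injective ι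
  mem : ∀ m, ι m ∈ V
  immersion : ∀ m, Function.Injective (mfderiv (𝓡 k) 𝓘(ℝ, E) ι m)

/-- The tangent space of the immersed submanifold `ι : M → E` at the point `ι m`. -/
noncomputable def immersedTangent (k : ℕ) {M : Type} [TopologicalSpace M]
    [ChartedSpace (EuclideanSpace ℝ (Fin k)) M] (ι : M → E) (m : M) : Submodule ℝ E :=
  LinearMap.range (mfderiv (𝓡 k) 𝓘(ℝ, E) ι m :
    EuclideanSpace ℝ (Fin k) →L[ℝ] E).toLinearMap

/-- `W` is a `k`-dimensional submanifold of `V` whose tangent spaces are given by `D`. -/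
def IsIntegralManifold (k : ℕ) (V : Set E) (D : E → Submodule ℝ E) (W : Set E) : Prop :=
  ∃ (M : Type) (_ : TopologicalSpace M) (_ : ChartedSpace (EuclideanSpace ℝ (Fin k)) M)
    (ι : M → E), IsImmersedIn k V ι ∧ (∀ m, immersedTangent k ι m = D (ι m)) ∧ Set.range ι = W

/-- The same with a connected manifold. -/
def IsConnectedIntegralManifold (k : ℕ) (V : Set E) (D : E → Submodule ℝ E) (W : Set E) : Prop :=
  ∃ (M : Type) (_ : TopologicalSpace M) (_ : ChartedSpace (EuclideanSpace ℝ (Fin k)) M)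
    (ι : M → E), ConnectedSpace M ∧ IsImmersedIn k V ι ∧ (∀ m, immersedTangent k ι m = D (ι m)) ∧
      Set.range ι = W

/-- The family `𝓕` of subsets of `V` forms the `k`-dimensional foliation of `V` defined by the
subbundle `D`: the subbundle is smooth of rank `k` and integrable, `𝓕` is a partition of `V`, and
each member of `𝓕` is a maximal connected integral manifold of `D`. -/
structure FormsFoliation (k : ℕ) (V : Set E) (D : E → Submodule ℝ E) (𝓕 : Set (Set E)) :
    Prop where
  isOpen : IsOpen V
  smooth : IsSmoothSubbundle k V D
  integrable : ∀ x ∈ V, ∃ W : Set E, x ∈ W ∧ IsIntegralManifold k V D W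
  nonempty : ∀ L ∈ 𝓕, L.Nonempty
  pairwiseDisjoint : 𝓕.PairwiseDisjoint id
  sUnion_eq : ⋃₀ 𝓕 = V
  leaf : ∀ L ∈ 𝓕, Maximal (IsConnectedIntegralManifold k V D) L

/-- A foliation chart: a smooth chart `φ` on an open set `U ⊆ V`, with values in a product of a set
of leaf coordinates and a set of transverse coordinates, such that for each leaf `L` the connected
components of `L ∩ U` (the plaques) are given by fixing the transverse coordinates. -/
structure IsFoliationChart {k q : ℕ} (V : Set E) (𝓕 : Set (Set E))
    (φ : OpenPartialHomeomorph E ((Fin k → ℝ) × (Fin q → ℝ))) : Prop where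
  source_subset : φ.source ⊆ V
  smooth : ContDiffOn ℝ ∞ φ φ.source
  smooth_symm : ContDiffOn ℝ ∞ φ.symm φ.target
  target_eq : ∃ (P : Set (Fin k → ℝ)) (T : Set (Fin q → ℝ)), φ.target = P ×ˢ T
  plaque : ∀ L ∈ 𝓕, ∀ x ∈ L ∩ φ.source,
    connectedComponentIn (L ∩ φ.source) x = {y ∈ φ.source | (φ y).2 = (φ x).2}

/-! ### Transverse measures -/

/-- A Borel transversal: a Borel subset of `V` that meets each leaf in a countable set. -/
def IsBorelTransversal [MeasurableSpace E] (V : Set E) (𝓕 : Set (Set E)) (B : Set E) : Prop :=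
  MeasurableSet B ∧ B ⊆ V ∧ ∀ L ∈ 𝓕, (B ∩ L).Countable

/-- A smooth transversal: an embedded submanifold `N` of `V` with `T_x V = T_x N ⊕ D_x` at each of
its points. -/
def IsSmoothTransversal (q : ℕ) (V : Set E) (D : E → Submodule ℝ E) (N : Set E) : Prop :=
  ∃ (M : Type) (_ : TopologicalSpace M) (_ : ChartedSpace (EuclideanSpace ℝ (Fin q)) M)
    (ι : M → E), IsImmersedIn q V ι ∧ Topology.IsEmbedding ι ∧
      (∀ m, IsCompl (immersedTangent q ι m) (D (ι m))) ∧ Set.range ι = N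

/-- `Λ` is a transverse measure for the foliation of codimension `q` with leaves `𝓕` that is defined
by `D`. Only the values of `Λ` on Borel transversals matter. -/
structure IsTransverseMeasure [MeasurableSpace E] (q : ℕ) (V : Set E) (D : E → Submodule ℝ E)
    (𝓕 : Set (Set E)) (Λ : Set E → ℝ≥0∞) : Prop where
  empty : Λ ∅ = 0
  iUnion : ∀ B : ℕ → Set E, (∀ n, IsBorelTransversal V 𝓕 (B n)) →
    Pairwise (Function.onFun Disjoint B) → Λ (⋃ n, B n) = ∑' n, Λ (B n)
  invariant : ∀ B₁ B₂ : Set E, IsBorelTransversal V 𝓕 B₁ → IsBorelTransversal V 𝓕 B₂ →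
    ∀ ψ : B₁ ≃ᵐ B₂, (∀ x : B₁, ∃ L ∈ 𝓕, (x : E) ∈ L ∧ (ψ x : E) ∈ L) → Λ B₁ = Λ B₂
  compact_lt_top : ∀ N : Set E, IsSmoothTransversal q V D N →
    ∀ K : Set E, IsCompact K → K ⊆ N → Λ K < ⊤

/-! ### Invariance of a measure under a `k`-vector field tangent to the leaves -/

/-- `X` is a smooth section over `V` of the `k`-th exterior power of the rank `k` bundle `D`, without
zeros. (Such a section is positive for exactly one orientation of `D`.) -/
structure IsLeafVolumeField {k : ℕ} (V : Set E) (D : E → Submodule ℝ E) (X : E → ⋀[ℝ]^k E) :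
    Prop where
  smooth : ∀ η : E [⋀^Fin k]→ₗ[ℝ] ℝ,
    ContDiffOn ℝ ∞ (fun x => exteriorPower.alternatingMapLinearEquiv η (X x)) V
  generates : ∀ x ∈ V, ∃ Y : Fin k → E, LinearIndependent ℝ Y ∧
    Submodule.span ℝ (Set.range Y) = D x ∧ X x = exteriorPower.ιMulti ℝ k Y

open Classical in
/-- The absolute value of the factor `c` in `η = c ξ`. -/
noncomputable def absRatio {k : ℕ} (ξ η : ⋀[ℝ]^k E) : ℝ :=
  if h : ∃ c : ℝ, η = c • ξ then |h.choose| else 0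

/-- The density, in the leaf coordinates of the chart `φ`, of the measure `μ_X` on the leaves:
`μ_X` is given by the volume form that takes the value `1` on `X`, so its density is `|c|` where
`∂₁ ∧ … ∧ ∂ₖ = c X` for the leaf coordinate fields `∂₁, …, ∂ₖ`. -/
noncomputable def leafDensity {k q : ℕ} (X : E → ⋀[ℝ]^k E)
    (φ : OpenPartialHomeomorph E ((Fin k → ℝ) × (Fin q → ℝ)))
    (z : (Fin k → ℝ) × (Fin q → ℝ)) : ℝ :=
  absRatio (X (φ.symm z))
    (exteriorPower.ιMulti ℝ k fun j => fderiv ℝ φ.symm z ((Pi.single j 1 : Fin k → ℝ), 0))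

/-- In the foliation chart `φ` the measure `μ` disintegrates over the measure `ν` in the transverse
coordinates, and its conditional measure on each plaque is the measure `μ_X` of that plaque. -/
def DisintegratesOver [MeasurableSpace E] {k q : ℕ} (X : E → ⋀[ℝ]^k E) (μ : Measure E)
    (φ : OpenPartialHomeomorph E ((Fin k → ℝ) × (Fin q → ℝ))) (ν : Measure (Fin q → ℝ)) : Prop :=
  ∀ g : E → ℝ≥0∞, Measurable g →
    ∫⁻ x in φ.source, g x ∂μ =
      ∫⁻ t, (∫⁻ p in {p : Fin k → ℝ | (p, t) ∈ φ.target},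
        g (φ.symm (p, t)) * ENNReal.ofReal (leafDensity X φ (p, t))) ∂ν

/-- The measure `μ` is `X`-invariant: in every foliation chart its conditional measures on the
plaques are proportional to `μ_X` (the factors are part of the transverse measure `ν`). -/
def IsInvariantMeasure [MeasurableSpace E] {k : ℕ} (q : ℕ) (V : Set E) (𝓕 : Set (Set E))
    (X : E → ⋀[ℝ]^k E) (μ : Measure E) : Prop :=
  ∀ φ : OpenPartialHomeomorph E ((Fin k → ℝ) × (Fin q → ℝ)), IsFoliationChart V 𝓕 φ →
    ∃ ν : Measure (Fin q → ℝ), DisintegratesOver X μ φ ν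

/-- The transverse measure `Λ` is the one that corresponds to the pair `(X, μ)`: in every foliation
chart, `μ` is the integral over `Λ` of the measures `μ_X` of the plaques, where `Λ` is evaluated on
the Borel subsets of the slices with fixed leaf coordinates. -/
def CorrespondsTo [MeasurableSpace E] {k : ℕ} (q : ℕ) (V : Set E) (𝓕 : Set (Set E))
    (Λ : Set E → ℝ≥0∞) (X : E → ⋀[ℝ]^k E) (μ : Measure E) : Prop :=
  ∀ φ : OpenPartialHomeomorph E ((Fin k → ℝ) × (Fin q → ℝ)), IsFoliationChart V 𝓕 φ →
    ∃ ν : Measure (Fin q → ℝ), DisintegratesOver X μ φ ν ∧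
      ∀ (p : Fin k → ℝ) (A : Set (Fin q → ℝ)), MeasurableSet A → {p} ×ˢ A ⊆ φ.target →
        ν A = Λ (φ.symm '' ({p} ×ˢ A))

end Foliations

/-! Each of the algebras has a Casimir function `f = a x₂ + b x₃ + c` (`casimir`), where `a`, `b`,
`c` depend only on `x₄`, `x₅` and `a` vanishes nowhere on `V`; in the code `x₁, …, x₅` are `x 0, …,
x 4`. The leaves turn out to be the level sets of `f` inside one of the four sign quadrants of `(x₄,
x₅)`. Since `f` is affine in `x₂`, the other six coordinates together with `f` are coordinates on
`V`, and each leaf is a copy of `ℝ⁶` (`leafParam`), hence connected.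

The coadjoint vector fields annihilate `f` (`fderiv_casimir_coadField`) and take all values in the
six coordinates other than `x₂` (`exists_coadField_eq`). The signs of `x₄`, `x₅` are preserved
because `X₄`, `X₅` are common eigenvectors of the adjoint action. So each orbit through `V` lies in
a leaf and is open in it, and connectedness of the leaf gives equality
(`coordOrbit_eq_leafThrough`). Passing from the algebra to the group rests on two facts: the
differential of `Ad` is the bracket (`fderiv_groupAd_chart`), and a function of `Ad g` that is
infinitesimally invariant is constant on a connected group (`comp_groupAd_eq`).

The bundle is `D = ker df`. The `6`-vector is normalized by `vol(w, 𝒳) = ± df(w)`, which ties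
Lebesgue measure to `𝒳` and `df`. The transverse measure of a set meeting each leaf at most once,
inside one quadrant, is the Lebesgue measure of its set of values of `f`; general sets are handled
by a supremum of such measures. In a foliation chart the Jacobian is the leaf density times the
derivative of `f` along a slice (`abs_volForm_fderiv_symm`). Change of variables and Tonelli then
give the disintegration, and integrating the second factor gives the measure of the values of `f`,
which is the transverse measure of the slice (`chartMeasure_apply_eq`). -/

/-! ### Second-order calculus in a local group -/

section LocalGroup

open Filter Topology

variable {E : Type*} [NormedAddCommGroup E] [NormedSpace ℝ E]

/-- The derivative at the unit of the adjoint representation of a local group, computed from the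
second derivative of its multiplication `m`, where `C` is the conjugation. -/
theorem fderiv_fderiv_conj_eq_sub {m C : E → E → E} {x₀ : E}
    (hm : ContDiffAt ℝ ∞ (Function.uncurry m) (x₀, x₀))
    (hC : ContDiffAt ℝ ∞ (Function.uncurry C) (x₀, x₀))
    (hm₁ : ∀ᶠ x in 𝓝 x₀, m x x₀ = x) (hC₁ : ∀ᶠ x in 𝓝 x₀, C x x₀ = x₀)
    (hC₂ : ∀ᶠ y in 𝓝 x₀, C x₀ y = y)
    (hmC : ∀ᶠ p in 𝓝 (x₀, x₀), m p.1 p.2 = m (C p.1 p.2) p.1) (v w : E) :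
    fderiv ℝ (fun x => fderiv ℝ (C x) x₀ w) x₀ v =
      fderiv ℝ (fun x => fderiv ℝ (m x) x₀ w) x₀ v -
        fderiv ℝ (fun x => fderiv ℝ (m x) x₀ v) x₀ w := by
  set M : E × E → E := Function.uncurry m with hM
  have hMd : ∀ᶠ p in 𝓝 (x₀, x₀), DifferentiableAt ℝ M p := by
    have := (hm.of_le (m := 1) (by simp)).eventually (by simp)
    filter_upwards [this] with p hp using hp.differentiableAt (by simp)
  have hCd : ∀ᶠ p in 𝓝 (x₀, x₀), DifferentiableAt ℝ (Function.uncurry C) p := by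
    have := (hC.of_le (m := 1) (by simp)).eventually (by simp)
    filter_upwards [this] with p hp using hp.differentiableAt (by simp)
  have hleft : Tendsto (fun x : E => (x, x₀)) (𝓝 x₀) (𝓝 (x₀, x₀)) :=
    (Continuous.prodMk_left x₀).tendsto' _ _ rfl
  have hright : Tendsto (fun x : E => (x₀, x)) (𝓝 x₀) (𝓝 (x₀, x₀)) :=
    (Continuous.prodMk_right x₀).tendsto' _ _ rfl
  have hslice : ∀ {f : E → E → E} {x : E}, DifferentiableAt ℝ (Function.uncurry f) (x, x₀) →
      HasFDerivAt (f x) ((fderiv ℝ (Function.uncurry f) (x, x₀)).comp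
        (ContinuousLinearMap.inr ℝ E E)) x₀ := by
    intro f x hf
    exact hf.hasFDerivAt.comp x₀ (hasFDerivAt_prodMk_right x x₀)
  have hmx : ∀ u : E, (fun x => fderiv ℝ (m x) x₀ u) =ᶠ[𝓝 x₀]
      fun x => fderiv ℝ M (x, x₀) (0, u) := by
    intro u
    filter_upwards [hleft.eventually hMd] with x hx
    rw [(hslice hx).fderiv]; simp [hM]
  -- Differentiating `m x y = m (C x y) x` in `y` at `x₀` trades a derivative in the second slot for
  -- one in the first, applied to the differential of the conjugation.
  have hmx' : (fun x => fderiv ℝ (m x) x₀ w) =ᶠ[𝓝 x₀]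
      fun x => fderiv ℝ M (x₀, x) (fderiv ℝ (C x) x₀ w, 0) := by
    filter_upwards [hleft.eventually hCd, hleft.eventually hmC.eventually_nhds, hC₁,
      hright.eventually hMd] with x hCx hmCx hC₁x hMx
    have h1 : m x =ᶠ[𝓝 x₀] fun y => M (C x y, x) := by
      have : Tendsto (fun y : E => (x, y)) (𝓝 x₀) (𝓝 (x, x₀)) :=
        (Continuous.prodMk_right x).tendsto' _ _ rfl
      exact this.eventually hmCx
    rw [h1.fderiv_eq]
    have h2 : HasFDerivAt (fun y => (C x y, x)) ((fderiv ℝ (C x) x₀).prod 0) x₀ :=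
      (hslice hCx).differentiableAt.hasFDerivAt.prodMk (hasFDerivAt_const x x₀)
    have h3 : HasFDerivAt M (fderiv ℝ M (x₀, x)) (C x x₀, x) := by
      rw [hC₁x]; exact hMx.hasFDerivAt
    have h4 : HasFDerivAt (fun y => M (C x y, x)) _ x₀ :=
      HasFDerivAt.comp (f := fun y => (C x y, x)) (g := M) x₀ h3 h2
    rw [h4.fderiv]; simp
  have h2le : (2 : ℕ∞ω) ≤ (∞ : ℕ∞ω) := ENat.LEInfty.out
  have h2le' : (1 : ℕ∞ω) + 1 ≤ (∞ : ℕ∞ω) := by rw [one_add_one_eq_two]; exact h2le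
  have hM2 : DifferentiableAt ℝ (fderiv ℝ M) (x₀, x₀) :=
    (hm.fderiv_right (m := 1) h2le').differentiableAt (by simp)
  have hsymm : IsSymmSndFDerivAt ℝ M (x₀, x₀) := hm.isSymmSndFDerivAt (by simpa using h2le)
  have hl : ∀ u v : E, fderiv ℝ (fun x => fderiv ℝ (m x) x₀ u) x₀ v =
      fderiv ℝ (fderiv ℝ M) (x₀, x₀) (v, 0) (0, u) := by
    intro u v
    rw [(hmx u).fderiv_eq]
    have h1 : HasFDerivAt (fun x => fderiv ℝ M (x, x₀))
        ((fderiv ℝ (fderiv ℝ M) (x₀, x₀)).comp (ContinuousLinearMap.inl ℝ E E)) x₀ :=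
      hM2.hasFDerivAt.comp (f := fun x => (x, x₀)) x₀ (hasFDerivAt_prodMk_left x₀ x₀)
    rw [(h1.clm_apply (hasFDerivAt_const ((0 : E), u) x₀)).fderiv]
    simp
  have hDC : DifferentiableAt ℝ (fun x => fderiv ℝ (C x) x₀ w) x₀ := by
    have : ContDiffAt ℝ 1 (fun x => fderiv ℝ (C x) x₀) x₀ :=
      ContDiffAt.fderiv (n := (∞ : ℕ∞ω)) hC contDiffAt_const h2le'
    exact (this.differentiableAt (by simp)).clm_apply (differentiableAt_const w)
  have hC0 : fderiv ℝ (C x₀) x₀ w = w := by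
    have : C x₀ =ᶠ[𝓝 x₀] id := hC₂
    rw [this.fderiv_eq]; simp
  -- The product rule along `v` gives a mixed second derivative of `M` and the derivative of the
  -- adjoint representation; the latter appears bare because the first partial derivative of `M` at
  -- the unit is the identity.
  have hr : fderiv ℝ (fun x => fderiv ℝ (m x) x₀ w) x₀ v =
      fderiv ℝ (fderiv ℝ M) (x₀, x₀) (0, v) (w, 0) +
        fderiv ℝ (fun x => fderiv ℝ (C x) x₀ w) x₀ v := by
    rw [hmx'.fderiv_eq]
    have h1 : HasFDerivAt (fun x => fderiv ℝ M (x₀, x))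
        ((fderiv ℝ (fderiv ℝ M) (x₀, x₀)).comp (ContinuousLinearMap.inr ℝ E E)) x₀ :=
      hM2.hasFDerivAt.comp x₀ (hasFDerivAt_prodMk_right x₀ x₀)
    rw [(h1.clm_apply (hDC.hasFDerivAt.prodMk (hasFDerivAt_const (0 : E) x₀))).fderiv]
    have h2 : ∀ u : E, fderiv ℝ M (x₀, x₀) (u, 0) = u := by
      intro u
      have h3 : HasFDerivAt (fun x => M (x, x₀)) ((fderiv ℝ M (x₀, x₀)).comp
          (ContinuousLinearMap.inl ℝ E E)) x₀ :=
        hMd.self_of_nhds.hasFDerivAt.comp (f := fun x => (x, x₀)) x₀ (hasFDerivAt_prodMk_left x₀ x₀)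
      have h4 : (fun x => M (x, x₀)) =ᶠ[𝓝 x₀] id := hm₁
      have h5 := h3.fderiv
      rw [h4.fderiv_eq, fderiv_id] at h5
      simpa using (DFunLike.congr_fun h5 u).symm
    simp [h2, hC0, add_comm]
  -- Symmetry of the second derivative identifies the mixed term with the one in which `v` and `w`
  -- are exchanged.
  rw [hr, hl v w, hsymm (w, 0) (0, v)]
  abel

end LocalGroup

/-! ### Adjoint representation and bracket of a Lie group in the chart at the unit -/

section LieGroupChart

open Filter Topology VectorField

variable {E : Type*} [NormedAddCommGroup E] [NormedSpace ℝ E]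
  {G : Type*} [TopologicalSpace G] [ChartedSpace E G] [Group G]

local notation "φ₁" => extChartAt 𝓘(ℝ, E) (1 : G)

variable (E G) in
/-- The multiplication of a Lie group in the chart at `1`. -/
noncomputable def chartMul (x y : E) : E := φ₁ ((φ₁).symm x * (φ₁).symm y)

variable (E G) in
/-- The conjugation of a Lie group in the chart at `1`. -/
noncomputable def chartConj (x y : E) : E := φ₁ ((φ₁).symm x * (φ₁).symm y * ((φ₁).symm x)⁻¹)

variable (E) in
/-- The differential at `1` of the conjugation by `g`. -/
noncomputable def groupAd (g : G) : E →L[ℝ] E :=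
  mfderiv 𝓘(ℝ, E) 𝓘(ℝ, E) (fun h : G => g * h * g⁻¹) 1

theorem chart_one_symm : (φ₁).symm (φ₁ 1) = 1 := extChartAt_to_inv _

theorem tendsto_chart_symm : Tendsto (φ₁).symm (𝓝 (φ₁ 1)) (𝓝 (1 : G)) := by
  have := (continuousAt_extChartAt_symm (I := 𝓘(ℝ, E)) (1 : G)).tendsto
  rwa [chart_one_symm] at this

theorem mfderiv_eq_fderiv_writtenInExtChartAt {E' : Type*} [NormedAddCommGroup E']
    [NormedSpace ℝ E'] {M M' : Type*} [TopologicalSpace M] [ChartedSpace E M]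
    [TopologicalSpace M'] [ChartedSpace E' M'] {f : M → M'} {x : M}
    (h : MDifferentiableAt 𝓘(ℝ, E) 𝓘(ℝ, E') f x) :
    mfderiv 𝓘(ℝ, E) 𝓘(ℝ, E') f x =
      fderiv ℝ (writtenInExtChartAt 𝓘(ℝ, E) 𝓘(ℝ, E') x f) (extChartAt 𝓘(ℝ, E) x x) := by
  have e : ∀ (f : E → E') (z : E), fderivWithin ℝ f (range 𝓘(ℝ, E)) z = fderiv ℝ f z := by
    intro f z
    simp only [modelWithCornersSelf_coe, range_id, fderivWithin_univ]
  exact h.mfderiv.trans (e _ _)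

variable [LieGroup 𝓘(ℝ, E) ∞ G]

theorem contMDiffAt_chart_symm_comp {F : Type*} [NormedAddCommGroup F] [NormedSpace ℝ F]
    {f : F → E} {z : F} (hf : ContDiffAt ℝ ∞ f z) (hz : f z = φ₁ 1) :
    ContMDiffAt 𝓘(ℝ, F) 𝓘(ℝ, E) ∞ (fun p => (φ₁).symm (f p)) z := by
  have h : ContMDiffAt 𝓘(ℝ, E) 𝓘(ℝ, E) ∞ (φ₁).symm (f z) := by
    rw [hz]
    exact (contMDiffOn_extChartAt_symm (1 : G)).contMDiffAt (extChartAt_target_mem_nhds 1)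
  exact h.comp z hf.contMDiffAt

theorem contDiffAt_chartMul :
    ContDiffAt ℝ ∞ (Function.uncurry (chartMul E G)) (φ₁ 1, φ₁ 1) := by
  rw [← contMDiffAt_iff_contDiffAt]
  have h := (contMDiffAt_chart_symm_comp (G := G)
    (contDiffAt_fst (p := (φ₁ (1 : G), φ₁ (1 : G)))) rfl).mul
    (contMDiffAt_chart_symm_comp (G := G) (contDiffAt_snd (p := (φ₁ (1 : G), φ₁ (1 : G)))) rfl)
  refine ContMDiffAt.comp (g := φ₁) _ ?_ h
  simp only [chart_one_symm, mul_one]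
  exact contMDiffAt_extChartAt

theorem contDiffAt_chartConj :
    ContDiffAt ℝ ∞ (Function.uncurry (chartConj E G)) (φ₁ 1, φ₁ 1) := by
  rw [← contMDiffAt_iff_contDiffAt]
  have h1 := contMDiffAt_chart_symm_comp (G := G)
    (contDiffAt_fst (p := (φ₁ (1 : G), φ₁ (1 : G)))) rfl
  have h := (h1.mul
    (contMDiffAt_chart_symm_comp (G := G)
      (contDiffAt_snd (p := (φ₁ (1 : G), φ₁ (1 : G)))) rfl)).mul h1.inv
  refine ContMDiffAt.comp (g := φ₁) _ ?_ h
  simp only [chart_one_symm, mul_one, inv_one]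
  exact contMDiffAt_extChartAt

theorem mdifferentiable_mul_left' (g : G) :
    MDifferentiable 𝓘(ℝ, E) 𝓘(ℝ, E) (fun h : G => g * h) :=
  (contMDiff_mul_left (I := 𝓘(ℝ, E)) (n := ∞) (a := g)).mdifferentiable (by simp)

theorem mdifferentiable_conj (g : G) :
    MDifferentiable 𝓘(ℝ, E) 𝓘(ℝ, E) (fun h : G => g * h * g⁻¹) :=
  ((contMDiff_mul_right (I := 𝓘(ℝ, E)) (n := ∞) (a := g⁻¹)).comp
    (contMDiff_mul_left (I := 𝓘(ℝ, E)) (n := ∞) (a := g))).mdifferentiable (by simp)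

theorem groupAd_chart_symm (x : E) :
    groupAd E ((φ₁).symm x) = fderiv ℝ (chartConj E G x) (φ₁ 1) := by
  have h := (mdifferentiable_conj (E := E) ((φ₁).symm x)) 1
  have e : extChartAt 𝓘(ℝ, E) ((φ₁).symm x * 1 * ((φ₁).symm x)⁻¹) = φ₁ := by simp
  have e' : writtenInExtChartAt 𝓘(ℝ, E) 𝓘(ℝ, E) (1 : G)
      (fun h : G => (φ₁).symm x * h * ((φ₁).symm x)⁻¹) = chartConj E G x := by
    ext y
    simp only [writtenInExtChartAt, e, chartConj, Function.comp_apply]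
  exact (mfderiv_eq_fderiv_writtenInExtChartAt h).trans (congrArg (fderiv ℝ · _) e')

/-- By the chain rule, the differential of the chart at `g` composed with that of left translation
by `g` is the differential of `y ↦ φ₁ (g y)`. The pullback involves the inverse of the differential
of `(φ₁).symm`, which is the differential of `φ₁`. -/
theorem mpullbackWithin_mulInvariantVectorField (v : GroupLieAlgebra 𝓘(ℝ, E) G) :
    ∀ᶠ x in 𝓝 (φ₁ 1), mpullbackWithin 𝓘(ℝ, E) 𝓘(ℝ, E) (φ₁).symm (mulInvariantVectorField v)
      (range 𝓘(ℝ, E)) x = fderiv ℝ (chartMul E G x) (φ₁ 1) v := by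
  have : IsManifold 𝓘(ℝ, E) 1 G := IsManifold.of_le (n := (∞ : ℕ∞ω)) (by simp)
  filter_upwards [extChartAt_target_mem_nhds (I := 𝓘(ℝ, E)) (1 : G)] with x hx
  have hinv : (mfderivWithin 𝓘(ℝ, E) 𝓘(ℝ, E) (φ₁).symm (range 𝓘(ℝ, E)) x).inverse =
      mfderiv 𝓘(ℝ, E) 𝓘(ℝ, E) φ₁ ((φ₁).symm x) :=
    ContinuousLinearMap.inverse_eq (mfderivWithin_extChartAt_symm_comp_mfderiv_extChartAt hx)
      (mfderiv_extChartAt_comp_mfderivWithin_extChartAt_symm hx)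
  rw [mpullbackWithin_apply, hinv, mulInvariantVectorField]
  set g := (φ₁).symm x with hg
  have hgs : g ∈ (chartAt E (1 : G)).source := by
    rw [← extChartAt_source 𝓘(ℝ, E)]; exact (φ₁).map_target hx
  have h1 : MDifferentiableAt 𝓘(ℝ, E) 𝓘(ℝ, E) φ₁ (g * 1) := by
    rw [mul_one]; exact mdifferentiableAt_extChartAt hgs
  have h2 := mfderiv_comp (I := 𝓘(ℝ, E)) (1 : G) (g := φ₁) (f := fun h => g * h) h1
    (mdifferentiable_mul_left' (E := E) g 1)
  have h3 : mfderiv 𝓘(ℝ, E) 𝓘(ℝ, E) ((φ₁) ∘ fun h => g * h) (1 : G) =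
      fderiv ℝ (chartMul E G x) (φ₁ 1) :=
    mfderiv_eq_fderiv_writtenInExtChartAt
      (MDifferentiableAt.comp (1 : G) h1 (mdifferentiable_mul_left' (E := E) g 1))
  have e : mfderiv 𝓘(ℝ, E) 𝓘(ℝ, E) φ₁ (g * 1) = mfderiv 𝓘(ℝ, E) 𝓘(ℝ, E) φ₁ g := by
    rw [mul_one]
  rw [h3] at h2
  have h4 := DFunLike.congr_fun h2 v
  refine Eq.trans ?_ h4.symm
  exact (DFunLike.congr_fun e _).symm

variable (E G) in
/-- The bracket of the Lie algebra of a Lie group, as an operation on the model space. -/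
noncomputable def groupBracket (v w : E) : E :=
  Bracket.bracket (L := GroupLieAlgebra 𝓘(ℝ, E) G) (M := GroupLieAlgebra 𝓘(ℝ, E) G) v w

/-- The bracket is that of left-invariant fields, computed in the chart as `DW(V) - DV(W)`. At the
unit the fields take the values `v` and `w`, since multiplication by `1` is the identity there. -/
theorem groupBracket_eq_chart (v w : E) :
    groupBracket E G v w =
      fderiv ℝ (fun x => fderiv ℝ (chartMul E G x) (φ₁ 1) w) (φ₁ 1) v -
        fderiv ℝ (fun x => fderiv ℝ (chartMul E G x) (φ₁ 1) v) (φ₁ 1) w := by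
  have : IsManifold 𝓘(ℝ, E) 1 G := IsManifold.of_le (n := (∞ : ℕ∞ω)) (by simp)
  have hv := mpullbackWithin_mulInvariantVectorField (G := G) v
  have hw := mpullbackWithin_mulInvariantVectorField (G := G) w
  have hone : ∀ u : E, fderiv ℝ (chartMul E G (φ₁ 1)) (φ₁ 1) u = u := by
    intro u
    have : chartMul E G (φ₁ 1) =ᶠ[𝓝 (φ₁ 1)] id := by
      filter_upwards [extChartAt_target_mem_nhds (I := 𝓘(ℝ, E)) (1 : G)] with y hy
      simp only [chartMul, chart_one_symm, one_mul, id, (φ₁).right_inv hy]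
    rw [this.fderiv_eq]; simp
  simp only [modelWithCornersSelf_coe, range_id] at hv hw
  have key := Filter.EventuallyEq.lieBracket_vectorField_eq (𝕜 := ℝ) hv hw
  have h1 : (mfderiv 𝓘(ℝ, E) 𝓘(ℝ, E) φ₁ (1 : G) : E →L[ℝ] E).inverse =
      ContinuousLinearMap.id ℝ E :=
    (congrArg ContinuousLinearMap.inverse
      (mfderiv_extChartAt_self (I := 𝓘(ℝ, E)) (x := (1 : G)))).trans
      (ContinuousLinearMap.inverse_id (R := ℝ) (M := E))
  have h2 : ∀ V W : E → E, lieBracketWithin ℝ V W ((φ₁).symm ⁻¹' univ ∩ range 𝓘(ℝ, E)) (φ₁ 1) =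
      lieBracket ℝ V W (φ₁ 1) := by
    intro V W
    simp only [preimage_univ, modelWithCornersSelf_coe, range_id, univ_inter,
      lieBracketWithin_univ]
  refine Eq.trans (DFunLike.congr_fun h1 _) (Eq.trans (h2 _ _) ?_)
  simp only [modelWithCornersSelf_coe, range_id]
  refine key.trans ?_
  rw [lieBracket, hone, hone]

theorem contDiffAt_groupAd_chart :
    ContDiffAt ℝ ∞ (fun x => groupAd E ((φ₁).symm x)) (φ₁ 1) := by
  simp only [groupAd_chart_symm]
  exact ContDiffAt.fderiv (n := (∞ : ℕ∞ω)) contDiffAt_chartConj contDiffAt_const (by simp)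

/-- The differential of the adjoint representation at `1` is the bracket. -/
theorem fderiv_groupAd_chart (v w : E) :
    fderiv ℝ (fun x => groupAd E ((φ₁).symm x) w) (φ₁ 1) v =
      groupBracket E G v w := by
  simp only [groupAd_chart_symm]
  rw [groupBracket_eq_chart]
  have : IsTopologicalGroup G := topologicalGroup_of_lieGroup 𝓘(ℝ, E) ∞
  have ht := extChartAt_target_mem_nhds (I := 𝓘(ℝ, E)) (1 : G)
  refine fderiv_fderiv_conj_eq_sub contDiffAt_chartMul contDiffAt_chartConj ?_ ?_ ?_ ?_ v w
  · filter_upwards [ht] with x hx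
    simp only [chartMul, chart_one_symm, mul_one, (φ₁).right_inv hx]
  · filter_upwards with x
    simp only [chartConj, chart_one_symm, mul_one, mul_inv_cancel]
  · filter_upwards [ht] with x hx
    simp only [chartConj, chart_one_symm, one_mul, inv_one, mul_one, (φ₁).right_inv hx]
  -- The identity `x y = (x y x⁻¹) x` survives in the chart only while `x y x⁻¹` stays in the chart
  -- domain, hence only near the unit.
  · have h1 : Tendsto (fun p : E × E => (φ₁).symm p.1 * (φ₁).symm p.2 * ((φ₁).symm p.1)⁻¹)
        (𝓝 (φ₁ 1, φ₁ 1)) (𝓝 (1 : G)) := by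
      have ha : Tendsto (fun p : E × E => (φ₁).symm p.1) (𝓝 (φ₁ 1, φ₁ 1)) (𝓝 (1 : G)) :=
        tendsto_chart_symm.comp (continuous_fst.tendsto' _ _ rfl)
      have hb : Tendsto (fun p : E × E => (φ₁).symm p.2) (𝓝 (φ₁ 1, φ₁ 1)) (𝓝 (1 : G)) :=
        tendsto_chart_symm.comp (continuous_snd.tendsto' _ _ rfl)
      simpa using (ha.mul hb).mul ha.inv
    filter_upwards [h1.eventually (extChartAt_source_mem_nhds (I := 𝓘(ℝ, E)) (1 : G))] with p hp
    simp only [chartMul, chartConj, (φ₁).left_inv hp, inv_mul_cancel_right]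

end LieGroupChart

/-! ### Functions with zero differential on a manifold -/

section ZeroDerivative

open Filter Topology

variable {E : Type*} [NormedAddCommGroup E] [NormedSpace ℝ E]
  {F : Type*} [NormedAddCommGroup F] [NormedSpace ℝ F]
  {M : Type*} [TopologicalSpace M] [ChartedSpace E M]

/-- In a chart, a small ball is convex, and a function with zero derivative on a convex set is
constant. -/
theorem eventually_eq_of_hasMFDerivAt_zero [IsManifold 𝓘(ℝ, E) 1 M] {u : M → F} {m₀ : M}
    (h : ∀ᶠ m in 𝓝 m₀, HasMFDerivAt 𝓘(ℝ, E) 𝓘(ℝ, F) u m 0) : ∀ᶠ m in 𝓝 m₀, u m = u m₀ := by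
  set φ := extChartAt 𝓘(ℝ, E) m₀ with hφ
  have h1 : Tendsto φ.symm (𝓝 (φ m₀)) (𝓝 m₀) := by
    have := (continuousAt_extChartAt_symm (I := 𝓘(ℝ, E)) m₀).tendsto
    rwa [extChartAt_to_inv] at this
  have h2 : ∀ᶠ x in 𝓝 (φ m₀), HasFDerivAt (u ∘ φ.symm) (0 : E →L[ℝ] F) x := by
    filter_upwards [extChartAt_target_mem_nhds (I := 𝓘(ℝ, E)) m₀, h1.eventually h] with x hx hu
    have hs := mdifferentiableWithinAt_extChartAt_symm hx
    rw [modelWithCornersSelf_coe, range_id, mdifferentiableWithinAt_univ] at hs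
    have hc := hu.comp x hs.hasMFDerivAt
    have hc' : HasMFDerivAt 𝓘(ℝ, E) 𝓘(ℝ, F) (u ∘ φ.symm) x (0 : E →L[ℝ] F) := by
      convert! hc using 1
    exact hasMFDerivAt_iff_hasFDerivAt.1 hc'
  obtain ⟨r, hr, hball⟩ := Metric.eventually_nhds_iff_ball.1 h2
  have h3 : ∀ x ∈ Metric.ball (φ m₀) r, (u ∘ φ.symm) x = (u ∘ φ.symm) (φ m₀) := by
    intro x hx
    refine (convex_ball (φ m₀) r).is_const_of_fderivWithin_eq_zero (𝕜 := ℝ)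
      (fun y hy => (hball y hy).differentiableAt.differentiableWithinAt) (fun y hy => ?_) hx
      (Metric.mem_ball_self hr)
    rw [fderivWithin_of_isOpen Metric.isOpen_ball hy, (hball y hy).fderiv]
  have h4 : ∀ᶠ m in 𝓝 m₀, φ m ∈ Metric.ball (φ m₀) r :=
    (continuousAt_extChartAt (I := 𝓘(ℝ, E)) m₀).eventually (Metric.ball_mem_nhds _ hr)
  filter_upwards [h4, extChartAt_source_mem_nhds (I := 𝓘(ℝ, E)) m₀] with m hm hms
  have := h3 _ hm
  rwa [Function.comp_apply, Function.comp_apply, φ.left_inv hms, hφ, extChartAt_to_inv] at this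

theorem eq_of_hasMFDerivAt_zero [IsManifold 𝓘(ℝ, E) 1 M] [PreconnectedSpace M] {u : M → F}
    (h : ∀ m, HasMFDerivAt 𝓘(ℝ, E) 𝓘(ℝ, F) u m 0) (a b : M) : u a = u b :=
  IsLocallyConstant.apply_eq_of_preconnectedSpace
    ((IsLocallyConstant.iff_eventually_eq u).2 fun _ =>
      eventually_eq_of_hasMFDerivAt_zero (Eventually.of_forall h)) a b

end ZeroDerivative

/-! ### From infinitesimal to global invariance -/

section AdjointRepresentation

open Filter Topology

variable {E : Type*} [NormedAddCommGroup E] [NormedSpace ℝ E]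
  {F : Type*} [NormedAddCommGroup F] [NormedSpace ℝ F]
  {G : Type*} [TopologicalSpace G] [ChartedSpace E G] [Group G]

theorem groupAd_one : groupAd E (1 : G) = ContinuousLinearMap.id ℝ E := by
  have h : (fun h : G => 1 * h * 1⁻¹) = id := by ext; simp
  have e : ∀ f : G → G, f = id → (mfderiv 𝓘(ℝ, E) 𝓘(ℝ, E) f (1 : G) : E →L[ℝ] E) =
      ContinuousLinearMap.id ℝ E := by
    rintro f rfl
    exact mfderiv_id
  exact e _ h

variable [LieGroup 𝓘(ℝ, E) ∞ G]

theorem groupAd_mul (g h : G) : groupAd E (g * h) = (groupAd E g).comp (groupAd E h) := by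
  have e : (fun k : G => g * h * k * (g * h)⁻¹) =
      (fun k : G => g * k * g⁻¹) ∘ fun k : G => h * k * h⁻¹ := by
    ext k; simp [mul_assoc]
  have e1 : h * 1 * h⁻¹ = 1 := by simp
  have c := mfderiv_comp (I := 𝓘(ℝ, E)) (I' := 𝓘(ℝ, E)) (I'' := 𝓘(ℝ, E)) (1 : G)
    (mdifferentiable_conj (E := E) g (h * 1 * h⁻¹)) (mdifferentiable_conj (E := E) h 1)
  have e2 : ∀ x : G, x = 1 →
      (mfderiv 𝓘(ℝ, E) 𝓘(ℝ, E) (fun k : G => g * k * g⁻¹) x : E →L[ℝ] E) = groupAd E g := by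
    rintro x rfl; rfl
  have e3 : ∀ f : G → G, f = (fun k : G => g * k * g⁻¹) ∘ (fun k : G => h * k * h⁻¹) →
      (mfderiv 𝓘(ℝ, E) 𝓘(ℝ, E) f (1 : G) : E →L[ℝ] E) =
      (mfderiv 𝓘(ℝ, E) 𝓘(ℝ, E) (fun k : G => g * k * g⁻¹) (h * 1 * h⁻¹) : E →L[ℝ] E).comp
        (groupAd E h) := by
    rintro f rfl; exact c
  exact (e3 _ e).trans (congrArg (fun L : E →L[ℝ] E => L.comp (groupAd E h)) (e2 _ e1))

variable (E G) in
/-- The adjoint representation of the Lie algebra, as the differential of that of the group. -/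
noncomputable def adDeriv : E →L[ℝ] E →L[ℝ] E :=
  fderiv ℝ (fun x => groupAd E ((extChartAt 𝓘(ℝ, E) (1 : G)).symm x)) (extChartAt 𝓘(ℝ, E) (1 : G) 1)

theorem hasStrictFDerivAt_groupAd_chart :
    HasStrictFDerivAt (fun x => groupAd E ((extChartAt 𝓘(ℝ, E) (1 : G)).symm x)) (adDeriv E G)
      (extChartAt 𝓘(ℝ, E) (1 : G) 1) :=
  contDiffAt_groupAd_chart.hasStrictFDerivAt (by simp)

theorem adDeriv_apply (v w : E) : adDeriv E G v w = groupBracket E G v w := by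
  rw [← fderiv_groupAd_chart]
  have := (hasStrictFDerivAt_groupAd_chart (E := E) (G := G)).hasFDerivAt.clm_apply
    (hasFDerivAt_const w _)
  rw [this.fderiv]
  simp

theorem hasMFDerivAt_groupAd_one :
    HasMFDerivAt 𝓘(ℝ, E) 𝓘(ℝ, E →L[ℝ] E) (groupAd E : G → E →L[ℝ] E) 1 (adDeriv E G) := by
  have hd := (hasStrictFDerivAt_groupAd_chart (E := E) (G := G)).hasFDerivAt
  refine ⟨?_, ?_⟩
  · have h1 : ContinuousAt (fun g : G => groupAd E ((extChartAt 𝓘(ℝ, E) (1 : G)).symm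
        (extChartAt 𝓘(ℝ, E) (1 : G) g))) 1 :=
      ContinuousAt.comp (f := extChartAt 𝓘(ℝ, E) (1 : G)) hd.continuousAt
        (continuousAt_extChartAt 1)
    refine h1.congr ?_
    filter_upwards [extChartAt_source_mem_nhds (I := 𝓘(ℝ, E)) (1 : G)] with g hg
    rw [(extChartAt 𝓘(ℝ, E) (1 : G)).left_inv hg]
  · exact hd.hasFDerivWithinAt

/-- Since `Ad k = Ad g ∘ Ad (g⁻¹ k)`, left translation moves the computation to the unit, where the
differential of `Ad` is `adDeriv`. So it suffices that `Ψ'` kills the vectors `Ad g ∘ ad v`. -/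
theorem hasMFDerivAt_comp_groupAd_zero {Ψ : (E →L[ℝ] E) → F} {Ψ' : (E →L[ℝ] E) →L[ℝ] F} {g : G}
    (hΨ : HasFDerivAt Ψ Ψ' (groupAd E g))
    (h0 : ∀ v, Ψ' ((groupAd E g).comp (adDeriv E G v)) = 0) :
    HasMFDerivAt 𝓘(ℝ, E) 𝓘(ℝ, F) (fun k : G => Ψ (groupAd E k)) g 0 := by
  have h1 : HasFDerivAt (fun A : E →L[ℝ] E => Ψ ((groupAd E g).comp A))
      (Ψ'.comp (ContinuousLinearMap.compL ℝ E E E (groupAd E g))) (groupAd E (1 : G)) := by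
    refine HasFDerivAt.comp (g := Ψ) (f := fun A => (groupAd E g).comp A) _ ?_
      (ContinuousLinearMap.compL ℝ E E E (groupAd E g)).hasFDerivAt
    rwa [groupAd_one, ContinuousLinearMap.comp_id]
  have h2 := h1.hasMFDerivAt.comp (1 : G) (hasMFDerivAt_groupAd_one (E := E) (G := G))
  have e1 : (fun k : G => Ψ (groupAd E k)) =
      ((fun A : E →L[ℝ] E => Ψ ((groupAd E g).comp A)) ∘ groupAd E) ∘ fun k : G => g⁻¹ * k := by
    ext k
    simp only [Function.comp_apply, ← groupAd_mul, mul_inv_cancel_left]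
  have e2 : (Ψ'.comp (ContinuousLinearMap.compL ℝ E E E (groupAd E g))).comp (adDeriv E G) = 0 := by
    ext v; exact h0 v
  have h3 : HasMFDerivAt 𝓘(ℝ, E) 𝓘(ℝ, F)
      ((fun A : E →L[ℝ] E => Ψ ((groupAd E g).comp A)) ∘ groupAd E) (g⁻¹ * g) 0 := by
    rw [inv_mul_cancel]
    exact (e2 ▸ h2 :)
  have h4 := h3.comp g (mdifferentiable_mul_left' (E := E) g⁻¹ g).hasMFDerivAt
  rw [e1]
  convert! h4 using 1

theorem comp_groupAd_eq [PreconnectedSpace G] {Ψ : (E →L[ℝ] E) → F}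
    {Ψ' : G → (E →L[ℝ] E) →L[ℝ] F} (hΨ : ∀ g, HasFDerivAt Ψ (Ψ' g) (groupAd E g))
    (h0 : ∀ g v, Ψ' g ((groupAd E g).comp (adDeriv E G v)) = 0) (g : G) :
    Ψ (groupAd E g) = Ψ (ContinuousLinearMap.id ℝ E) := by
  have : IsManifold 𝓘(ℝ, E) 1 G := IsManifold.of_le (n := (∞ : ℕ∞ω)) (by simp)
  have := eq_of_hasMFDerivAt_zero (u := fun k : G => Ψ (groupAd E k))
    (fun k => hasMFDerivAt_comp_groupAd_zero (hΨ k) (h0 k)) g 1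
  rwa [groupAd_one] at this

/-- A common eigenvector of the adjoint representation of the Lie algebra is one of the adjoint
representation of a connected group. -/
theorem exists_groupAd_eq_smul [PreconnectedSpace G] {v : E} {ε : E →L[ℝ] ℝ} (hε : ε v = 1)
    (hv : ∀ w, ∃ a : ℝ, groupBracket E G w v = a • v) (g : G) : ∃ c : ℝ, groupAd E g v = c • v := by
  have : IsManifold 𝓘(ℝ, E) 1 G := IsManifold.of_le (n := (∞ : ℕ∞ω)) (by simp)
  have : IsTopologicalGroup G := topologicalGroup_of_lieGroup 𝓘(ℝ, E) ∞
  have hev : (ContinuousLinearMap.apply ℝ E v) (groupAd E (1 : G)) = v := by simp [groupAd_one]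
  have hc : ContinuousAt (fun g : G => ε (groupAd E g v)) 1 :=
    (ε.comp (ContinuousLinearMap.apply ℝ E v)).continuous.continuousAt.comp
      hasMFDerivAt_groupAd_one.continuousAt
  have hne : ∀ᶠ g in 𝓝 (1 : G), ε (groupAd E g v) ≠ 0 :=
    hc.eventually_ne (by simp [groupAd_one, hε])
  -- The derivative of `Ad g v` along `w` is `Ad g [w, v]`, a multiple of `Ad g v`, so the vector
  -- normalized by `ε` has zero derivative. The normalization makes sense only near `1`, where `ε
  -- (Ad g v) ≠ 0`.
  have hder : ∀ᶠ g in 𝓝 (1 : G), HasMFDerivAt 𝓘(ℝ, E) 𝓘(ℝ, E)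
      (fun k : G => (ε (groupAd E k v))⁻¹ • groupAd E k v) g 0 := by
    filter_upwards [hne] with g hg
    have hA : HasFDerivAt (fun A : E →L[ℝ] E => A v) (ContinuousLinearMap.apply ℝ E v)
      (groupAd E g) := (ContinuousLinearMap.apply ℝ E v).hasFDerivAt
    have hB : HasFDerivAt (fun A : E →L[ℝ] E => ε (A v))
      (ε.comp (ContinuousLinearMap.apply ℝ E v)) (groupAd E g) :=
        (ε.comp (ContinuousLinearMap.apply ℝ E v)).hasFDerivAt
    refine hasMFDerivAt_comp_groupAd_zero (Ψ := fun A => (ε (A v))⁻¹ • A v)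
      ((HasDerivAt.comp_hasFDerivAt (f := fun A : E →L[ℝ] E => ε (A v)) _
        (hasDerivAt_inv hg) hB).smul hA) fun w => ?_
    obtain ⟨a, ha⟩ := hv w
    simp only [add_apply, smul_apply,
      ContinuousLinearMap.smulRight_apply, ContinuousLinearMap.comp_apply,
      ContinuousLinearMap.apply_apply, adDeriv_apply, ha, map_smul, Function.comp_apply,
      smul_smul, smul_eq_mul]
    rw [← add_smul]
    convert zero_smul ℝ _
    field_simp
    simp
  have hloc := eventually_eq_of_hasMFDerivAt_zero hder
  -- To leave the neighbourhood of `1`: the elements scaling `v` by a nonzero factor form a subgroup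
  -- which contains a neighbourhood of `1`, hence is open and closed.
  let S : Subgroup G :=
    { carrier := {g | ∃ c : ℝ, c ≠ 0 ∧ groupAd E g v = c • v}
      mul_mem' := by
        rintro a b ⟨c, hc0, hc⟩ ⟨d, hd0, hd⟩
        refine ⟨c * d, mul_ne_zero hc0 hd0, ?_⟩
        rw [groupAd_mul, ContinuousLinearMap.comp_apply, hd, map_smul, hc, smul_smul, mul_comm]
      one_mem' := ⟨1, one_ne_zero, by simp [groupAd_one]⟩
      inv_mem' := by
        rintro a ⟨c, hc0, hc⟩
        refine ⟨c⁻¹, inv_ne_zero hc0, ?_⟩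
        have h1 : groupAd E (a⁻¹ * a) v = v := by simp [groupAd_one]
        rw [groupAd_mul, ContinuousLinearMap.comp_apply, hc, map_smul] at h1
        rw [eq_inv_smul_iff₀ hc0, h1] }
  have hS : (S : Set G) ∈ 𝓝 (1 : G) := by
    filter_upwards [hne, hloc] with k hk hk'
    refine ⟨ε (groupAd E k v), hk, ?_⟩
    simp only [groupAd_one, ContinuousLinearMap.id_apply, hε, inv_one, one_smul] at hk'
    rw [inv_smul_eq_iff₀ hk] at hk'
    exact hk'
  have hopen : IsOpen (S : Set G) := S.isOpen_of_mem_nhds hS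
  have hclopen : IsClopen (S : Set G) := ⟨S.isClosed_of_isOpen hopen, hopen⟩
  have : (S : Set G) = univ := hclopen.eq_univ ⟨1, S.one_mem⟩
  obtain ⟨c, -, hc⟩ := (this ▸ mem_univ g : g ∈ (S : Set G))
  exact ⟨c, hc⟩

end AdjointRepresentation

/-! ### Casimir functions and coadjoint vector fields -/

namespace AlgLabel

/-- The coefficient of `x₂` in the Casimir function. -/
noncomputable def casA : AlgLabel → ℝ → ℝ → ℝ
  | g2, _, _ => 1
  | g3, p, _ => 1 / p
  | g4, p, q => -q / p
  | g9, p, _ => 1 / p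
  | g10 _, p, _ => 1 / p

/-- The coefficient of `x₃` in the Casimir function. -/
noncomputable def casB : AlgLabel → ℝ → ℝ → ℝ
  | g2, p, q => -p / q
  | g3, _, q => -1 / q
  | g4, _, _ => 1
  | g9, _, q => -1 / q
  | g10 _, _, q => -1 / q

/-- The part of the Casimir function that does not depend on `x₂` and `x₃`. -/
noncomputable def casC : AlgLabel → ℝ → ℝ → ℝ
  | g2, _, _ => 0
  | g3, _, _ => 0
  | g4, _, _ => 0
  | g9, p, _ => Real.log p
  | g10 lam, p, q => Real.log q - lam * Real.log p

/-- A function on the dual of the Lie algebra whose level sets in `V` consist of coadjoint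
orbits. -/
noncomputable def casimir (i : AlgLabel) (x : Fin 7 → ℝ) : ℝ :=
  i.casA (x 3) (x 4) * x 1 + i.casB (x 3) (x 4) * x 2 + i.casC (x 3) (x 4)

/-- The partial derivative of the Casimir function with respect to `x₄`. -/
noncomputable def casP : AlgLabel → (Fin 7 → ℝ) → ℝ
  | g2, x => -x 2 / x 4
  | g3, x => -x 1 / x 3 ^ 2
  | g4, x => x 1 * x 4 / x 3 ^ 2
  | g9, x => -x 1 / x 3 ^ 2 + 1 / x 3
  | g10 lam, x => -x 1 / x 3 ^ 2 - lam / x 3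

/-- The partial derivative of the Casimir function with respect to `x₅`. -/
noncomputable def casQ : AlgLabel → (Fin 7 → ℝ) → ℝ
  | g2, x => x 2 * x 3 / x 4 ^ 2
  | g3, x => x 2 / x 4 ^ 2
  | g4, x => -x 1 / x 3
  | g9, x => x 2 / x 4 ^ 2
  | g10 _, x => x 2 / x 4 ^ 2 + 1 / x 4

theorem ne_zero_of_mem_genericSet {x : Fin 7 → ℝ} (hx : x ∈ genericSet) : x 3 ≠ 0 ∧ x 4 ≠ 0 :=
  mul_ne_zero_iff.1 hx

theorem isOpen_genericSet : IsOpen genericSet :=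
  isOpen_ne_fun (by fun_prop) (by fun_prop)

theorem casA_ne_zero (i : AlgLabel) {p q : ℝ} (hp : p ≠ 0) (hq : q ≠ 0) : i.casA p q ≠ 0 := by
  cases i <;> simp [casA, hp, hq]

theorem contDiffAt_casA (i : AlgLabel) {z : ℝ × ℝ} (hp : z.1 ≠ 0) :
    ContDiffAt ℝ ∞ (fun z : ℝ × ℝ => i.casA z.1 z.2) z := by
  cases i <;> simp only [casA] <;> fun_prop (disch := assumption)

theorem contDiffAt_casB (i : AlgLabel) {z : ℝ × ℝ} (hq : z.2 ≠ 0) :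
    ContDiffAt ℝ ∞ (fun z : ℝ × ℝ => i.casB z.1 z.2) z := by
  cases i <;> simp only [casB] <;> fun_prop (disch := assumption)

/-- `Real.log` is `log |·|`, so a single formula is smooth for both signs of `p` and `q`. -/
theorem contDiffAt_casC (i : AlgLabel) {z : ℝ × ℝ} (hp : z.1 ≠ 0) (hq : z.2 ≠ 0) :
    ContDiffAt ℝ ∞ (fun z : ℝ × ℝ => i.casC z.1 z.2) z := by
  cases i <;> simp only [casC] <;> fun_prop (disch := assumption)

section Composition

variable {F : Type*} [NormedAddCommGroup F] [NormedSpace ℝ F] {p q : F → ℝ} {y : F}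

theorem contDiffAt_casA_comp (i : AlgLabel) (hp : ContDiffAt ℝ ∞ p y) (hq : ContDiffAt ℝ ∞ q y)
    (hp0 : p y ≠ 0) : ContDiffAt ℝ ∞ (fun y => i.casA (p y) (q y)) y :=
  ContDiffAt.comp (g := fun z : ℝ × ℝ => i.casA z.1 z.2) (f := fun y => (p y, q y)) y
    (i.contDiffAt_casA (z := (p y, q y)) hp0) (hp.prodMk hq)

theorem contDiffAt_casB_comp (i : AlgLabel) (hp : ContDiffAt ℝ ∞ p y) (hq : ContDiffAt ℝ ∞ q y)
    (hq0 : q y ≠ 0) : ContDiffAt ℝ ∞ (fun y => i.casB (p y) (q y)) y :=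
  ContDiffAt.comp (g := fun z : ℝ × ℝ => i.casB z.1 z.2) (f := fun y => (p y, q y)) y
    (i.contDiffAt_casB (z := (p y, q y)) hq0) (hp.prodMk hq)

theorem contDiffAt_casC_comp (i : AlgLabel) (hp : ContDiffAt ℝ ∞ p y) (hq : ContDiffAt ℝ ∞ q y)
    (hp0 : p y ≠ 0) (hq0 : q y ≠ 0) : ContDiffAt ℝ ∞ (fun y => i.casC (p y) (q y)) y :=
  ContDiffAt.comp (g := fun z : ℝ × ℝ => i.casC z.1 z.2) (f := fun y => (p y, q y)) y
    (i.contDiffAt_casC (z := (p y, q y)) hp0 hq0) (hp.prodMk hq)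

end Composition

theorem contDiffAt_casimir (i : AlgLabel) {x : Fin 7 → ℝ} (hx : x ∈ genericSet) :
    ContDiffAt ℝ ∞ i.casimir x := by
  obtain ⟨h3, h4⟩ := ne_zero_of_mem_genericSet hx
  have e : ∀ j : Fin 7, ContDiffAt ℝ ∞ (fun x : Fin 7 → ℝ => x j) x := fun j => by fun_prop
  exact (((i.contDiffAt_casA_comp (e 3) (e 4) h3).mul (e 1)).add
    ((i.contDiffAt_casB_comp (e 3) (e 4) h4).mul (e 2))).add
    (i.contDiffAt_casC_comp (e 3) (e 4) h3 h4)

/-- Differentiability is known, so the value on `u` is the derivative along the line `x + t u`,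
which one-variable rules compute. -/
theorem fderiv_casimir (i : AlgLabel) {x : Fin 7 → ℝ} (hx : x ∈ genericSet) (u : Fin 7 → ℝ) :
    fderiv ℝ i.casimir x u = i.casA (x 3) (x 4) * u 1 + i.casB (x 3) (x 4) * u 2 +
      i.casP x * u 3 + i.casQ x * u 4 := by
  obtain ⟨h3, h4⟩ := ne_zero_of_mem_genericSet hx
  have hf := ((i.contDiffAt_casimir hx).differentiableAt (by simp)).hasFDerivAt
  have hl : HasDerivAt (fun t : ℝ => x + t • u) u 0 := by
    simpa using ((hasDerivAt_id (0 : ℝ)).smul_const u).const_add x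
  have hx0 : x + (0 : ℝ) • u = x := by simp
  have h1 : HasDerivAt (fun t : ℝ => i.casimir (x + t • u)) (fderiv ℝ i.casimir x u) 0 := by
    have hf' : HasFDerivAt i.casimir (fderiv ℝ i.casimir x) (x + (0 : ℝ) • u) := by rwa [hx0]
    exact hf'.comp_hasDerivAt (0 : ℝ) hl
  refine h1.unique ?_
  have e : ∀ j, HasDerivAt (fun t : ℝ => x j + t * u j) (u j) 0 := by
    intro j
    simpa using ((hasDerivAt_id (0 : ℝ)).mul_const (u j)).const_add (x j)
  have h3' : x 3 + 0 * u 3 ≠ 0 := by simpa using h3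
  have h4' : x 4 + 0 * u 4 ≠ 0 := by simpa using h4
  simp only [casimir, Pi.add_apply, Pi.smul_apply, smul_eq_mul]
  cases i with
  | g2 =>
    simp only [casA, casB, casC, casP, casQ]
    convert! (((e 1).const_mul 1).add (((e 3).neg.div (e 4) h4').mul (e 2))).add_const 0 using 1
    simp; field_simp; ring
  | g3 =>
    simp only [casA, casB, casC, casP, casQ]
    convert! ((((hasDerivAt_const 0 1).div (e 3) h3').mul (e 1)).add
      (((hasDerivAt_const 0 (-1)).div (e 4) h4').mul (e 2))).add_const 0 using 1
    simp; field_simp; ring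
  | g4 =>
    simp only [casA, casB, casC, casP, casQ]
    convert! ((((e 4).neg.div (e 3) h3').mul (e 1)).add ((e 2).const_mul 1)).add_const 0 using 1
    simp; field_simp; ring
  | g9 =>
    simp only [casA, casB, casC, casP, casQ]
    convert! ((((hasDerivAt_const 0 1).div (e 3) h3').mul (e 1)).add
      (((hasDerivAt_const 0 (-1)).div (e 4) h4').mul (e 2))).add ((e 3).log h3') using 1
    simp; field_simp; ring
  | g10 lam =>
    simp only [casA, casB, casC, casP, casQ]
    convert! ((((hasDerivAt_const 0 1).div (e 3) h3').mul (e 1)).add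
      (((hasDerivAt_const 0 (-1)).div (e 4) h4').mul (e 2))).add
      (((e 4).log h4').sub (((e 3).log h3').const_mul lam)) using 1
    simp; field_simp; ring

/-- The derivative in the direction of `x₂` is `casA`. Its nonvanishing makes `f` a submersion on
`V` and singles out `x₂` as the coordinate to eliminate. -/
theorem fderiv_casimir_single_one_ne_zero (i : AlgLabel) {x : Fin 7 → ℝ} (hx : x ∈ genericSet) :
    fderiv ℝ i.casimir x (Pi.single 1 1) ≠ 0 := by
  obtain ⟨h3, h4⟩ := ne_zero_of_mem_genericSet hx
  rw [i.fderiv_casimir hx]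
  simpa using i.casA_ne_zero h3 h4

/-- The vector field on the dual of the Lie algebra by which `u` acts. -/
def coadField (i : AlgLabel) (u x : Fin 7 → ℝ) : Fin 7 → ℝ :=
  fun j => ∑ k, algBracket i u (Pi.single j 1) k * x k

theorem coadField_eq (i : AlgLabel) (u x : Fin 7 → ℝ) : i.coadField u x =
    match i with
    | g2 => ![u 5 * x 0 - u 1 * x 3 - u 2 * x 4, u 0 * x 3, u 6 * x 2 + u 0 * x 4, u 5 * x 3,
        (u 5 + u 6) * x 4, -(u 0 * x 0 + u 3 * x 3 + u 4 * x 4), -(u 2 * x 2 + u 4 * x 4)]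
    | g3 => ![-u 1 * x 3 - u 2 * x 4, u 5 * x 1 + u 0 * x 3, u 6 * x 2 + u 0 * x 4, u 5 * x 3,
        u 6 * x 4, -(u 1 * x 1 + u 3 * x 3), -(u 2 * x 2 + u 4 * x 4)]
    | g4 => ![u 5 * x 0 - u 1 * x 3 - u 2 * x 4, u 6 * x 1 + u 0 * x 3, u 0 * x 4,
        (u 5 + u 6) * x 3, u 5 * x 4, -(u 0 * x 0 + u 3 * x 3 + u 4 * x 4),
        -(u 1 * x 1 + u 3 * x 3)]
    | g9 => ![-u 1 * x 3 - u 2 * x 4, u 6 * x 1 + u 0 * x 3, u 5 * x 2 + u 0 * x 4 + u 6 * x 4,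
        u 6 * x 3, u 5 * x 4, -(u 2 * x 2 + u 4 * x 4), -(u 1 * x 1 + u 3 * x 3 + u 2 * x 4)]
    | g10 lam => ![-u 1 * x 3 - u 2 * x 4, u 5 * x 1 + u 0 * x 3,
        lam * u 5 * x 2 + u 6 * x 2 + u 0 * x 4 + u 6 * x 4, u 5 * x 3,
        lam * u 5 * x 4 + u 6 * x 4, -(u 1 * x 1 + u 3 * x 3 + lam * (u 2 * x 2 + u 4 * x 4)),
        -(u 2 * x 2 + u 4 * x 4 + u 2 * x 4)] := by
  cases i <;> ext j <;> fin_cases j <;>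
    simp [coadField, algBracket_eq, Fin.sum_univ_seven] <;> ring

/-- Infinitesimal invariance of `f`. The logarithms in `casC` disappear on differentiation, so each
label leaves an identity of rational functions with denominators `x 3`, `x 4`. -/
theorem fderiv_casimir_coadField (i : AlgLabel) {x : Fin 7 → ℝ} (hx : x ∈ genericSet)
    (u : Fin 7 → ℝ) : fderiv ℝ i.casimir x (i.coadField u x) = 0 := by
  obtain ⟨h3, h4⟩ := ne_zero_of_mem_genericSet hx
  rw [i.fderiv_casimir hx, coadField_eq]
  cases i <;> simp [casA, casB, casP, casQ] <;> field_simp <;> ring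

/-- The orbits thus have dimension at least six. With `u 1 = 0` the six equations form a triangular
system in the other `u k`, with pivots `± x 3` and `± x 4`. -/
theorem exists_coadField_eq (i : AlgLabel) {x : Fin 7 → ℝ} (hx : x ∈ genericSet)
    (y : Fin 7 → ℝ) : ∃ u, ∀ j, j ≠ 1 → i.coadField u x j = y j := by
  obtain ⟨h3, h4⟩ := ne_zero_of_mem_genericSet hx
  suffices h : ∃ u, i.coadField u x 0 = y 0 ∧ i.coadField u x 2 = y 2 ∧ i.coadField u x 3 = y 3 ∧
      i.coadField u x 4 = y 4 ∧ i.coadField u x 5 = y 5 ∧ i.coadField u x 6 = y 6 by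
    obtain ⟨u, h0, h2, h3, h4, h5, h6⟩ := h
    refine ⟨u, fun j hj => ?_⟩
    fin_cases j
    exacts [h0, absurd rfl hj, h2, h3, h4, h5, h6]
  simp only [coadField_eq]
  cases i with
  | g2 =>
    obtain ⟨u5, e5⟩ : ∃ t, t * x 3 = y 3 := ⟨y 3 / x 3, by field_simp⟩
    obtain ⟨u6, e6⟩ : ∃ t, (u5 + t) * x 4 = y 4 := ⟨y 4 / x 4 - u5, by field_simp; ring⟩
    obtain ⟨u0, e0⟩ : ∃ t, u6 * x 2 + t * x 4 = y 2 := ⟨(y 2 - u6 * x 2) / x 4, by field_simp; ring⟩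
    obtain ⟨u2, e2⟩ : ∃ t, u5 * x 0 - 0 * x 3 - t * x 4 = y 0 :=
      ⟨(u5 * x 0 - y 0) / x 4, by field_simp; ring⟩
    obtain ⟨u4, e4⟩ : ∃ t, -(u2 * x 2 + t * x 4) = y 6 :=
      ⟨-(y 6 + u2 * x 2) / x 4, by field_simp; ring⟩
    obtain ⟨u3, e3⟩ : ∃ t, -(u0 * x 0 + t * x 3 + u4 * x 4) = y 5 :=
      ⟨-(y 5 + u0 * x 0 + u4 * x 4) / x 3, by field_simp; ring⟩
    exact ⟨![u0, 0, u2, u3, u4, u5, u6], e2, e0, e5, e6, e3, e4⟩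
  | g3 =>
    obtain ⟨u5, e5⟩ : ∃ t, t * x 3 = y 3 := ⟨y 3 / x 3, by field_simp⟩
    obtain ⟨u6, e6⟩ : ∃ t, t * x 4 = y 4 := ⟨y 4 / x 4, by field_simp⟩
    obtain ⟨u0, e0⟩ : ∃ t, u6 * x 2 + t * x 4 = y 2 := ⟨(y 2 - u6 * x 2) / x 4, by field_simp; ring⟩
    obtain ⟨u2, e2⟩ : ∃ t, -0 * x 3 - t * x 4 = y 0 := ⟨-y 0 / x 4, by field_simp; ring⟩
    obtain ⟨u4, e4⟩ : ∃ t, -(u2 * x 2 + t * x 4) = y 6 :=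
      ⟨-(y 6 + u2 * x 2) / x 4, by field_simp; ring⟩
    obtain ⟨u3, e3⟩ : ∃ t, -(0 * x 1 + t * x 3) = y 5 := ⟨-y 5 / x 3, by field_simp; ring⟩
    exact ⟨![u0, 0, u2, u3, u4, u5, u6], e2, e0, e5, e6, e3, e4⟩
  | g4 =>
    obtain ⟨u5, e5⟩ : ∃ t, t * x 4 = y 4 := ⟨y 4 / x 4, by field_simp⟩
    obtain ⟨u6, e6⟩ : ∃ t, (u5 + t) * x 3 = y 3 := ⟨y 3 / x 3 - u5, by field_simp; ring⟩
    obtain ⟨u0, e0⟩ : ∃ t, t * x 4 = y 2 := ⟨y 2 / x 4, by field_simp⟩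
    obtain ⟨u2, e2⟩ : ∃ t, u5 * x 0 - 0 * x 3 - t * x 4 = y 0 :=
      ⟨(u5 * x 0 - y 0) / x 4, by field_simp; ring⟩
    obtain ⟨u3, e3⟩ : ∃ t, -(0 * x 1 + t * x 3) = y 6 := ⟨-y 6 / x 3, by field_simp; ring⟩
    obtain ⟨u4, e4⟩ : ∃ t, -(u0 * x 0 + u3 * x 3 + t * x 4) = y 5 :=
      ⟨-(y 5 + u0 * x 0 + u3 * x 3) / x 4, by field_simp; ring⟩
    exact ⟨![u0, 0, u2, u3, u4, u5, u6], e2, e0, e6, e5, e4, e3⟩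
  | g9 =>
    obtain ⟨u6, e6⟩ : ∃ t, t * x 3 = y 3 := ⟨y 3 / x 3, by field_simp⟩
    obtain ⟨u5, e5⟩ : ∃ t, t * x 4 = y 4 := ⟨y 4 / x 4, by field_simp⟩
    obtain ⟨u0, e0⟩ : ∃ t, u5 * x 2 + t * x 4 + u6 * x 4 = y 2 :=
      ⟨(y 2 - u5 * x 2 - u6 * x 4) / x 4, by field_simp; ring⟩
    obtain ⟨u2, e2⟩ : ∃ t, -0 * x 3 - t * x 4 = y 0 := ⟨-y 0 / x 4, by field_simp; ring⟩
    obtain ⟨u4, e4⟩ : ∃ t, -(u2 * x 2 + t * x 4) = y 5 :=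
      ⟨-(y 5 + u2 * x 2) / x 4, by field_simp; ring⟩
    obtain ⟨u3, e3⟩ : ∃ t, -(0 * x 1 + t * x 3 + u2 * x 4) = y 6 :=
      ⟨-(y 6 + u2 * x 4) / x 3, by field_simp; ring⟩
    exact ⟨![u0, 0, u2, u3, u4, u5, u6], e2, e0, e6, e5, e4, e3⟩
  | g10 lam =>
    obtain ⟨u5, e5⟩ : ∃ t, t * x 3 = y 3 := ⟨y 3 / x 3, by field_simp⟩
    obtain ⟨u6, e6⟩ : ∃ t, lam * u5 * x 4 + t * x 4 = y 4 :=
      ⟨y 4 / x 4 - lam * u5, by field_simp; ring⟩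
    obtain ⟨u0, e0⟩ : ∃ t, lam * u5 * x 2 + u6 * x 2 + t * x 4 + u6 * x 4 = y 2 :=
      ⟨(y 2 - lam * u5 * x 2 - u6 * x 2 - u6 * x 4) / x 4, by field_simp; ring⟩
    obtain ⟨u2, e2⟩ : ∃ t, -0 * x 3 - t * x 4 = y 0 := ⟨-y 0 / x 4, by field_simp; ring⟩
    obtain ⟨u4, e4⟩ : ∃ t, -(u2 * x 2 + t * x 4 + u2 * x 4) = y 6 :=
      ⟨-(y 6 + u2 * x 2 + u2 * x 4) / x 4, by field_simp; ring⟩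
    obtain ⟨u3, e3⟩ : ∃ t, -(0 * x 1 + t * x 3 + lam * (u2 * x 2 + u4 * x 4)) = y 5 :=
      ⟨-(y 5 + lam * (u2 * x 2 + u4 * x 4)) / x 3, by field_simp; ring⟩
    exact ⟨![u0, 0, u2, u3, u4, u5, u6], e2, e0, e5, e6, e3, e4⟩

end AlgLabel

/-! ### Coordinates on `V` and parametrization of the leaves -/

/-- The signs of the coordinates `x₄` and `x₅`. -/
noncomputable def signPair (x : Fin 7 → ℝ) : SignType × SignType :=
  (SignType.sign (x 3), SignType.sign (x 4))

/-- All coordinates but `x₂`. -/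
def dropCoord (x : Fin 7 → ℝ) : Fin 6 → ℝ := ![x 0, x 2, x 3, x 4, x 5, x 6]

theorem contDiff_dropCoord : ContDiff ℝ ∞ dropCoord := by
  rw [contDiff_pi]
  intro j
  fin_cases j <;> simp only [dropCoord] <;> exact contDiff_apply ℝ ℝ _

theorem sign_eq_sign_iff_mul_pos {a b : ℝ} (hb : b ≠ 0) :
    SignType.sign a = SignType.sign b ↔ 0 < b * a := by
  rcases lt_or_gt_of_ne hb with hb | hb
  · rw [sign_neg hb, sign_eq_neg_one_iff]
    exact ⟨mul_pos_of_neg_of_neg hb, fun h => (neg_iff_neg_of_mul_pos h).1 hb⟩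
  · rw [sign_pos hb, sign_eq_one_iff, mul_pos_iff_of_pos_left hb]

theorem signPair_eq_iff {x z : Fin 7 → ℝ} (hz : z ∈ genericSet) :
    signPair x = signPair z ↔ 0 < z 3 * x 3 ∧ 0 < z 4 * x 4 := by
  obtain ⟨h3, h4⟩ := AlgLabel.ne_zero_of_mem_genericSet hz
  rw [signPair, signPair, Prod.mk.injEq, sign_eq_sign_iff_mul_pos h3, sign_eq_sign_iff_mul_pos h4]

theorem mem_genericSet_of_signPair_eq {x z : Fin 7 → ℝ} (hz : z ∈ genericSet)
    (h : signPair x = signPair z) : x ∈ genericSet := by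
  obtain ⟨h3, h4⟩ := (signPair_eq_iff hz).1 h
  exact mul_ne_zero (right_ne_zero_of_mul h3.ne') (right_ne_zero_of_mul h4.ne')

theorem isOpen_setOf_signPair_eq {z : Fin 7 → ℝ} (hz : z ∈ genericSet) :
    IsOpen {x | signPair x = signPair z} := by
  simp only [signPair_eq_iff hz]
  exact (isOpen_lt (f := fun _ => 0) (g := fun x : Fin 7 → ℝ => z 3 * x 3) continuous_const
    (by fun_prop)).inter (isOpen_lt (f := fun _ => 0) (g := fun x : Fin 7 → ℝ => z 4 * x 4)
    continuous_const (by fun_prop))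

namespace AlgLabel

/-- The point with given coordinates other than `x₂` and given value of the Casimir function. -/
noncomputable def fillCoord (i : AlgLabel) (p : Fin 6 → ℝ) (t : ℝ) : Fin 7 → ℝ :=
  ![p 0, (t - i.casB (p 2) (p 3) * p 1 - i.casC (p 2) (p 3)) / i.casA (p 2) (p 3), p 1, p 2, p 3,
    p 4, p 5]

theorem dropCoord_fillCoord (i : AlgLabel) (p : Fin 6 → ℝ) (t : ℝ) :
    dropCoord (i.fillCoord p t) = p := by
  ext j; fin_cases j <;> rfl

theorem casimir_fillCoord (i : AlgLabel) {p : Fin 6 → ℝ} (h2 : p 2 ≠ 0) (h3 : p 3 ≠ 0) (t : ℝ) :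
    i.casimir (i.fillCoord p t) = t := by
  have := i.casA_ne_zero h2 h3
  simp only [casimir, fillCoord, Matrix.cons_val]
  field_simp
  ring

/-- `f` is affine in `x₂` with slope `casA ≠ 0`, so `x₂` is recovered from the value of `f` and the
remaining coordinates. -/
theorem fillCoord_dropCoord (i : AlgLabel) {x : Fin 7 → ℝ} (hx : x ∈ genericSet) :
    i.fillCoord (dropCoord x) (i.casimir x) = x := by
  obtain ⟨h3, h4⟩ := ne_zero_of_mem_genericSet hx
  have := i.casA_ne_zero h3 h4
  ext j
  fin_cases j
  pick_goal 2
  · simp only [casimir, fillCoord, dropCoord]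
    simp
    field_simp
    ring
  all_goals rfl

theorem eq_of_dropCoord_eq (i : AlgLabel) {x y : Fin 7 → ℝ} (hx : x ∈ genericSet)
    (hy : y ∈ genericSet) (h : dropCoord x = dropCoord y) (hc : i.casimir x = i.casimir y) :
    x = y := by
  rw [← i.fillCoord_dropCoord hx, ← i.fillCoord_dropCoord hy, h, hc]

theorem contDiffAt_fillCoord (i : AlgLabel) {F : Type*} [NormedAddCommGroup F] [NormedSpace ℝ F]
    {p : F → Fin 6 → ℝ} {t : F → ℝ} {y : F} (hp : ContDiffAt ℝ ∞ p y) (ht : ContDiffAt ℝ ∞ t y)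
    (h2 : p y 2 ≠ 0) (h3 : p y 3 ≠ 0) : ContDiffAt ℝ ∞ (fun y => i.fillCoord (p y) (t y)) y := by
  have e : ∀ k, ContDiffAt ℝ ∞ (fun y => p y k) y := contDiffAt_pi.1 hp
  rw [contDiffAt_pi]
  intro j
  fin_cases j
  · exact e 0
  · exact ((ht.sub ((i.contDiffAt_casB_comp (e 2) (e 3) h3).mul (e 1))).sub
      (i.contDiffAt_casC_comp (e 2) (e 3) h2 h3)).div (i.contDiffAt_casA_comp (e 2) (e 3) h2)
      (i.casA_ne_zero h2 h3)
  · exact e 1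
  · exact e 2
  · exact e 3
  · exact e 4
  · exact e 5

/-- The leaf through `z`. -/
def leafThrough (i : AlgLabel) (z : Fin 7 → ℝ) : Set (Fin 7 → ℝ) :=
  {x | signPair x = signPair z ∧ i.casimir x = i.casimir z}

theorem mem_leafThrough_self (i : AlgLabel) (z : Fin 7 → ℝ) : z ∈ i.leafThrough z := ⟨rfl, rfl⟩

/-- The leaf coordinates on the quadrant of `z`, without restrictions on their values. -/
noncomputable def quadrantCoord (z : Fin 7 → ℝ) (m : EuclideanSpace ℝ (Fin 6)) : Fin 6 → ℝ :=
  ![m 0, m 1, z 3 * Real.exp (m 2), z 4 * Real.exp (m 3), m 4, m 5]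

theorem contDiff_quadrantCoord (z : Fin 7 → ℝ) : ContDiff ℝ ∞ (quadrantCoord z) := by
  have e : ∀ k : Fin 6, ContDiff ℝ ∞ (fun m : EuclideanSpace ℝ (Fin 6) => m k) := fun k => by
    fun_prop
  rw [contDiff_pi]
  intro j
  fin_cases j
  exacts [e 0, e 1, contDiff_const.mul (e 2).exp, contDiff_const.mul (e 3).exp, e 4, e 5]

/-- A parametrization of the leaf through `z`. -/
noncomputable def leafParam (i : AlgLabel) (z : Fin 7 → ℝ) (m : EuclideanSpace ℝ (Fin 6)) :
    Fin 7 → ℝ :=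
  i.fillCoord (quadrantCoord z m) (i.casimir z)

theorem dropCoord_leafParam (i : AlgLabel) (z : Fin 7 → ℝ) (m : EuclideanSpace ℝ (Fin 6)) :
    dropCoord (i.leafParam z m) = quadrantCoord z m := i.dropCoord_fillCoord _ _

theorem quadrantCoord_ne_zero {z : Fin 7 → ℝ} (hz : z ∈ genericSet)
    (m : EuclideanSpace ℝ (Fin 6)) : quadrantCoord z m 2 ≠ 0 ∧ quadrantCoord z m 3 ≠ 0 := by
  obtain ⟨h3, h4⟩ := ne_zero_of_mem_genericSet hz
  exact ⟨mul_ne_zero h3 (Real.exp_ne_zero _), mul_ne_zero h4 (Real.exp_ne_zero _)⟩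

theorem casimir_leafParam (i : AlgLabel) {z : Fin 7 → ℝ} (hz : z ∈ genericSet)
    (m : EuclideanSpace ℝ (Fin 6)) : i.casimir (i.leafParam z m) = i.casimir z :=
  i.casimir_fillCoord (quadrantCoord_ne_zero hz m).1 (quadrantCoord_ne_zero hz m).2 _

theorem contDiff_leafParam (i : AlgLabel) {z : Fin 7 → ℝ} (hz : z ∈ genericSet) :
    ContDiff ℝ ∞ (i.leafParam z) :=
  contDiff_iff_contDiffAt.2 fun m => i.contDiffAt_fillCoord
    (contDiff_quadrantCoord z).contDiffAt contDiffAt_const (quadrantCoord_ne_zero hz m).1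
    (quadrantCoord_ne_zero hz m).2

theorem quadrantCoord_injective {z : Fin 7 → ℝ} (hz : z ∈ genericSet) :
    Function.Injective (quadrantCoord z) := by
  obtain ⟨h3, h4⟩ := ne_zero_of_mem_genericSet hz
  intro m m' h
  have e := fun k => congrFun h k
  have e2 : m 2 = m' 2 := Real.exp_injective (mul_left_cancel₀ h3 (e 2))
  have e3 : m 3 = m' 3 := Real.exp_injective (mul_left_cancel₀ h4 (e 3))
  ext j
  fin_cases j
  exacts [e 0, e 1, e2, e3, e 4, e 5]

theorem leafParam_injective (i : AlgLabel) {z : Fin 7 → ℝ} (hz : z ∈ genericSet) :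
    Function.Injective (i.leafParam z) := by
  intro m m' h
  apply quadrantCoord_injective hz
  rw [← i.dropCoord_leafParam, ← i.dropCoord_leafParam, h]

/-- The factors `exp` keep the signs of `z 3`, `z 4` and reach every number of these signs, so all
of `ℝ⁶` covers exactly one leaf; logarithms of quotients invert the parametrization. -/
theorem range_leafParam (i : AlgLabel) {z : Fin 7 → ℝ} (hz : z ∈ genericSet) :
    range (i.leafParam z) = i.leafThrough z := by
  obtain ⟨h3, h4⟩ := ne_zero_of_mem_genericSet hz
  ext x
  constructor
  · rintro ⟨m, rfl⟩
    refine ⟨(signPair_eq_iff hz).2 ⟨?_, ?_⟩, i.casimir_leafParam hz m⟩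
    · change 0 < z 3 * (z 3 * Real.exp (m 2))
      have := Real.exp_pos (m 2)
      rw [← mul_assoc]
      exact mul_pos (mul_self_pos.2 h3) this
    · change 0 < z 4 * (z 4 * Real.exp (m 3))
      have := Real.exp_pos (m 3)
      rw [← mul_assoc]
      exact mul_pos (mul_self_pos.2 h4) this
  · rintro ⟨hs, hc⟩
    have hx := mem_genericSet_of_signPair_eq hz hs
    obtain ⟨p3, p4⟩ := (signPair_eq_iff hz).1 hs
    have hlog : ∀ {a b : ℝ}, 0 < a * b → a * Real.exp (Real.log (b / a)) = b := by
      intro a b hab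
      have ha : a ≠ 0 := left_ne_zero_of_mul hab.ne'
      have : 0 < b / a := by
        rw [← mul_div_mul_left b a ha]
        exact div_pos hab (mul_self_pos.2 ha)
      rw [Real.exp_log this]; field_simp
    refine ⟨!₂[x 0, x 2, Real.log (x 3 / z 3), Real.log (x 4 / z 4), x 5, x 6], ?_⟩
    have : quadrantCoord z !₂[x 0, x 2, Real.log (x 3 / z 3), Real.log (x 4 / z 4), x 5, x 6] =
        dropCoord x := by
      ext j
      fin_cases j
      exacts [rfl, rfl, hlog p3, hlog p4, rfl, rfl]
    rw [leafParam, this, ← hc, i.fillCoord_dropCoord hx]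

theorem isPreconnected_leafThrough (i : AlgLabel) {z : Fin 7 → ℝ} (hz : z ∈ genericSet) :
    IsPreconnected (i.leafThrough z) := by
  rw [← i.range_leafParam hz]
  exact isPreconnected_range (i.contDiff_leafParam hz).continuous

end AlgLabel

/-! ### Generic coadjoint orbits are the leaves -/

theorem sign_cast_injective : Function.Injective ((↑) : SignType → ℝ) := by
  intro a b h
  cases a <;> cases b <;> first | rfl | (exfalso; norm_num at h)

theorem linearForm_eq_sum {E : Type*} [AddCommGroup E] [Module ℝ E]
    (c : E ≃ₗ[ℝ] (Fin 7 → ℝ)) (F : E →ₗ[ℝ] ℝ) (v : E) :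
    F v = ∑ k, c v k * F (c.symm (Pi.single k 1)) := by
  have h : v = ∑ k, c v k • c.symm (Pi.single k 1) := by
    apply c.injective
    ext k
    simp [Finset.sum_apply, Pi.single_apply]
  conv_lhs => rw [h]
  simp only [map_sum, map_smul, smul_eq_mul]

section CoadjointPoints

open Filter Topology

variable {E : Type*} [NormedAddCommGroup E] [NormedSpace ℝ E] [FiniteDimensional ℝ E]

/-- The coordinates of `F ∘ A` when `F` is the linear form with coordinates `x`. -/
noncomputable def coadPoint (c : E ≃ₗ[ℝ] (Fin 7 → ℝ)) (x : Fin 7 → ℝ) :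
    (E →L[ℝ] E) →L[ℝ] (Fin 7 → ℝ) :=
  LinearMap.toContinuousLinearMap
    { toFun := fun A j => ∑ k, c (A (c.symm (Pi.single j 1))) k * x k
      map_add' := fun A B => by
        ext j; simp [add_mul, Finset.sum_add_distrib]
      map_smul' := fun r A => by
        ext j; simp [mul_assoc, Finset.mul_sum] }

theorem coadPoint_apply (c : E ≃ₗ[ℝ] (Fin 7 → ℝ)) (x : Fin 7 → ℝ) (A : E →L[ℝ] E) (j : Fin 7) :
    coadPoint c x A j = ∑ k, c (A (c.symm (Pi.single j 1))) k * x k := rfl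

theorem coadPoint_id (c : E ≃ₗ[ℝ] (Fin 7 → ℝ)) (x : Fin 7 → ℝ) :
    coadPoint c x (ContinuousLinearMap.id ℝ E) = x := by
  ext j
  simp [coadPoint_apply, Pi.single_apply]

/-- Composition of operators becomes a right action on the coordinates of linear forms. This makes
the sets `coordOrbit` true orbits and reduces derivatives at `g` to derivatives at the unit. -/
theorem coadPoint_comp (c : E ≃ₗ[ℝ] (Fin 7 → ℝ)) (x : Fin 7 → ℝ) (A B : E →L[ℝ] E) :
    coadPoint c x (A.comp B) = coadPoint c (coadPoint c x A) B := by
  ext j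
  simp only [coadPoint_apply, ContinuousLinearMap.comp_apply]
  have h : B (c.symm (Pi.single j 1)) =
      ∑ l, c (B (c.symm (Pi.single j 1))) l • c.symm (Pi.single l 1) := by
    apply c.injective
    ext k
    simp [Finset.sum_apply, Pi.single_apply]
  conv_lhs => rw [h]
  simp only [map_sum, map_smul, Finset.sum_apply, Pi.smul_apply, smul_eq_mul, Finset.sum_mul,
    Finset.mul_sum]
  rw [Finset.sum_comm]
  simp only [mul_assoc]

variable {G : Type*} [TopologicalSpace G] [ChartedSpace E G] [Group G]

variable (G) in
/-- The coadjoint orbit of the linear form with coordinates `x`, in coordinates. -/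
def coordOrbit (c : E ≃ₗ[ℝ] (Fin 7 → ℝ)) (x : Fin 7 → ℝ) : Set (Fin 7 → ℝ) :=
  range fun g : G => coadPoint c x (groupAd E g)

theorem mem_coordOrbit_self (c : E ≃ₗ[ℝ] (Fin 7 → ℝ)) (x : Fin 7 → ℝ) : x ∈ coordOrbit G c x :=
  ⟨1, by simp only [groupAd_one, coadPoint_id]⟩

variable [LieGroup 𝓘(ℝ, E) ∞ G] (c : E ≃ₗ[ℝ] (Fin 7 → ℝ)) {i : AlgLabel}

theorem coadPoint_adDeriv (hc : ∀ v w, c (groupBracket E G v w) = AlgLabel.algBracket i (c v) (c w))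
    (x : Fin 7 → ℝ) (v : E) : coadPoint c x (adDeriv E G v) = i.coadField (c v) x := by
  ext j
  simp [coadPoint_apply, adDeriv_apply, hc, AlgLabel.coadField]

theorem coordOrbit_eq_of_mem {x y : Fin 7 → ℝ} (h : y ∈ coordOrbit G c x) :
    coordOrbit G c y = coordOrbit G c x := by
  obtain ⟨g, rfl⟩ := h
  ext z
  constructor
  · rintro ⟨k, rfl⟩
    exact ⟨g * k, by simp only [groupAd_mul, coadPoint_comp]⟩
  · rintro ⟨k, rfl⟩
    refine ⟨g⁻¹ * k, ?_⟩
    simp only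
    rw [← coadPoint_comp, ← groupAd_mul, mul_inv_cancel_left]

/-- The line spanned by a common eigenvector of the adjoint representation is preserved. -/
theorem coadPoint_groupAd_apply_eq_mul [PreconnectedSpace G]
    (hc : ∀ v w, c (groupBracket E G v w) = AlgLabel.algBracket i (c v) (c w))
    {j : Fin 7} (hj : ∀ u, ∃ a : ℝ, AlgLabel.algBracket i u (Pi.single j 1) = a • Pi.single j 1)
    (x : Fin 7 → ℝ) (g : G) : ∃ r : ℝ, r ≠ 0 ∧ coadPoint c x (groupAd E g) j = r * x j := by
  let ε : E →L[ℝ] ℝ := LinearMap.toContinuousLinearMap (LinearMap.proj j ∘ₗ c.toLinearMap)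
  have key : ∀ g : G, ∃ r : ℝ,
      groupAd E g (c.symm (Pi.single j 1)) = r • c.symm (Pi.single j 1) := by
    refine exists_groupAd_eq_smul (ε := ε) (by simp [ε]) fun w => ?_
    obtain ⟨a, ha⟩ := hj (c w)
    refine ⟨a, c.injective ?_⟩
    rw [hc, c.apply_symm_apply, ha, map_smul, c.apply_symm_apply]
  obtain ⟨r, hr⟩ := key g
  refine ⟨r, ?_, ?_⟩
  -- A factor zero would contradict the invertibility of `Ad g`.
  · rintro rfl
    have h1 : groupAd E (g⁻¹ * g) (c.symm (Pi.single j 1)) = c.symm (Pi.single j 1) := by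
      simp [groupAd_one]
    rw [groupAd_mul, ContinuousLinearMap.comp_apply, hr, zero_smul, map_zero] at h1
    have := congrFun (congrArg c h1) j
    simp at this
  · simp [coadPoint_apply, hr, Pi.single_apply]

/-- The coordinate never vanishes along the orbit, so its sign is locally constant as a function of
the operator near each `Ad g`. Read as a real number it has zero derivative, and `comp_groupAd_eq`
applies. -/
theorem sign_coadPoint_groupAd [PreconnectedSpace G]
    (hc : ∀ v w, c (groupBracket E G v w) = AlgLabel.algBracket i (c v) (c w))
    {j : Fin 7} (hj : ∀ u, ∃ a : ℝ, AlgLabel.algBracket i u (Pi.single j 1) = a • Pi.single j 1)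
    {x : Fin 7 → ℝ} (hx : x j ≠ 0) (g : G) :
    SignType.sign (coadPoint c x (groupAd E g) j) = SignType.sign (x j) := by
  have h : ((SignType.sign (coadPoint c x (groupAd E g) j) : SignType) : ℝ) =
      (SignType.sign (coadPoint c x (ContinuousLinearMap.id ℝ E) j) : SignType) := by
    refine comp_groupAd_eq (Ψ := fun A : E →L[ℝ] E =>
      ((SignType.sign (coadPoint c x A j) : SignType) : ℝ)) (Ψ' := fun _ => 0) (fun g => ?_)
      (fun _ _ => by simp) g
    obtain ⟨r, hr, hrx⟩ := coadPoint_groupAd_apply_eq_mul c hc hj x g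
    have hne : coadPoint c x (groupAd E g) j ≠ 0 := by rw [hrx]; exact mul_ne_zero hr hx
    have h1 : ContinuousAt (fun A : E →L[ℝ] E => SignType.sign (coadPoint c x A j)) (groupAd E g) :=
      ContinuousAt.comp (f := fun A : E →L[ℝ] E => coadPoint c x A j)
        (continuousAt_sign_of_ne_zero hne)
        ((continuous_apply j).comp (coadPoint c x).continuous).continuousAt
    have h2 : ∀ᶠ A in 𝓝 (groupAd E g), SignType.sign (coadPoint c x A j) =
        SignType.sign (coadPoint c x (groupAd E g) j) :=
      h1.eventually (eventually_of_mem ((isOpen_discrete {_}).mem_nhds rfl) fun _ h => h)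
    refine (hasFDerivAt_const ((SignType.sign (coadPoint c x (groupAd E g) j) : SignType) : ℝ)
      _).congr_of_eventuallyEq ?_
    filter_upwards [h2] with A hA
    rw [hA]
  rw [coadPoint_id] at h
  exact sign_cast_injective h

/-- `X₄` and `X₅` span ideals in every one of the algebras; the eigenvalue is read off as the `j`-th
component of the bracket. -/
theorem exists_algBracket_single_eq_smul (i : AlgLabel) {j : Fin 7} (hj : j = 3 ∨ j = 4)
    (u : Fin 7 → ℝ) : ∃ a : ℝ, AlgLabel.algBracket i u (Pi.single j 1) = a • Pi.single j 1 := by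
  refine ⟨AlgLabel.algBracket i u (Pi.single j 1) j, ?_⟩
  rcases hj with rfl | rfl <;> cases i <;> ext k <;> fin_cases k <;>
    simp [AlgLabel.algBracket_eq]

theorem coordOrbit_subset_leafThrough [PreconnectedSpace G]
    (hc : ∀ v w, c (groupBracket E G v w) = AlgLabel.algBracket i (c v) (c w))
    {x : Fin 7 → ℝ} (hx : x ∈ genericSet) : coordOrbit G c x ⊆ i.leafThrough x := by
  obtain ⟨h3, h4⟩ := AlgLabel.ne_zero_of_mem_genericSet hx
  have hs : ∀ g : G, signPair (coadPoint c x (groupAd E g)) = signPair x := fun g =>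
    Prod.ext (sign_coadPoint_groupAd c hc (exists_algBracket_single_eq_smul i (.inl rfl)) h3 g)
      (sign_coadPoint_groupAd c hc (exists_algBracket_single_eq_smul i (.inr rfl)) h4 g)
  rintro _ ⟨g, rfl⟩
  refine ⟨hs g, ?_⟩
  -- The signs had to come first: they keep the orbit inside `V`, where `f` is differentiable.
  have h := comp_groupAd_eq (G := G) (Ψ := fun A : E →L[ℝ] E => i.casimir (coadPoint c x A))
    (Ψ' := fun g => (fderiv ℝ i.casimir (coadPoint c x (groupAd E g))).comp (coadPoint c x))
    (fun g => ?_) (fun g v => ?_) g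
  · rwa [coadPoint_id] at h
  · have hg := mem_genericSet_of_signPair_eq hx (hs g)
    exact HasFDerivAt.comp (g := i.casimir) _
      ((i.contDiffAt_casimir hg).differentiableAt (by simp)).hasFDerivAt
      (coadPoint c x).hasFDerivAt
  · have hg := mem_genericSet_of_signPair_eq hx (hs g)
    rw [ContinuousLinearMap.comp_apply, coadPoint_comp, coadPoint_adDeriv c hc,
      i.fderiv_casimir_coadField hg]

/-- Orbits are open in leaves. Dropping `x₂`, the orbit map has surjective derivative at the unit,
hence covers a neighbourhood in `ℝ⁶`; two points of a leaf that agree off `x₂` are equal because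
they share the value of `f`. -/
theorem eventually_mem_coordOrbit [PreconnectedSpace G]
    (hc : ∀ v w, c (groupBracket E G v w) = AlgLabel.algBracket i (c v) (c w))
    {x : Fin 7 → ℝ} (hx : x ∈ genericSet) :
    ∀ᶠ y in 𝓝 x, y ∈ i.leafThrough x → y ∈ coordOrbit G c x := by
  have : CompleteSpace E := FiniteDimensional.complete ℝ E
  let drop : (Fin 7 → ℝ) →L[ℝ] (Fin 6 → ℝ) := LinearMap.toContinuousLinearMap
    { toFun := dropCoord
      map_add' := fun a b => by ext j; fin_cases j <;> rfl
      map_smul' := fun r a => by ext j; fin_cases j <;> rfl }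
  have hd : HasStrictFDerivAt (fun s => drop (coadPoint c x
      (groupAd E ((extChartAt 𝓘(ℝ, E) (1 : G)).symm s))))
      ((drop.comp (coadPoint c x)).comp (adDeriv E G)) (extChartAt 𝓘(ℝ, E) (1 : G) 1) :=
    (drop.comp (coadPoint c x)).hasStrictFDerivAt.comp _ hasStrictFDerivAt_groupAd_chart
  have hsurj : ((drop.comp (coadPoint c x)).comp (adDeriv E G)).range = ⊤ := by
    rw [LinearMap.range_eq_top]
    intro y
    -- The entry `0` at the index of `x₂` is a filler: that component is not prescribed.
    obtain ⟨u, hu⟩ := i.exists_coadField_eq hx ![y 0, 0, y 1, y 2, y 3, y 4, y 5]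
    refine ⟨c.symm u, ?_⟩
    change dropCoord (coadPoint c x (adDeriv E G (c.symm u))) = y
    rw [coadPoint_adDeriv c hc, c.apply_symm_apply]
    ext j
    fin_cases j
    exacts [hu 0 (by decide), hu 2 (by decide), hu 3 (by decide), hu 4 (by decide),
      hu 5 (by decide), hu 6 (by decide)]
  have hmap := hd.map_nhds_eq_of_surj hsurj
  have h0 : drop (coadPoint c x (groupAd E ((extChartAt 𝓘(ℝ, E) (1 : G)).symm
      (extChartAt 𝓘(ℝ, E) (1 : G) 1)))) = dropCoord x := by
    rw [chart_one_symm, groupAd_one, coadPoint_id]; rfl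
  rw [h0] at hmap
  have h1 : ∀ᶠ p in 𝓝 (dropCoord x), ∃ g : G, dropCoord (coadPoint c x (groupAd E g)) = p := by
    rw [← hmap, eventually_map]
    exact Eventually.of_forall fun s => ⟨_, rfl⟩
  filter_upwards [contDiff_dropCoord.continuous.continuousAt.eventually h1] with y hy hyL
  obtain ⟨g, hg⟩ := hy
  have hgL := coordOrbit_subset_leafThrough c hc hx ⟨g, rfl⟩
  refine ⟨g, i.eq_of_dropCoord_eq (mem_genericSet_of_signPair_eq hx hgL.1)
    (mem_genericSet_of_signPair_eq hx hyL.1) hg (hgL.2.trans hyL.2.symm)⟩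

/-- The generic coadjoint orbits are the leaves. -/
theorem coordOrbit_eq_leafThrough [PreconnectedSpace G]
    (hc : ∀ v w, c (groupBracket E G v w) = AlgLabel.algBracket i (c v) (c w))
    {x : Fin 7 → ℝ} (hx : x ∈ genericSet) : coordOrbit G c x = i.leafThrough x := by
  refine (coordOrbit_subset_leafThrough c hc hx).antisymm fun y hy => ?_
  -- Nearby points of a leaf have the same orbit, so the orbit is constant along the connected
  -- parameter space `ℝ⁶`.
  have hloc : IsLocallyConstant fun m => coordOrbit G c (i.leafParam x m) := by
    rw [IsLocallyConstant.iff_eventually_eq]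
    intro m
    have hL : ∀ m, i.leafParam x m ∈ i.leafThrough x := fun m => by
      rw [← i.range_leafParam hx]; exact mem_range_self m
    have hm : i.leafParam x m ∈ genericSet := mem_genericSet_of_signPair_eq hx (hL m).1
    filter_upwards [(i.contDiff_leafParam hx).continuous.continuousAt.eventually
      (eventually_mem_coordOrbit c hc hm)] with m' hm'
    exact coordOrbit_eq_of_mem c
      (hm' ⟨(hL m').1.trans (hL m).1.symm, (hL m').2.trans (hL m).2.symm⟩)
  have hx' := i.mem_leafThrough_self x
  rw [← i.range_leafParam hx] at hy hx'
  obtain ⟨m, rfl⟩ := hy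
  obtain ⟨m₀, hm₀⟩ := hx'
  have := hloc.apply_eq_of_preconnectedSpace m m₀
  simp only [hm₀] at this
  rw [← this]
  exact mem_coordOrbit_self c _

end CoadjointPoints

section GenericOrbits

variable {i : AlgLabel} {G : Type*} [TopologicalSpace G]
  [ChartedSpace (EuclideanSpace ℝ (Fin 7)) G] [Group G] [LieGroup (𝓡 7) ∞ G]

/-- The coordinates on the Lie algebra, as a linear isomorphism from the model space. -/
noncomputable def lieCoord (e : GroupLieAlgebra (𝓡 7) G ≃ₗ⁅ℝ⁆ i.Alg) :
    EuclideanSpace ℝ (Fin 7) ≃ₗ[ℝ] (Fin 7 → ℝ) :=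
  e.toLinearEquiv

theorem lieCoord_groupBracket (e : GroupLieAlgebra (𝓡 7) G ≃ₗ⁅ℝ⁆ i.Alg)
    (v w : EuclideanSpace ℝ (Fin 7)) :
    lieCoord e (groupBracket _ G v w) = AlgLabel.algBracket i (lieCoord e v) (lieCoord e w) :=
  e.map_lie v w

theorem dualCoord_comp (e : GroupLieAlgebra (𝓡 7) G ≃ₗ⁅ℝ⁆ i.Alg)
    (F : Module.Dual ℝ (GroupLieAlgebra (𝓡 7) G)) (g : G) :
    dualCoord e (coadjoint g F) =
      coadPoint (lieCoord e) (dualCoord e F) (groupAd (EuclideanSpace ℝ (Fin 7)) g⁻¹) := by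
  ext j
  rw [coadPoint_apply]
  exact linearForm_eq_sum (lieCoord e) F _

/-- The coadjoint action uses `Ad (g⁻¹)` and `coordOrbit` uses `Ad g`; inversion on the group
matches the two orbits. Every coordinate vector comes from a linear form, so every leaf occurs. -/
theorem genericOrbits_eq [PreconnectedSpace G] (e : GroupLieAlgebra (𝓡 7) G ≃ₗ⁅ℝ⁆ i.Alg) :
    genericOrbits e = {L | ∃ z ∈ genericSet, L = i.leafThrough z} := by
  have horb : ∀ F : Module.Dual ℝ (GroupLieAlgebra (𝓡 7) G),
      dualCoord e '' coadjointOrbit F = coordOrbit G (lieCoord e) (dualCoord e F) := by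
    intro F
    ext y
    constructor
    · rintro ⟨_, ⟨g, rfl⟩, rfl⟩
      exact ⟨g⁻¹, (dualCoord_comp e F g).symm⟩
    · rintro ⟨g, rfl⟩
      refine ⟨_, ⟨g⁻¹, rfl⟩, ?_⟩
      simp only [dualCoord_comp, inv_inv]
  ext L
  constructor
  · rintro ⟨F, hF, rfl⟩
    exact ⟨_, hF, by rw [horb, coordOrbit_eq_leafThrough _ (lieCoord_groupBracket e) hF]⟩
  · rintro ⟨z, hz, rfl⟩
    obtain ⟨F, hF⟩ : ∃ F : Module.Dual ℝ (GroupLieAlgebra (𝓡 7) G), dualCoord e F = z := by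
      let F : EuclideanSpace ℝ (Fin 7) →ₗ[ℝ] ℝ :=
        (Fintype.linearCombination ℝ z : (Fin 7 → ℝ) →ₗ[ℝ] ℝ) ∘ₗ (lieCoord e).toLinearMap
      refine ⟨F, ?_⟩
      ext j
      have : F ((lieCoord e).symm (Pi.single j 1)) = z j := by
        simp [F, Fintype.linearCombination_apply, Pi.single_apply]
      exact this
    exact ⟨F, hF.symm ▸ hz, by
      rw [horb, hF, coordOrbit_eq_leafThrough _ (lieCoord_groupBracket e) hz]⟩

end GenericOrbits

/-! ### A frame and a `6`-vector for the kernel of a linear form -/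

section KernelFrame

/-- A basis of the kernel of a linear form that does not vanish on the second basis vector. -/
noncomputable def kerFrame (l : (Fin 7 → ℝ) →L[ℝ] ℝ) (k : Fin 6) : Fin 7 → ℝ :=
  Pi.single (Fin.succAbove 1 k) 1 -
    (l (Pi.single (Fin.succAbove 1 k) 1) / l (Pi.single 1 1)) • Pi.single 1 1

variable {l : (Fin 7 → ℝ) →L[ℝ] ℝ}

theorem apply_kerFrame (hl : l (Pi.single 1 1) ≠ 0) (k : Fin 6) : l (kerFrame l k) = 0 := by
  rw [kerFrame, map_sub, map_smul, smul_eq_mul, div_mul_cancel₀ _ hl, sub_self]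

theorem kerFrame_apply_succAbove (j k : Fin 6) :
    kerFrame l k (Fin.succAbove 1 j) = if j = k then 1 else 0 := by
  simp [kerFrame, Pi.single_apply]

theorem linearIndependent_kerFrame : LinearIndependent ℝ (kerFrame l) := by
  rw [Fintype.linearIndependent_iff]
  intro g hg j
  have := congrFun hg (Fin.succAbove 1 j)
  simpa [Finset.sum_apply, kerFrame_apply_succAbove] using this

/-- The splitting of the space into the kernel of `l` and the line of the second basis vector: each
other basis vector differs from its frame vector by a multiple of that vector. -/
theorem eq_sum_kerFrame_add (hl : l (Pi.single 1 1) ≠ 0) (u : Fin 7 → ℝ) :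
    u = ∑ k, u (Fin.succAbove 1 k) • kerFrame l k +
      (l u / l (Pi.single 1 1)) • Pi.single 1 1 := by
  have h1 : u = ∑ k : Fin 6, u (Fin.succAbove 1 k) • Pi.single (Fin.succAbove 1 k) (1 : ℝ) +
      u 1 • Pi.single 1 1 := by
    have := pi_eq_sum_univ' u
    rw [Fin.sum_univ_succAbove _ 1, add_comm] at this
    exact this
  have h2 : l u = ∑ k : Fin 6, u (Fin.succAbove 1 k) * l (Pi.single (Fin.succAbove 1 k) 1) +
      u 1 * l (Pi.single 1 1) := by
    conv_lhs => rw [h1]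
    simp only [map_add, map_sum, map_smul, smul_eq_mul]
  rw [h2, add_div, mul_div_cancel_right₀ _ hl, add_smul, ← add_assoc]
  conv_lhs => rw [h1]
  congr 1
  simp only [kerFrame, smul_sub, Finset.sum_sub_distrib, Finset.sum_div, Finset.sum_smul,
    smul_smul, mul_div_assoc, sub_add_cancel]

theorem span_range_kerFrame (hl : l (Pi.single 1 1) ≠ 0) :
    Submodule.span ℝ (range (kerFrame l)) = l.ker := by
  apply le_antisymm
  · rw [Submodule.span_le]
    rintro _ ⟨k, rfl⟩
    exact apply_kerFrame hl k
  · intro u hu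
    have hu0 : l u = 0 := hu
    rw [eq_sum_kerFrame_add hl u, hu0, zero_div, zero_smul, add_zero]
    exact Submodule.sum_mem _ fun k _ =>
      Submodule.smul_mem _ _ (Submodule.subset_span (mem_range_self k))

/-- The decomposable `6`-vector that represents the kernel of a linear form, normalized such that
its exterior product with `u` has the volume `± l u`. -/
noncomputable def kerVector (l : (Fin 7 → ℝ) →L[ℝ] ℝ) : ⋀[ℝ]^6 (Fin 7 → ℝ) :=
  l (Pi.single 1 1) • exteriorPower.ιMulti ℝ 6 (kerFrame l)

theorem exists_kerVector_eq_ιMulti (hl : l (Pi.single 1 1) ≠ 0) :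
    ∃ Y : Fin 6 → Fin 7 → ℝ, LinearIndependent ℝ Y ∧ Submodule.span ℝ (range Y) = l.ker ∧
      kerVector l = exteriorPower.ιMulti ℝ 6 Y := by
  -- The scalar in `kerVector` is absorbed by the first frame vector; working with units keeps
  -- linear independence and the span.
  let w : Fin 6 → ℝˣ := fun k => if k = 0 then Units.mk0 _ hl else 1
  have hw : ∏ k, ((w k : ℝˣ) : ℝ) = l (Pi.single 1 1) := by
    simp [w, Fin.prod_univ_six]
  refine ⟨w • kerFrame l, linearIndependent_kerFrame.units_smul w, ?_, ?_⟩
  · rw [← span_range_kerFrame hl]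
    apply le_antisymm <;> rw [Submodule.span_le] <;> rintro _ ⟨k, rfl⟩
    · exact Submodule.smul_mem _ ((w k : ℝˣ) : ℝ) (Submodule.subset_span (mem_range_self k))
    · have : kerFrame l k = ((w k)⁻¹ : ℝˣ) • (w • kerFrame l) k := by simp
      rw [this]
      exact Submodule.smul_mem _ (((w k)⁻¹ : ℝˣ) : ℝ) (Submodule.subset_span (mem_range_self k))
  · rw [kerVector, ← hw]
    exact ((exteriorPower.ιMulti ℝ 6).map_smul_univ (fun k => ((w k : ℝˣ) : ℝ)) _).symm

end KernelFrame

section Smoothness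

variable {F : Type*} [NormedAddCommGroup F] [NormedSpace ℝ F]

/-- Multilinear expansion in the standard basis turns `η (Y x)` into a polynomial in the components
of the vectors `Y x k`. -/
theorem contDiffOn_alternatingMap_apply (η : (Fin 7 → ℝ) [⋀^Fin 6]→ₗ[ℝ] ℝ) {s : Set F}
    {Y : F → Fin 6 → Fin 7 → ℝ} (hY : ∀ k, ContDiffOn ℝ ∞ (fun x => Y x k) s) :
    ContDiffOn ℝ ∞ (fun x => η (Y x)) s := by
  have h : ∀ x, η (Y x) = ∑ r : Fin 6 → Fin 7, (∏ k, Y x k (r k)) *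
      η (fun k => Pi.single (r k) (1 : ℝ)) := by
    intro x
    have hx : Y x = fun k => ∑ j, Y x k j • Pi.single j (1 : ℝ) := by
      ext1 k; exact pi_eq_sum_univ' _
    conv_lhs => rw [hx]
    refine (η.toMultilinearMap.map_sum _).trans (Finset.sum_congr rfl fun r _ => ?_)
    exact η.toMultilinearMap.map_smul_univ _ _
  simp only [h]
  refine ContDiffOn.sum fun r _ => ContDiffOn.mul (contDiffOn_prod fun k _ => ?_) contDiffOn_const
  exact contDiffOn_pi.1 (hY k) (r k)

end Smoothness

/-! ### The foliation by the leaves -/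

namespace AlgLabel

open Filter Topology

/-- The tangent spaces of the leaves. -/
noncomputable def leafTangent (i : AlgLabel) (x : Fin 7 → ℝ) : Submodule ℝ (Fin 7 → ℝ) :=
  (fderiv ℝ i.casimir x).ker

theorem contDiffOn_fderiv_casimir_apply (i : AlgLabel) (u : Fin 7 → ℝ) :
    ContDiffOn ℝ ∞ (fun x => fderiv ℝ i.casimir x u) genericSet := fun x hx =>
  (((i.contDiffAt_casimir hx).fderiv_right (m := (∞ : ℕ∞ω)) (by simp)).clm_apply
    contDiffAt_const).contDiffWithinAt

theorem contDiffOn_kerFrame (i : AlgLabel) (k : Fin 6) :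
    ContDiffOn ℝ ∞ (fun x => kerFrame (fderiv ℝ i.casimir x) k) genericSet :=
  contDiffOn_const.sub (((i.contDiffOn_fderiv_casimir_apply _).div
    (i.contDiffOn_fderiv_casimir_apply _)
    fun _ hx => i.fderiv_casimir_single_one_ne_zero hx).smul contDiffOn_const)

theorem isSmoothSubbundle_leafTangent (i : AlgLabel) :
    IsSmoothSubbundle 6 genericSet i.leafTangent := fun _ hx =>
  ⟨genericSet, isOpen_genericSet, hx, Subset.rfl, fun k x => kerFrame (fderiv ℝ i.casimir x) k,
    i.contDiffOn_kerFrame, fun _ hy => ⟨linearIndependent_kerFrame,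
      span_range_kerFrame (i.fderiv_casimir_single_one_ne_zero hy)⟩⟩

theorem isLeafVolumeField_kerVector (i : AlgLabel) :
    IsLeafVolumeField genericSet i.leafTangent fun x => kerVector (fderiv ℝ i.casimir x) where
  smooth η := by
    simp only [kerVector, map_smul, exteriorPower.alternatingMapLinearEquiv_apply_ιMulti,
      smul_eq_mul]
    exact (i.contDiffOn_fderiv_casimir_apply _).mul
      (contDiffOn_alternatingMap_apply η i.contDiffOn_kerFrame)
  generates _ hx := exists_kerVector_eq_ιMulti (i.fderiv_casimir_single_one_ne_zero hx)

/-- The differential is diagonal, with entries `1`, `z 3 * exp (m 2)` and `z 4 * exp (m 3)`. -/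
theorem fderiv_quadrantCoord_injective {z : Fin 7 → ℝ} (hz : z ∈ genericSet)
    (m : EuclideanSpace ℝ (Fin 6)) : Function.Injective (fderiv ℝ (quadrantCoord z) m) := by
  obtain ⟨h3, h4⟩ := ne_zero_of_mem_genericSet hz
  rw [injective_iff_map_eq_zero]
  intro v hv
  have hd := ((contDiff_quadrantCoord z).differentiable (by simp) m).hasFDerivAt
  have hj := fun j => hasFDerivAt_pi'.1 hd j
  have e : ∀ k : Fin 6, HasFDerivAt (fun m : EuclideanSpace ℝ (Fin 6) => m k)
      (EuclideanSpace.proj k : EuclideanSpace ℝ (Fin 6) →L[ℝ] ℝ) m := fun k =>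
    (EuclideanSpace.proj k : EuclideanSpace ℝ (Fin 6) →L[ℝ] ℝ).hasFDerivAt
  have hz : ∀ j, fderiv ℝ (quadrantCoord z) m v j = 0 := fun j => congrFun hv j
  have u0 := DFunLike.congr_fun ((hj 0).unique (e 0)) v
  have u1 := DFunLike.congr_fun ((hj 1).unique (e 1)) v
  have u2 := DFunLike.congr_fun ((hj 2).unique ((e 2).exp.const_mul (z 3))) v
  have u3 := DFunLike.congr_fun ((hj 3).unique ((e 3).exp.const_mul (z 4))) v
  have u4 := DFunLike.congr_fun ((hj 4).unique (e 4)) v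
  have u5 := DFunLike.congr_fun ((hj 5).unique (e 5)) v
  simp [hz, h3, h4] at u0 u1 u2 u3 u4 u5
  ext j
  fin_cases j
  exacts [u0.symm, u1.symm, u2, u3, u4.symm, u5.symm]

/-- `dropCoord` after the parametrization is `quadrantCoord`, whose differential is injective, so
the inner factor is injective too. -/
theorem fderiv_leafParam_injective (i : AlgLabel) {z : Fin 7 → ℝ} (hz : z ∈ genericSet)
    (m : EuclideanSpace ℝ (Fin 6)) : Function.Injective (fderiv ℝ (i.leafParam z) m) := by
  have h : dropCoord ∘ i.leafParam z = quadrantCoord z := by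
    ext1 m; exact i.dropCoord_leafParam z m
  have h1 := fderiv_comp m (contDiff_dropCoord.differentiable (by simp) (i.leafParam z m))
    ((i.contDiff_leafParam hz).differentiable (by simp) m)
  rw [h] at h1
  have h2 := fderiv_quadrantCoord_injective hz m
  rw [h1, ContinuousLinearMap.coe_comp] at h2
  exact h2.of_comp

theorem leafParam_mem (i : AlgLabel) {z : Fin 7 → ℝ} (hz : z ∈ genericSet)
    (m : EuclideanSpace ℝ (Fin 6)) : i.leafParam z m ∈ genericSet := by
  have : i.leafParam z m ∈ i.leafThrough z := by
    rw [← i.range_leafParam hz]; exact mem_range_self m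
  exact mem_genericSet_of_signPair_eq hz this.1

/-- `f` is constant along the parametrization, which gives one inclusion; both spaces have dimension
six. -/
theorem range_fderiv_leafParam (i : AlgLabel) {z : Fin 7 → ℝ} (hz : z ∈ genericSet)
    (m : EuclideanSpace ℝ (Fin 6)) :
    (fderiv ℝ (i.leafParam z) m).range = i.leafTangent (i.leafParam z m) := by
  have hm := i.leafParam_mem hz m
  have hc : i.casimir ∘ i.leafParam z = fun _ => i.casimir z := by
    ext m; exact i.casimir_leafParam hz m
  have h1 := fderiv_comp m ((i.contDiffAt_casimir hm).differentiableAt (by simp))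
    ((i.contDiff_leafParam hz).differentiable (by simp) m)
  rw [hc, fderiv_fun_const] at h1
  refine Submodule.eq_of_le_of_finrank_eq ?_ ?_
  · rintro _ ⟨v, rfl⟩
    exact (DFunLike.congr_fun h1 v).symm
  · have hne : (fderiv ℝ i.casimir (i.leafParam z m) : (Fin 7 → ℝ) →ₗ[ℝ] ℝ) ≠ 0 := by
      intro h
      exact i.fderiv_casimir_single_one_ne_zero hm (DFunLike.congr_fun h _)
    have h2 := Module.Dual.finrank_ker_add_one_of_ne_zero hne
    have h3 := LinearMap.finrank_range_of_inj (f := (fderiv ℝ (i.leafParam z) m).toLinearMap)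
      (i.fderiv_leafParam_injective hz m)
    rw [Module.finrank_fin_fun] at h2
    rw [finrank_euclideanSpace_fin] at h3
    refine h3.trans ?_
    change 6 = Module.finrank ℝ (LinearMap.ker
      (fderiv ℝ i.casimir (i.leafParam z m) : (Fin 7 → ℝ) →ₗ[ℝ] ℝ))
    omega

theorem isImmersedIn_leafParam (i : AlgLabel) {z : Fin 7 → ℝ} (hz : z ∈ genericSet) :
    IsImmersedIn 6 genericSet (i.leafParam z) where
  isManifold := inferInstance
  t2 := inferInstance
  secondCountable := inferInstance
  contMDiff := (i.contDiff_leafParam hz).contMDiff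
  injective := i.leafParam_injective hz
  mem := i.leafParam_mem hz
  immersion m := by
    have := i.fderiv_leafParam_injective hz m
    rw [← mfderiv_eq_fderiv] at this
    exact this

theorem immersedTangent_leafParam (i : AlgLabel) {z : Fin 7 → ℝ} (hz : z ∈ genericSet)
    (m : EuclideanSpace ℝ (Fin 6)) :
    immersedTangent 6 (i.leafParam z) m = i.leafTangent (i.leafParam z m) := by
  rw [← i.range_fderiv_leafParam hz m]
  exact congrArg (fun L : EuclideanSpace ℝ (Fin 6) →L[ℝ] (Fin 7 → ℝ) => L.range)
    (mfderiv_eq_fderiv (f := i.leafParam z) (x := m))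

theorem isConnectedIntegralManifold_leafThrough (i : AlgLabel) {z : Fin 7 → ℝ}
    (hz : z ∈ genericSet) :
    IsConnectedIntegralManifold 6 genericSet i.leafTangent (i.leafThrough z) :=
  ⟨EuclideanSpace ℝ (Fin 6), _, _, i.leafParam z, inferInstance, i.isImmersedIn_leafParam hz,
    i.immersedTangent_leafParam hz, i.range_leafParam hz⟩

/-- A connected integral manifold is contained in a leaf. -/
theorem subset_leafThrough_of_isConnectedIntegralManifold (i : AlgLabel) {W : Set (Fin 7 → ℝ)}
    (hW : IsConnectedIntegralManifold 6 genericSet i.leafTangent W) {z : Fin 7 → ℝ} (hz : z ∈ W) :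
    W ⊆ i.leafThrough z := by
  obtain ⟨M, _, _, ι, hM, hι, ht, rfl⟩ := hW
  have := hι.isManifold
  have : IsManifold (𝓡 6) 1 M := IsManifold.of_le (n := (∞ : ℕ∞ω)) (by simp)
  obtain ⟨m₀, rfl⟩ := hz
  rintro _ ⟨m, rfl⟩
  constructor
  -- The quadrants of `V` are open, so the pair of signs is locally constant along the connected
  -- manifold; `f` is constant there because its differential kills the tangent spaces.
  · have hl : IsLocallyConstant fun m => signPair (ι m) := by
      rw [IsLocallyConstant.iff_eventually_eq]
      intro m
      exact hι.contMDiff.continuous.continuousAt.eventually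
        ((isOpen_setOf_signPair_eq (hι.mem m)).mem_nhds rfl)
    exact hl.apply_eq_of_preconnectedSpace m m₀
  · refine eq_of_hasMFDerivAt_zero (E := EuclideanSpace ℝ (Fin 6)) (u := fun m => i.casimir (ι m))
      (fun m => ?_) m m₀
    have h1 : HasMFDerivAt (𝓡 6) 𝓘(ℝ, Fin 7 → ℝ) ι m (mfderiv (𝓡 6) 𝓘(ℝ, Fin 7 → ℝ) ι m) :=
      (hι.contMDiff.mdifferentiable (by simp) m).hasMFDerivAt
    have h2 : HasFDerivAt i.casimir (fderiv ℝ i.casimir (ι m)) (ι m) :=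
      ((i.contDiffAt_casimir (hι.mem m)).differentiableAt (by simp)).hasFDerivAt
    have h3 := h2.hasMFDerivAt.comp m h1
    have h4 : ∀ v : EuclideanSpace ℝ (Fin 6), fderiv ℝ i.casimir (ι m)
        ((mfderiv (𝓡 6) 𝓘(ℝ, Fin 7 → ℝ) ι m : EuclideanSpace ℝ (Fin 6) →L[ℝ] (Fin 7 → ℝ)) v) =
          0 := by
      intro v
      have h5 : (mfderiv (𝓡 6) 𝓘(ℝ, Fin 7 → ℝ) ι m :
          EuclideanSpace ℝ (Fin 6) →L[ℝ] (Fin 7 → ℝ)) v ∈ immersedTangent 6 ι m := ⟨v, rfl⟩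
      rw [ht m] at h5
      exact h5
    have h6 : (fderiv ℝ i.casimir (ι m)).comp
        (mfderiv (𝓡 6) 𝓘(ℝ, Fin 7 → ℝ) ι m : EuclideanSpace ℝ (Fin 6) →L[ℝ] (Fin 7 → ℝ)) = 0 :=
      ContinuousLinearMap.ext h4
    exact (h6 ▸ h3 :)

/-- The family of the leaves. -/
def leaves (i : AlgLabel) : Set (Set (Fin 7 → ℝ)) := {L | ∃ z ∈ genericSet, L = i.leafThrough z}

theorem leafThrough_eq (i : AlgLabel) {x z : Fin 7 → ℝ} (h : x ∈ i.leafThrough z) :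
    i.leafThrough z = i.leafThrough x := by
  ext y
  simp only [leafThrough, mem_ofPred_eq, h.1, h.2]

theorem formsFoliation_leaves (i : AlgLabel) :
    FormsFoliation 6 genericSet i.leafTangent i.leaves where
  isOpen := isOpen_genericSet
  smooth := i.isSmoothSubbundle_leafTangent
  integrable x hx := ⟨i.leafThrough x, i.mem_leafThrough_self x, by
    obtain ⟨M, a, b, ι, -, h⟩ := i.isConnectedIntegralManifold_leafThrough hx
    exact ⟨M, a, b, ι, h⟩⟩
  nonempty := by
    rintro _ ⟨z, -, rfl⟩
    exact ⟨z, i.mem_leafThrough_self z⟩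
  pairwiseDisjoint := by
    rintro _ ⟨z, -, rfl⟩ _ ⟨w, -, rfl⟩ hne
    refine disjoint_left.2 fun x hx hx' => hne ?_
    rw [i.leafThrough_eq hx, i.leafThrough_eq hx']
  sUnion_eq := by
    ext x
    constructor
    · rintro ⟨_, ⟨z, hz, rfl⟩, hx⟩
      exact mem_genericSet_of_signPair_eq hz hx.1
    · exact fun hx => ⟨_, ⟨x, hx, rfl⟩, i.mem_leafThrough_self x⟩
  leaf := by
    rintro _ ⟨z, hz, rfl⟩
    refine ⟨i.isConnectedIntegralManifold_leafThrough hz, fun W hW hle => ?_⟩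
    -- A connected integral manifold containing the leaf passes through `z`, hence is contained in
    -- the leaf of `z`.
    exact i.subset_leafThrough_of_isConnectedIntegralManifold hW (hle (i.mem_leafThrough_self z))

/-- The foliation chart on the quadrant of `z`. -/
noncomputable def quadrantChart (i : AlgLabel) {z : Fin 7 → ℝ} (hz : z ∈ genericSet) :
    OpenPartialHomeomorph (Fin 7 → ℝ) ((Fin 6 → ℝ) × (Fin 1 → ℝ)) where
  toFun x := (dropCoord x, fun _ => i.casimir x)
  invFun q := i.fillCoord q.1 (q.2 0)
  source := {x | signPair x = signPair z}
  target := {p : Fin 6 → ℝ | 0 < z 3 * p 2 ∧ 0 < z 4 * p 3} ×ˢ univ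
  map_source' x hx := ⟨(signPair_eq_iff hz).1 hx, mem_univ _⟩
  map_target' q hq := (signPair_eq_iff hz).2 hq.1
  left_inv' x hx := i.fillCoord_dropCoord (mem_genericSet_of_signPair_eq hz hx)
  right_inv' q hq := by
    refine Prod.ext (i.dropCoord_fillCoord _ _) ?_
    ext k
    rw [Subsingleton.elim k 0]
    exact i.casimir_fillCoord (right_ne_zero_of_mul hq.1.1.ne')
      (right_ne_zero_of_mul hq.1.2.ne') _
  open_source := isOpen_setOf_signPair_eq hz
  open_target := by
    refine IsOpen.prod (IsOpen.inter ?_ ?_) isOpen_univ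
    · exact isOpen_lt (f := fun _ => 0) (g := fun p : Fin 6 → ℝ => z 3 * p 2) continuous_const
        (by fun_prop)
    · exact isOpen_lt (f := fun _ => 0) (g := fun p : Fin 6 → ℝ => z 4 * p 3) continuous_const
        (by fun_prop)
  continuousOn_toFun x hx := by
    have hx' := mem_genericSet_of_signPair_eq hz hx
    exact (contDiff_dropCoord.continuous.continuousAt.prodMk (continuousAt_pi.2 fun _ =>
      (i.contDiffAt_casimir hx').continuousAt)).continuousWithinAt
  continuousOn_invFun q hq := by
    exact (i.contDiffAt_fillCoord contDiffAt_fst (contDiffAt_pi.1 contDiffAt_snd 0)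
      (right_ne_zero_of_mul hq.1.1.ne')
      (right_ne_zero_of_mul hq.1.2.ne')).continuousAt.continuousWithinAt

/-- The chart domain is a whole quadrant. A leaf that meets it lies inside it and is connected, so
each plaque is an entire leaf. -/
theorem isFoliationChart_quadrantChart (i : AlgLabel) {z : Fin 7 → ℝ} (hz : z ∈ genericSet) :
    IsFoliationChart genericSet i.leaves (i.quadrantChart hz) where
  source_subset x hx := mem_genericSet_of_signPair_eq hz hx
  smooth x hx := by
    have hx' := mem_genericSet_of_signPair_eq hz hx
    exact (contDiff_dropCoord.contDiffAt.prodMk (contDiffAt_pi.2 fun _ =>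
      i.contDiffAt_casimir hx')).contDiffWithinAt
  smooth_symm q hq := (i.contDiffAt_fillCoord contDiffAt_fst (contDiffAt_pi.1 contDiffAt_snd 0)
    (right_ne_zero_of_mul hq.1.1.ne') (right_ne_zero_of_mul hq.1.2.ne')).contDiffWithinAt
  target_eq := ⟨_, _, rfl⟩
  plaque := by
    rintro _ ⟨w, hw, rfl⟩ x ⟨hxw, hxz⟩
    have hxz' : signPair x = signPair z := hxz
    have hx := mem_genericSet_of_signPair_eq hz hxz'
    rw [i.leafThrough_eq hxw]
    have h1 : i.leafThrough x ∩ (i.quadrantChart hz).source = i.leafThrough x :=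
      inter_eq_left.2 fun y hy => hy.1.trans hxz'
    rw [h1, (i.isPreconnected_leafThrough hx).connectedComponentIn (i.mem_leafThrough_self x)]
    ext y
    constructor
    · rintro ⟨hs, hc⟩
      exact ⟨hs.trans hxz', funext fun _ => hc⟩
    · rintro ⟨hs, hc⟩
      exact ⟨Eq.trans hs hxz'.symm, congrFun hc 0⟩

end AlgLabel

/-! ### Transverse measures from sections -/

section TransverseMeasure

open Filter Topology

variable {E S : Type*} [MeasurableSpace E] {q : ℕ}

/-- A Borel subset of `V` that meets each leaf at most once, where the leaves are the common level
sets of the label `σ` and of the transverse coordinates `τ`, and where `σ` is constant. -/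
structure IsLeafSection (V : Set E) (σ : E → S) (τ : E → Fin q → ℝ) (C : Set E) : Prop where
  measurableSet : MeasurableSet C
  subset : C ⊆ V
  injOn : InjOn τ C
  label : ∀ x ∈ C, ∀ y ∈ C, σ x = σ y

/-- The measure on a section that corresponds to the Lebesgue measure in the transverse
coordinates. -/
noncomputable def sectionMeasure (τ : E → Fin q → ℝ) (C : Set E) : Measure E :=
  ((volume : Measure (Fin q → ℝ)).comap fun c : C => τ c).map Subtype.val

/-- The measure whose value on a Borel set is the supremum of the sums of the measures of disjoint
sections contained in it. -/
noncomputable def transverseMeasure (V : Set E) (σ : E → S) (τ : E → Fin q → ℝ) : Measure E :=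
  ⨆ (C : Set E) (_ : IsLeafSection V σ τ C), sectionMeasure τ C

variable {V : Set E} {σ : E → S} {τ : E → Fin q → ℝ}

theorem IsLeafSection.mono {C C' : Set E} (hC : IsLeafSection V σ τ C) (hC' : MeasurableSet C')
    (h : C' ⊆ C) : IsLeafSection V σ τ C' :=
  ⟨hC', h.trans hC.subset, hC.injOn.mono h, fun x hx y hy => hC.label x (h hx) y (h hy)⟩

variable [TopologicalSpace E] [BorelSpace E] [StandardBorelSpace E]

/-- An injective measurable map from a standard Borel space has Borel images of Borel sets
(Lusin–Souslin), so the pulled back measure can be evaluated on images. -/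
theorem IsLeafSection.measurableEmbedding (hτ : ContinuousOn τ V) {C : Set E}
    (hC : IsLeafSection V σ τ C) : MeasurableEmbedding fun c : C => τ c := by
  have : StandardBorelSpace C := hC.measurableSet.standardBorel
  refine Measurable.measurableEmbedding ?_ (injOn_iff_injective.1 hC.injOn)
  exact (continuousOn_iff_continuous_domRestrict.1 (hτ.mono hC.subset)).measurable

theorem sectionMeasure_apply (hτ : ContinuousOn τ V) {C B : Set E} (hC : IsLeafSection V σ τ C)
    (hB : MeasurableSet B) : sectionMeasure τ C B = volume (τ '' (B ∩ C)) := by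
  rw [sectionMeasure, Measure.map_apply measurable_subtype_coe hB,
    (hC.measurableEmbedding hτ).comap_apply]
  congr 1
  ext t
  constructor
  · rintro ⟨c, hc, rfl⟩
    exact ⟨c, ⟨hc, c.2⟩, rfl⟩
  · rintro ⟨x, ⟨hx, hxC⟩, rfl⟩
    exact ⟨⟨x, hxC⟩, hx, rfl⟩

theorem volume_image_le_transverseMeasure (hτ : ContinuousOn τ V) {C : Set E}
    (hC : IsLeafSection V σ τ C) : volume (τ '' C) ≤ transverseMeasure V σ τ C := by
  have h : sectionMeasure τ C ≤ transverseMeasure V σ τ :=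
    le_iSup₂ (f := fun C (_ : IsLeafSection V σ τ C) => sectionMeasure τ C) C hC
  have := h C
  rwa [sectionMeasure_apply hτ hC hC.measurableSet, inter_self] at this

/-- A measure is an upper bound if it is so on a Borel set `B` and agrees with the transverse
measure off `B`. -/
theorem transverseMeasure_le (hτ : ContinuousOn τ V) {B : Set E} (hB : MeasurableSet B)
    {m : Measure E} (h : ∀ C ⊆ B, IsLeafSection V σ τ C → volume (τ '' C) ≤ m C) :
    transverseMeasure V σ τ ≤ m + (transverseMeasure V σ τ).restrict Bᶜ := by
  refine iSup₂_le fun C hC => Measure.le_iff.2 fun A hA => ?_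
  rw [sectionMeasure_apply hτ hC hA, Measure.add_apply, Measure.restrict_apply hA]
  have hin := hC.mono ((hA.inter hC.measurableSet).inter hB)
    (inter_subset_left.trans inter_subset_right)
  have hout := hC.mono ((hA.inter hC.measurableSet).inter hB.compl)
    (inter_subset_left.trans inter_subset_right)
  -- Any piece of a section is split by `B`: the part inside is bounded through `h`, the part
  -- outside by the transverse measure itself.
  calc volume (τ '' (A ∩ C)) = volume (τ '' (A ∩ C ∩ B) ∪ τ '' (A ∩ C ∩ Bᶜ)) := by
        rw [← image_union, inter_union_compl]
    _ ≤ volume (τ '' (A ∩ C ∩ B)) + volume (τ '' (A ∩ C ∩ Bᶜ)) := measure_union_le _ _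
    _ ≤ m A + transverseMeasure V σ τ (A ∩ Bᶜ) := by
        refine add_le_add ?_ ?_
        · exact (h _ inter_subset_right hin).trans
            (measure_mono (inter_subset_left.trans inter_subset_left))
        · exact (volume_image_le_transverseMeasure hτ hout).trans
            (measure_mono (inter_subset_inter_left _ inter_subset_left))

/-- On subsets of `C` every competing section gets exactly the mass that `sectionMeasure τ C` gives
it, so the supremum adds nothing on `C`. -/
theorem transverseMeasure_section (hτ : ContinuousOn τ V) {C : Set E}
    (hC : IsLeafSection V σ τ C) : transverseMeasure V σ τ C = volume (τ '' C) := by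
  refine le_antisymm ?_ (volume_image_le_transverseMeasure hτ hC)
  have h := transverseMeasure_le hτ hC.measurableSet (σ := σ) (m := sectionMeasure τ C)
    fun C' hC' h' => by
      rw [sectionMeasure_apply hτ hC h'.measurableSet, inter_eq_left.2 hC']
  have := h C
  rw [Measure.add_apply, sectionMeasure_apply hτ hC hC.measurableSet, inter_self,
    Measure.restrict_apply hC.measurableSet, inter_compl_self, measure_empty, add_zero] at this
  exact this

/-- `ψ` preserves `σ` and `τ`, so it carries sections in `B₁` to sections in `B₂` with the same
values of `τ`. The transverse measure of `B₂` transported back by `ψ.symm` is therefore an upper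
bound on `B₁`. -/
theorem transverseMeasure_le_of_measurableEquiv (hτ : ContinuousOn τ V) {B₁ B₂ : Set E}
    (hB₁ : MeasurableSet B₁) (hB₂ : MeasurableSet B₂) (hV : B₂ ⊆ V) (ψ : B₁ ≃ᵐ B₂)
    (hψ : ∀ x : B₁, σ (ψ x) = σ x ∧ τ (ψ x) = τ x) :
    transverseMeasure V σ τ B₁ ≤ transverseMeasure V σ τ B₂ := by
  let Λ := transverseMeasure V σ τ
  let m : Measure E := (Λ.comap (Subtype.val : B₂ → E)).map fun y => (ψ.symm y : E)
  have hmeas : Measurable fun y : B₂ => (ψ.symm y : E) :=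
    measurable_subtype_coe.comp ψ.symm.measurable
  have hm : ∀ A, MeasurableSet A →
      m A = Λ (Subtype.val '' {y : B₂ | (ψ.symm y : E) ∈ A}) := by
    intro A hA
    rw [Measure.map_apply hmeas hA, (MeasurableEmbedding.subtype_coe hB₂).comap_apply]
    rfl
  have h := transverseMeasure_le hτ hB₁ (σ := σ) (m := m) fun C hCB hC => by
    rw [hm C hC.measurableSet]
    set C' : Set E := Subtype.val '' {y : B₂ | (ψ.symm y : E) ∈ C} with hC'
    have hback : ∀ y : B₂, σ (y : E) = σ (ψ.symm y) ∧ τ (y : E) = τ (ψ.symm y) := fun y => by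
      have := hψ (ψ.symm y)
      rwa [ψ.apply_symm_apply] at this
    have hs : IsLeafSection V σ τ C' := by
      refine ⟨hB₂.subtype_image (hmeas hC.measurableSet), ?_, ?_, ?_⟩
      · rintro _ ⟨y, -, rfl⟩
        exact hV y.2
      · rintro _ ⟨y, hy, rfl⟩ _ ⟨y', hy', rfl⟩ he
        rw [(hback y).2, (hback y').2] at he
        exact congrArg _ (ψ.symm.injective (Subtype.ext (hC.injOn hy hy' he)))
      · rintro _ ⟨y, hy, rfl⟩ _ ⟨y', hy', rfl⟩
        rw [(hback y).1, (hback y').1]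
        exact hC.label _ hy _ hy'
    have himg : τ '' C ⊆ τ '' C' := by
      rintro _ ⟨x, hx, rfl⟩
      refine ⟨ψ ⟨x, hCB hx⟩, ⟨_, ?_, rfl⟩, (hψ ⟨x, hCB hx⟩).2⟩
      simpa using hx
    exact (measure_mono himg).trans (volume_image_le_transverseMeasure hτ hs)
  have h1 := h B₁
  rw [Measure.add_apply, Measure.restrict_apply hB₁, inter_compl_self, measure_empty, add_zero,
    hm B₁ hB₁] at h1
  refine h1.trans (measure_mono ?_)
  rintro _ ⟨y, -, rfl⟩
  exact y.2

theorem transverseMeasure_eq_of_measurableEquiv (hτ : ContinuousOn τ V) {B₁ B₂ : Set E}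
    (hB₁ : MeasurableSet B₁) (hB₂ : MeasurableSet B₂) (hV₁ : B₁ ⊆ V) (hV₂ : B₂ ⊆ V)
    (ψ : B₁ ≃ᵐ B₂) (hψ : ∀ x : B₁, σ (ψ x) = σ x ∧ τ (ψ x) = τ x) :
    transverseMeasure V σ τ B₁ = transverseMeasure V σ τ B₂ := by
  refine le_antisymm (transverseMeasure_le_of_measurableEquiv hτ hB₁ hB₂ hV₂ ψ hψ)
    (transverseMeasure_le_of_measurableEquiv hτ hB₂ hB₁ hV₁ ψ.symm fun y => ?_)
  have := hψ (ψ.symm y)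
  rw [ψ.apply_symm_apply] at this
  exact ⟨this.1.symm, this.2.symm⟩

/-- The transverse measure of a compact set is finite if the set is locally a section. -/
theorem transverseMeasure_lt_top [T2Space E] (hτ : ContinuousOn τ V) {K : Set E} (hK : IsCompact K)
    (hKV : K ⊆ V) (h : ∀ x ∈ K, ∃ U ∈ 𝓝 x, InjOn τ (K ∩ U) ∧ ∀ y ∈ K ∩ U, σ y = σ x) :
    transverseMeasure V σ τ K < ⊤ := by
  -- `τ '' K` is compact, so each section inside `K` has finite measure, and finitely many of them
  -- cover `K`.
  have hbd : volume (τ '' K) < ⊤ := (hK.image_of_continuousOn (hτ.mono hKV)).measure_lt_top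
  choose! U hU hinj hlab using h
  obtain ⟨t, hcov⟩ := hK.elim_nhds_subcover' (fun x _ => interior (U x))
    fun x hx => interior_mem_nhds.2 (hU x hx)
  have hsub : K ⊆ ⋃ x ∈ t, K ∩ interior (U (x : E)) := by
    intro y hy
    obtain ⟨x, hx, hyx⟩ := mem_iUnion₂.1 (hcov hy)
    exact mem_iUnion₂.2 ⟨x, hx, hy, hyx⟩
  refine (measure_mono hsub).trans_lt ((measure_biUnion_finset_le t _).trans_lt ?_)
  refine ENNReal.sum_lt_top.2 fun x _ => ?_
  have hs : IsLeafSection V σ τ (K ∩ interior (U (x : E))) :=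
    ⟨hK.measurableSet.inter isOpen_interior.measurableSet, inter_subset_left.trans hKV,
      (hinj x x.2).mono (inter_subset_inter_right _ interior_subset), fun y hy z hz =>
        (hlab x x.2 y ⟨hy.1, interior_subset hy.2⟩).trans
          (hlab x x.2 z ⟨hz.1, interior_subset hz.2⟩).symm⟩
  rw [transverseMeasure_section hτ hs]
  exact (measure_mono (image_mono inter_subset_left)).trans_lt hbd

end TransverseMeasure

/-! ### Local injectivity on transverse submanifolds -/

section LocalInjectivity

open Filter Topology

variable {E F : Type*} [NormedAddCommGroup E] [NormedSpace ℝ E]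
  [NormedAddCommGroup F] [NormedSpace ℝ F] [FiniteDimensional ℝ F]

theorem HasStrictFDerivAt.exists_injOn_of_injective [FiniteDimensional ℝ E] {f : E → F}
    {f' : E →L[ℝ] F} {a : E}
    (hf : HasStrictFDerivAt f f' a) (hinj : Function.Injective f')
    (hdim : Module.finrank ℝ E = Module.finrank ℝ F) : ∃ U ∈ 𝓝 a, InjOn f U := by
  have : CompleteSpace E := FiniteDimensional.complete ℝ E
  let L : E ≃L[ℝ] F :=
    (LinearEquiv.ofInjectiveOfFinrankEq f'.toLinearMap hinj hdim).toContinuousLinearEquiv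
  have hL : (L : E →L[ℝ] F) = f' := by ext v; rfl
  rw [← hL] at hf
  exact ⟨_, (hf.toOpenPartialHomeomorph f).open_source.mem_nhds
    hf.mem_toOpenPartialHomeomorph_source, (hf.toOpenPartialHomeomorph f).injOn⟩

/-- A function whose differential is injective on the tangent space of an immersed submanifold is
locally injective on it. -/
theorem IsImmersedIn.exists_injOn_comp {V : Set E} {q : ℕ} {M : Type} [TopologicalSpace M]
    [ChartedSpace (EuclideanSpace ℝ (Fin q)) M] {ι : M → E} (hι : IsImmersedIn q V ι) {f : E → F}
    {m : M} (hf : ContDiffAt ℝ ∞ f (ι m)) (hF : Module.finrank ℝ F = q)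
    (hinj : Disjoint (immersedTangent q ι m) (fderiv ℝ f (ι m)).ker) :
    ∃ U ∈ 𝓝 m, InjOn (f ∘ ι) U := by
  have := hι.isManifold
  set φ := extChartAt (𝓡 q) m with hφ
  have h1 : ContDiffAt ℝ ∞ (ι ∘ φ.symm) (φ m) := by
    have := (contMDiffAt_iff.1 (hι.contMDiff m)).2
    rw [modelWithCornersSelf_coe, range_id, contDiffWithinAt_univ] at this
    exact this
  have hsm : φ.symm (φ m) = m := extChartAt_to_inv m
  have h2 : ContDiffAt ℝ ∞ (f ∘ (ι ∘ φ.symm)) (φ m) := by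
    refine ContDiffAt.comp _ ?_ h1
    rwa [Function.comp_apply, hsm]
  have hd1 := h1.differentiableAt (by simp)
  have h3 : fderiv ℝ (f ∘ (ι ∘ φ.symm)) (φ m) =
      (fderiv ℝ f (ι m)).comp (fderiv ℝ (ι ∘ φ.symm) (φ m)) := by
    have hd2 : DifferentiableAt ℝ f ((ι ∘ φ.symm) (φ m)) := by
      rw [Function.comp_apply, hsm]; exact hf.differentiableAt (by simp)
    rw [fderiv_comp _ hd2 hd1, Function.comp_apply, hsm]
  have h4 : (mfderiv (𝓡 q) 𝓘(ℝ, E) ι m : EuclideanSpace ℝ (Fin q) →L[ℝ] E) =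
      fderiv ℝ (ι ∘ φ.symm) (φ m) :=
    mfderiv_eq_fderiv_writtenInExtChartAt (hι.contMDiff.mdifferentiable (by simp) m)
  have h5 : Function.Injective (fderiv ℝ (ι ∘ φ.symm) (φ m)) := by
    rw [← h4]; exact hι.immersion m
  -- A tangent vector of the submanifold killed by the differential of `f` lies in both of two
  -- disjoint subspaces, hence is zero.
  have h6 : Function.Injective (fderiv ℝ (f ∘ (ι ∘ φ.symm)) (φ m)) := by
    rw [injective_iff_map_eq_zero]
    intro v hv
    rw [h3, ContinuousLinearMap.comp_apply] at hv
    have hmem : fderiv ℝ (ι ∘ φ.symm) (φ m) v ∈ immersedTangent q ι m := by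
      rw [← h4]; exact ⟨v, rfl⟩
    have := Submodule.disjoint_def.1 hinj _ hmem hv
    exact h5 (this.trans (map_zero _).symm)
  obtain ⟨U, hU, hUi⟩ := (h2.hasStrictFDerivAt (by simp)).exists_injOn_of_injective h6
    (by rw [finrank_euclideanSpace_fin, hF])
  refine ⟨φ ⁻¹' U ∩ φ.source, inter_mem ((continuousAt_extChartAt (I := 𝓡 q) m) hU)
    (extChartAt_source_mem_nhds m), ?_⟩
  rintro a ⟨ha, has⟩ b ⟨hb, hbs⟩ hab
  refine φ.injOn has hbs (hUi ha hb ?_)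
  simpa only [Function.comp_apply, φ.left_inv has, φ.left_inv hbs] using hab

end LocalInjectivity

/-! ### The transverse measure of the foliation -/

namespace AlgLabel

open Filter Topology

/-- The Casimir function with values in the space of transverse coordinates. -/
noncomputable def casimirMap (i : AlgLabel) (x : Fin 7 → ℝ) : Fin 1 → ℝ := fun _ => i.casimir x

theorem contDiffAt_casimirMap (i : AlgLabel) {x : Fin 7 → ℝ} (hx : x ∈ genericSet) :
    ContDiffAt ℝ ∞ i.casimirMap x := contDiffAt_pi.2 fun _ => i.contDiffAt_casimir hx

theorem continuousOn_casimirMap (i : AlgLabel) : ContinuousOn i.casimirMap genericSet := fun _ hx =>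
  (i.contDiffAt_casimirMap hx).continuousAt.continuousWithinAt

theorem ker_fderiv_casimirMap (i : AlgLabel) {x : Fin 7 → ℝ} (hx : x ∈ genericSet) :
    (fderiv ℝ i.casimirMap x).ker = i.leafTangent x := by
  have h := hasFDerivAt_pi'.1
    ((i.contDiffAt_casimirMap hx).differentiableAt (by simp)).hasFDerivAt 0
  have h' := h.unique ((i.contDiffAt_casimir hx).differentiableAt (by simp)).hasFDerivAt
  ext v
  rw [leafTangent, LinearMap.mem_ker, LinearMap.mem_ker]
  change fderiv ℝ i.casimirMap x v = 0 ↔ fderiv ℝ i.casimir x v = 0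
  rw [← h']
  constructor
  · intro hv; simp [hv]
  · intro hv
    ext k
    rw [Subsingleton.elim k 0]
    simpa using hv

/-- The transverse measure of the foliation by the leaves, which is given by the Lebesgue measure
of the values of the Casimir function. -/
noncomputable def leafTransverseMeasure (i : AlgLabel) : Measure (Fin 7 → ℝ) :=
  transverseMeasure genericSet signPair i.casimirMap

theorem isTransverseMeasure_leafTransverseMeasure (i : AlgLabel) :
    IsTransverseMeasure 1 genericSet i.leafTangent i.leaves i.leafTransverseMeasure where
  empty := measure_empty
  iUnion B hB hd := measure_iUnion hd fun n => (hB n).1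
  invariant B₁ B₂ h₁ h₂ ψ hψ := by
    refine transverseMeasure_eq_of_measurableEquiv i.continuousOn_casimirMap h₁.1 h₂.1 h₁.2.1
      h₂.2.1 ψ fun x => ?_
    obtain ⟨_, ⟨z, hz, rfl⟩, hx, hy⟩ := hψ x
    exact ⟨hy.1.trans hx.1.symm, funext fun _ => hy.2.trans hx.2.symm⟩
  compact_lt_top := by
    rintro _ ⟨M, _, _, ι, hι, hemb, hcompl, rfl⟩ K hK hKN
    refine transverseMeasure_lt_top i.continuousOn_casimirMap hK ?_ fun x hx => ?_
    · intro x hx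
      obtain ⟨m, rfl⟩ := hKN hx
      exact hι.mem m
    · obtain ⟨m, rfl⟩ := hKN hx
      have hm := hι.mem m
      obtain ⟨U, hU, hUi⟩ := hι.exists_injOn_comp (i.contDiffAt_casimirMap hm)
        (Module.finrank_fin_fun ℝ) (by
          rw [i.ker_fderiv_casimirMap hm]; exact (hcompl m).disjoint)
      -- As `ι` is an embedding, the neighbourhood in `M` on which `f` is injective comes from a
      -- neighbourhood in the ambient space. It is cut down to one quadrant to make the label
      -- constant.
      rw [hemb.nhds_eq_comap, mem_comap] at hU
      obtain ⟨W, hW, hWU⟩ := hU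
      refine ⟨W ∩ {y | signPair y = signPair (ι m)},
        inter_mem hW ((isOpen_setOf_signPair_eq hm).mem_nhds rfl), ?_, fun y hy => hy.2.2⟩
      rintro y ⟨hyK, hyW, -⟩ y' ⟨hyK', hyW', -⟩ he
      obtain ⟨a, rfl⟩ := hKN hyK
      obtain ⟨b, rfl⟩ := hKN hyK'
      rw [hUi (hWU hyW) (hWU hyW') he]

end AlgLabel

/-! ### Determinants and the normalization of the `6`-vector -/

section Determinant

/-- An alternating map is determined by its values on injective families of basis vectors; these are
permutations of the basis, on which both sides change by the same sign. -/
theorem AlternatingMap.eq_det_smul {n : ℕ} {N : Type*} [AddCommGroup N] [Module ℝ N]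
    (f : (Fin n → ℝ) [⋀^Fin n]→ₗ[ℝ] N) (a : Fin n → Fin n → ℝ) :
    f a = (Pi.basisFun ℝ (Fin n)).det a • f (Pi.basisFun ℝ (Fin n)) := by
  have h : f = (LinearMap.toSpanSingleton ℝ N (f (Pi.basisFun ℝ (Fin n)))).compAlternatingMap
      (Pi.basisFun ℝ (Fin n)).det := by
    refine Module.Basis.ext_alternating (Pi.basisFun ℝ (Fin n)) fun v hv => ?_
    let e : Equiv.Perm (Fin n) := Equiv.ofBijective v (Finite.injective_iff_bijective.1 hv)
    have h1 := f.map_perm (Pi.basisFun ℝ (Fin n)) e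
    have h2 := (Pi.basisFun ℝ (Fin n)).det.map_perm (Pi.basisFun ℝ (Fin n)) e
    have h3 : (fun k => Pi.basisFun ℝ (Fin n) (v k)) = ⇑(Pi.basisFun ℝ (Fin n)) ∘ e := rfl
    rw [h3, h1, LinearMap.compAlternatingMap_apply, h2, Module.Basis.det_self]
    simp only [LinearMap.toSpanSingleton_apply, Units.smul_def, zsmul_eq_mul, mul_one,
      Int.cast_smul_eq_zsmul]
  exact DFunLike.congr_fun h a

variable {l : (Fin 7 → ℝ) →L[ℝ] ℝ}

/-- The volume form, with its first argument separated. -/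
noncomputable def volForm : (Fin 7 → ℝ) →ₗ[ℝ] (Fin 7 → ℝ) [⋀^Fin 6]→ₗ[ℝ] ℝ :=
  (Pi.basisFun ℝ (Fin 7)).det.curryLeft

theorem volForm_apply (w : Fin 7 → ℝ) (v : Fin 6 → Fin 7 → ℝ) :
    volForm w v = (Matrix.of (Matrix.vecCons w v)).det := by
  rw [volForm, AlternatingMap.curryLeft_apply_apply, Pi.basisFun_det_apply]

theorem volForm_eq_zero {w : Fin 7 → ℝ} {v : Fin 6 → Fin 7 → ℝ} {k : Fin 6} (h : w = v k) :
    volForm w v = 0 := by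
  rw [volForm_apply]
  exact Matrix.det_zero_of_row_eq (i := 0) (j := k.succ) (Fin.succ_ne_zero k).symm h

/-- In the expansion along the first row only the second entry survives; its minor is the identity
and its cofactor sign is `-1`. -/
theorem volForm_single_kerFrame : volForm (Pi.single 1 1) (kerFrame l) = -1 := by
  rw [volForm_apply, Matrix.det_succ_row_zero, Finset.sum_eq_single 1]
  · have h : (Matrix.of (Matrix.vecCons (Pi.single 1 1) (kerFrame l))).submatrix Fin.succ
        (Fin.succAbove 1) = 1 := by
      ext k j
      rw [Matrix.submatrix_apply, Matrix.of_apply, Matrix.cons_val_succ,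
        kerFrame_apply_succAbove, Matrix.one_apply]
      simp only [eq_comm]
    rw [h]
    simp
  · intro j _ hj
    simp [hj]
  · simp

/-- The kernel part of `w` is a combination of frame vectors and contributes determinants with a
repeated row; only the multiple of the second basis vector counts. -/
theorem volForm_kerFrame (hl : l (Pi.single 1 1) ≠ 0) (w : Fin 7 → ℝ) :
    volForm w (kerFrame l) = -(l w / l (Pi.single 1 1)) := by
  have h : ∀ k, volForm (kerFrame l k) (kerFrame l) = 0 := fun k => volForm_eq_zero rfl
  conv_lhs => rw [eq_sum_kerFrame_add hl w]
  simp only [map_add, map_smul, AlternatingMap.add_apply, AlternatingMap.smul_apply,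
    Fin.sum_univ_six, h, volForm_single_kerFrame, mul_zero, add_zero,
    zero_add, smul_eq_mul, mul_neg, mul_one]

/-- The vectors `v j` lie in the six-dimensional kernel, whose top exterior power is a line; the
factor is the determinant of their coordinates in the frame, divided by the normalizing scalar. -/
theorem exists_ιMulti_eq_smul_kerVector (hl : l (Pi.single 1 1) ≠ 0) {v : Fin 6 → Fin 7 → ℝ}
    (hv : ∀ j, l (v j) = 0) : ∃ c : ℝ, exteriorPower.ιMulti ℝ 6 v = c • kerVector l := by
  let N : (Fin 6 → ℝ) →ₗ[ℝ] (Fin 7 → ℝ) := Fintype.linearCombination ℝ (kerFrame l)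
  have hN : v = N ∘ fun j k => v j (Fin.succAbove 1 k) := by
    ext1 j
    have := eq_sum_kerFrame_add hl (v j)
    rw [hv j, zero_div, zero_smul, add_zero] at this
    exact this
  have hb : N ∘ (Pi.basisFun ℝ (Fin 6)) = kerFrame l := by
    ext1 j
    simp [N, Fintype.linearCombination_apply, Pi.single_apply]
  have h := AlternatingMap.eq_det_smul ((exteriorPower.ιMulti ℝ 6).compLinearMap N)
    fun j k => v j (Fin.succAbove 1 k)
  rw [AlternatingMap.compLinearMap_apply, AlternatingMap.compLinearMap_apply] at h
  refine ⟨(Pi.basisFun ℝ (Fin 6)).det (fun j k => v j (Fin.succAbove 1 k)) / l (Pi.single 1 1), ?_⟩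
  rw [kerVector, smul_smul, div_mul_cancel₀ _ hl, ← hb]
  conv_lhs => rw [hN]
  exact h

/-- The determinant of a family whose members but one lie in the kernel of a linear form. -/
theorem abs_volForm_eq (hl : l (Pi.single 1 1) ≠ 0) {v : Fin 6 → Fin 7 → ℝ}
    (hv : ∀ j, l (v j) = 0) (w : Fin 7 → ℝ) :
    |volForm w v| = absRatio (kerVector l) (exteriorPower.ιMulti ℝ 6 v) * |l w| := by
  have hex := exists_ιMulti_eq_smul_kerVector hl hv
  -- Pairing with the volume form with first argument `w` turns the equation of `6`-vectors into one
  -- of numbers, in which `kerVector l` contributes `-l w`.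
  have h := congrArg (exteriorPower.alternatingMapLinearEquiv (volForm w)) hex.choose_spec
  have hk : exteriorPower.alternatingMapLinearEquiv (volForm w) (kerVector l) = -l w := by
    rw [kerVector, map_smul, exteriorPower.alternatingMapLinearEquiv_apply_ιMulti,
      volForm_kerFrame hl, smul_eq_mul, mul_neg, mul_div_cancel₀ _ hl]
  rw [map_smul, exteriorPower.alternatingMapLinearEquiv_apply_ιMulti, hk] at h
  rw [absRatio, dif_pos hex, h, smul_eq_mul, abs_mul, abs_neg]

end Determinant

/-! ### Splitting `ℝ⁷` into leaf and transverse coordinates -/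

section SplitCoordinates

/-- The splitting of the coordinates into the last six and the first. -/
def splitCoord : (Fin 7 → ℝ) →L[ℝ] (Fin 6 → ℝ) × (Fin 1 → ℝ) :=
  (ContinuousLinearMap.pi fun j : Fin 6 => ContinuousLinearMap.proj j.succ).prod
    (ContinuousLinearMap.pi fun _ => ContinuousLinearMap.proj 0)

/-- The same as a measurable equivalence. -/
def splitCoordEquiv : (Fin 7 → ℝ) ≃ᵐ (Fin 6 → ℝ) × (Fin 1 → ℝ) :=
  ((MeasurableEquiv.piFinSuccAbove (fun _ : Fin 7 => ℝ) 0).trans MeasurableEquiv.prodComm).trans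
    (MeasurableEquiv.prodCongr (MeasurableEquiv.refl _) (MeasurableEquiv.funUnique (Fin 1) ℝ).symm)

theorem coe_splitCoordEquiv : ⇑splitCoordEquiv = splitCoord := rfl

theorem measurePreserving_splitCoord : MeasurePreserving splitCoord volume volume := by
  rw [← coe_splitCoordEquiv]
  have h1 := volume_preserving_piFinSuccAbove (fun _ : Fin 7 => ℝ) 0
  have h2 := (volume_preserving_funUnique (Fin 1) ℝ).symm
  exact ((MeasurePreserving.id _).prod h2).comp (Measure.measurePreserving_swap.comp h1)

theorem splitCoord_single_zero : splitCoord (Pi.single 0 1) = (0, Pi.single 0 1) := by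
  refine Prod.ext (funext fun j => ?_) (funext fun j => ?_)
  · simp [splitCoord]
  · rw [Subsingleton.elim j 0]; simp [splitCoord]

theorem splitCoord_single_succ (j : Fin 6) :
    splitCoord (Pi.single j.succ 1) = (Pi.single j 1, 0) := by
  refine Prod.ext (funext fun k => ?_) (funext fun k => ?_)
  · simp [splitCoord, Pi.single_apply]
  · simp [splitCoord]

/-- The first coordinate of `ℝ⁷` is the transverse one, so the image of the transverse direction is
the argument that `volForm` separates. -/
theorem det_comp_splitCoord (L : (Fin 6 → ℝ) × (Fin 1 → ℝ) →L[ℝ] (Fin 7 → ℝ)) :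
    (L.comp splitCoord).det =
      volForm (L (0, Pi.single 0 1)) fun j => L (Pi.single j 1, 0) := by
  rw [volForm_apply, ContinuousLinearMap.det, ← LinearMap.det_toMatrix', ← Matrix.det_transpose]
  congr 1
  ext j k
  rw [Matrix.transpose_apply, LinearMap.toMatrix'_apply, Matrix.of_apply]
  refine Fin.cases ?_ (fun j => ?_) j
  · rw [Matrix.cons_val_zero, ← splitCoord_single_zero]
    simp
  · rw [Matrix.cons_val_succ, ← splitCoord_single_succ]
    simp

theorem det_eq_apply (L : (Fin 1 → ℝ) →L[ℝ] (Fin 1 → ℝ)) : L.det = L (Pi.single 0 1) 0 := by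
  rw [ContinuousLinearMap.det, ← LinearMap.det_toMatrix', Matrix.det_unique,
    LinearMap.toMatrix'_apply]
  simp

end SplitCoordinates

/-! ### Disintegration of Lebesgue measure in a foliation chart -/

namespace AlgLabel

open Filter Topology

variable {i : AlgLabel} {φ : OpenPartialHomeomorph (Fin 7 → ℝ) ((Fin 6 → ℝ) × (Fin 1 → ℝ))}

theorem _root_.IsFoliationChart.symm_mem {k q : ℕ} {E : Type*} [NormedAddCommGroup E]
    [NormedSpace ℝ E] {V : Set E} {𝓕 : Set (Set E)}
    {φ : OpenPartialHomeomorph E ((Fin k → ℝ) × (Fin q → ℝ))} (hφ : IsFoliationChart V 𝓕 φ)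
    {z : (Fin k → ℝ) × (Fin q → ℝ)} (hz : z ∈ φ.target) : φ.symm z ∈ V :=
  hφ.source_subset (φ.map_target hz)

/-- Points with the same transverse coordinates lie in the same leaf. -/
theorem symm_mem_leafThrough (hφ : IsFoliationChart genericSet i.leaves φ)
    {z z' : (Fin 6 → ℝ) × (Fin 1 → ℝ)} (hz : z ∈ φ.target) (hz' : z' ∈ φ.target)
    (h : z'.2 = z.2) : φ.symm z' ∈ i.leafThrough (φ.symm z) := by
  have hp := hφ.plaque (i.leafThrough (φ.symm z)) ⟨_, hφ.symm_mem hz, rfl⟩ (φ.symm z)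
    ⟨i.mem_leafThrough_self _, φ.map_target hz⟩
  have hm : φ.symm z' ∈ {y ∈ φ.source | (φ y).2 = (φ (φ.symm z)).2} :=
    ⟨φ.map_target hz', by rw [φ.right_inv hz, φ.right_inv hz', h]⟩
  rw [← hp] at hm
  exact (connectedComponentIn_subset _ _ hm).1

theorem contDiffAt_symm (hφ : IsFoliationChart genericSet i.leaves φ)
    {z : (Fin 6 → ℝ) × (Fin 1 → ℝ)} (hz : z ∈ φ.target) : ContDiffAt ℝ ∞ φ.symm z :=
  hφ.smooth_symm.contDiffAt (φ.open_target.mem_nhds hz)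

/-- The values of the Casimir function along the slice of the chart through `p`. -/
noncomputable def sliceCasimir (i : AlgLabel)
    (φ : OpenPartialHomeomorph (Fin 7 → ℝ) ((Fin 6 → ℝ) × (Fin 1 → ℝ))) (p : Fin 6 → ℝ)
    (t : Fin 1 → ℝ) : Fin 1 → ℝ := i.casimirMap (φ.symm (p, t))

theorem contDiffAt_casimirMap_symm (hφ : IsFoliationChart genericSet i.leaves φ)
    {z : (Fin 6 → ℝ) × (Fin 1 → ℝ)} (hz : z ∈ φ.target) :
    ContDiffAt ℝ ∞ (i.casimirMap ∘ φ.symm) z :=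
  (i.contDiffAt_casimirMap (hφ.symm_mem hz)).comp z (contDiffAt_symm hφ hz)

theorem contDiffAt_sliceCasimir (hφ : IsFoliationChart genericSet i.leaves φ)
    {p : Fin 6 → ℝ} {t : Fin 1 → ℝ} (hz : (p, t) ∈ φ.target) :
    ContDiffAt ℝ ∞ (i.sliceCasimir φ p) t := by
  have h : ContDiffAt ℝ ∞ (fun t : Fin 1 → ℝ => (p, t)) t := contDiffAt_const.prodMk contDiffAt_id
  exact ContDiffAt.comp (g := i.casimirMap ∘ φ.symm) t (contDiffAt_casimirMap_symm hφ hz) h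

/-- The differential of the Casimir function in a foliation chart. -/
theorem fderiv_casimirMap_comp (hφ : IsFoliationChart genericSet i.leaves φ)
    {P : Set (Fin 6 → ℝ)} {T : Set (Fin 1 → ℝ)} (hPT : φ.target = P ×ˢ T) {p₀ : Fin 6 → ℝ}
    (hp₀ : p₀ ∈ P) {z : (Fin 6 → ℝ) × (Fin 1 → ℝ)} (hz : z ∈ φ.target)
    (v : (Fin 6 → ℝ) × (Fin 1 → ℝ)) :
    fderiv ℝ i.casimirMap (φ.symm z) (fderiv ℝ φ.symm z v) =
      fderiv ℝ (i.sliceCasimir φ p₀) z.2 v.2 := by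
  have hz2 : (p₀, z.2) ∈ φ.target := by
    rw [hPT] at hz ⊢
    exact ⟨hp₀, hz.2⟩
  -- Fixing `t` stays in one leaf, so `f` in the chart depends on `t` alone and may be computed on
  -- the slice through `p₀`; the product form of the target ensures that `(p₀, t)` is available.
  have hev : i.casimirMap ∘ φ.symm =ᶠ[𝓝 z] i.sliceCasimir φ p₀ ∘ Prod.snd := by
    filter_upwards [φ.open_target.mem_nhds hz] with y hy
    have hy2 : (p₀, y.2) ∈ φ.target := by
      rw [hPT] at hy ⊢
      exact ⟨hp₀, hy.2⟩
    exact funext fun _ => (symm_mem_leafThrough hφ hy2 hy rfl).2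
  have h1 := fderiv_comp z
    ((i.contDiffAt_casimirMap (hφ.symm_mem hz)).differentiableAt (by simp))
    ((contDiffAt_symm hφ hz).differentiableAt (by simp))
  have h2 := fderiv_comp z (g := i.sliceCasimir φ p₀)
    ((contDiffAt_sliceCasimir hφ hz2).differentiableAt (by simp)) differentiableAt_snd
  rw [← ContinuousLinearMap.comp_apply, ← h1, hev.fderiv_eq, h2, fderiv_snd]
  rfl

theorem fderiv_casimirMap_apply (i : AlgLabel) {x : Fin 7 → ℝ} (hx : x ∈ genericSet)
    (v : Fin 7 → ℝ) : fderiv ℝ i.casimirMap x v = fun _ => fderiv ℝ i.casimir x v := by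
  have h : HasFDerivAt i.casimirMap (ContinuousLinearMap.pi fun _ => fderiv ℝ i.casimir x) x :=
    hasFDerivAt_pi.2 fun _ => ((i.contDiffAt_casimir hx).differentiableAt (by simp)).hasFDerivAt
  rw [h.fderiv]
  rfl

/-- `f` is a submersion, the chart is a diffeomorphism, and leaf directions do not change `f`. So
the transverse derivative is nonzero, and in one transverse dimension this is injectivity. -/
theorem fderiv_sliceCasimir_injective (hφ : IsFoliationChart genericSet i.leaves φ)
    {P : Set (Fin 6 → ℝ)} {T : Set (Fin 1 → ℝ)} (hPT : φ.target = P ×ˢ T) {p : Fin 6 → ℝ}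
    {t : Fin 1 → ℝ} (hp : p ∈ P) (ht : t ∈ T) :
    Function.Injective (fderiv ℝ (i.sliceCasimir φ p) t) := by
  have hz : (p, t) ∈ φ.target := by rw [hPT]; exact ⟨hp, ht⟩
  set x := φ.symm (p, t) with hxdef
  have hx : x ∈ φ.source := φ.map_target hz
  have hφx : φ x = (p, t) := φ.right_inv hz
  have hdφ : DifferentiableAt ℝ φ x :=
    (hφ.smooth.contDiffAt (φ.open_source.mem_nhds hx)).differentiableAt (by simp)
  have hdψ : DifferentiableAt ℝ φ.symm (φ x) := by
    rw [hφx]; exact (contDiffAt_symm hφ hz).differentiableAt (by simp)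
  have hid : ∀ u, fderiv ℝ φ.symm (p, t) (fderiv ℝ φ x u) = u := fun u => by
    have h1 := fderiv_comp x hdψ hdφ
    have h2 : φ.symm ∘ φ =ᶠ[𝓝 x] id := φ.eventually_left_inverse hx
    rw [h2.fderiv_eq, fderiv_id, hφx] at h1
    exact (DFunLike.congr_fun h1 u).symm
  have hne := i.fderiv_casimir_single_one_ne_zero (hφ.source_subset hx)
  have h := fderiv_casimirMap_comp hφ hPT hp hz (fderiv ℝ φ x (Pi.single 1 1))
  rw [hid, i.fderiv_casimirMap_apply (hφ.source_subset hx)] at h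
  set w := (fderiv ℝ φ x (Pi.single 1 1)).2
  rw [injective_iff_map_eq_zero]
  intro v hv
  by_contra hv0
  have hv1 : v 0 ≠ 0 := fun h0 => hv0 (funext fun k => by rw [Subsingleton.elim k 0, h0]; rfl)
  have hw : w = (w 0 / v 0) • v := by
    ext k
    rw [Subsingleton.elim k 0, Pi.smul_apply, smul_eq_mul, div_mul_cancel₀ _ hv1]
  have hw0 : fderiv ℝ (i.sliceCasimir φ p) t w = 0 := by rw [hw, map_smul, hv, smul_zero]
  exact hne ((congrFun h 0).trans (congrFun hw0 0))

/-- The Jacobian determinant of a foliation chart is the product of the leaf density and the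
transverse density. -/
theorem abs_volForm_fderiv_symm (hφ : IsFoliationChart genericSet i.leaves φ)
    {P : Set (Fin 6 → ℝ)} {T : Set (Fin 1 → ℝ)} (hPT : φ.target = P ×ˢ T) {p₀ : Fin 6 → ℝ}
    (hp₀ : p₀ ∈ P) {z : (Fin 6 → ℝ) × (Fin 1 → ℝ)} (hz : z ∈ φ.target) :
    |volForm (fderiv ℝ φ.symm z (0, Pi.single 0 1))
        fun j => fderiv ℝ φ.symm z (Pi.single j 1, 0)| =
      leafDensity (fun x => kerVector (fderiv ℝ i.casimir x)) φ z *
        |(fderiv ℝ (i.sliceCasimir φ p₀) z.2).det| := by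
  have hx := hφ.symm_mem hz
  have h : ∀ v, fderiv ℝ i.casimir (φ.symm z) (fderiv ℝ φ.symm z v) =
      fderiv ℝ (i.sliceCasimir φ p₀) z.2 v.2 0 := fun v => by
    rw [← fderiv_casimirMap_comp hφ hPT hp₀ hz, i.fderiv_casimirMap_apply hx]
  rw [abs_volForm_eq (i.fderiv_casimir_single_one_ne_zero hx) fun j => ?_, h, det_eq_apply]
  · rfl
  · rw [h, map_zero]; rfl

theorem measurable_det_of {F : Type*} [MeasurableSpace F] {n : ℕ} {M : F → Fin n → Fin n → ℝ}
    (hM : Measurable M) : Measurable fun z => (Matrix.of (M z)).det := by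
  have h : Continuous fun M : Fin n → Fin n → ℝ => (Matrix.of M).det :=
    Continuous.matrix_det continuous_id
  exact h.measurable.comp hM

theorem measurable_volForm_fderiv {F : Type*} [NormedAddCommGroup F] [NormedSpace ℝ F]
    [MeasurableSpace F] [OpensMeasurableSpace F] (f : F → Fin 7 → ℝ) (u : F) (v : Fin 6 → F) :
    Measurable fun z => volForm (fderiv ℝ f z u) fun j => fderiv ℝ f z (v j) := by
  have h : Measurable fun z => (Matrix.vecCons (fderiv ℝ f z u)
      fun j => fderiv ℝ f z (v j) : Fin 7 → Fin 7 → ℝ) := by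
    refine measurable_pi_lambda _ fun a => ?_
    refine Fin.cases ?_ (fun j => ?_) a
    · exact measurable_fderiv_apply_const ℝ f u
    · exact measurable_fderiv_apply_const ℝ f (v j)
  simp only [volForm_apply]
  exact measurable_det_of h

/-- The measure in the transverse coordinates of a foliation chart. -/
noncomputable def chartMeasure (i : AlgLabel)
    (φ : OpenPartialHomeomorph (Fin 7 → ℝ) ((Fin 6 → ℝ) × (Fin 1 → ℝ))) (p : Fin 6 → ℝ)
    (T : Set (Fin 1 → ℝ)) : Measure (Fin 1 → ℝ) :=
  (volume.restrict T).withDensity fun t => ENNReal.ofReal |(fderiv ℝ (i.sliceCasimir φ p) t).det|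

theorem measurable_ofReal_abs_det_fderiv {n : ℕ} (f : (Fin n → ℝ) → (Fin n → ℝ)) :
    Measurable fun t => ENNReal.ofReal |(fderiv ℝ f t).det| :=
  (continuous_abs.measurable.comp
    (ContinuousLinearMap.continuous_det.measurable.comp (measurable_fderiv ℝ f))).ennreal_ofReal

/-- Change of variables along `φ.symm`, then Tonelli with the transverse integral outside. The
Jacobian factors as the leaf density times a function of `t` alone, which is the density of
`chartMeasure`. -/
theorem disintegratesOver_chartMeasure (hφ : IsFoliationChart genericSet i.leaves φ)
    {P : Set (Fin 6 → ℝ)} {T : Set (Fin 1 → ℝ)} (hPT : φ.target = P ×ˢ T)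
    (hT : MeasurableSet T) {p₀ : Fin 6 → ℝ} (hp₀ : p₀ ∈ P) :
    DisintegratesOver (fun x => kerVector (fderiv ℝ i.casimir x)) (volume.restrict genericSet) φ
      (i.chartMeasure φ p₀ T) := by
  intro g hg
  set J : (Fin 6 → ℝ) × (Fin 1 → ℝ) → ℝ := fun z =>
    volForm (fderiv ℝ φ.symm z (0, Pi.single 0 1)) fun j => fderiv ℝ φ.symm z (Pi.single j 1, 0)
    with hJ
  have himg : φ.source = (φ.symm ∘ splitCoord) '' (splitCoord ⁻¹' φ.target) := by
    rw [image_comp, image_preimage_eq _ (coe_splitCoordEquiv ▸ splitCoordEquiv.surjective),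
      φ.symm_image_target_eq_source]
  have hmeas : MeasurableSet (splitCoord ⁻¹' φ.target) :=
    splitCoord.continuous.measurable φ.open_target.measurableSet
  have hinj : InjOn (φ.symm ∘ splitCoord) (splitCoord ⁻¹' φ.target) :=
    φ.symm.injOn.comp (coe_splitCoordEquiv ▸ splitCoordEquiv.injective).injOn fun _ h => h
  have hder : ∀ y ∈ splitCoord ⁻¹' φ.target, HasFDerivWithinAt (φ.symm ∘ splitCoord)
      ((fderiv ℝ φ.symm (splitCoord y)).comp splitCoord) (splitCoord ⁻¹' φ.target) y :=
    fun y hy => (((contDiffAt_symm hφ hy).differentiableAt (by simp)).hasFDerivAt.comp y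
      splitCoord.hasFDerivAt).hasFDerivWithinAt
  have hemb : MeasurableEmbedding splitCoord :=
    coe_splitCoordEquiv ▸ splitCoordEquiv.measurableEmbedding
  have h1 : ∫⁻ x in φ.source, g x ∂(volume.restrict genericSet) =
      ∫⁻ z in φ.target, ENNReal.ofReal |J z| * g (φ.symm z) := by
    rw [Measure.restrict_restrict φ.open_source.measurableSet,
      inter_eq_left.2 hφ.source_subset]
    conv_lhs => rw [himg]
    rw [lintegral_image_eq_lintegral_abs_det_fderiv_mul volume hmeas hder hinj]
    simp only [det_comp_splitCoord]
    exact measurePreserving_splitCoord.setLIntegral_comp_preimage_emb hemb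
      (fun z => ENNReal.ofReal |J z| * g (φ.symm z)) φ.target
  have hae : AEMeasurable (fun z => ENNReal.ofReal |J z| * g (φ.symm z))
      ((volume.prod volume).restrict (P ×ˢ T)) := by
    rw [← hPT]
    refine AEMeasurable.mul ?_ ?_
    · exact (continuous_abs.measurable.comp
        (measurable_volForm_fderiv φ.symm _ _)).ennreal_ofReal.aemeasurable
    · exact hg.comp_aemeasurable
        (φ.continuousOn_symm.aemeasurable φ.open_target.measurableSet)
  rw [h1, hPT]
  refine (setLIntegral_prod_symm _ hae).trans ?_
  -- This form needs no measurability of the inner integral as a function of `t`, only a finite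
  -- density.
  rw [chartMeasure, lintegral_withDensity_eq_lintegral_mul_non_measurable _
    (measurable_ofReal_abs_det_fderiv _) (ae_of_all _ fun _ => ENNReal.ofReal_lt_top)]
  refine setLIntegral_congr_fun hT fun t ht => ?_
  have hset : {p | (p, t) ∈ P ×ˢ T} = P := by ext p; simp [ht]
  have hP : MeasurableSet P := by
    rw [← hset, ← hPT]
    exact measurable_prodMk_right φ.open_target.measurableSet
  rw [Pi.mul_apply, hset, ← lintegral_const_mul' _ _ ENNReal.ofReal_ne_top]
  refine setLIntegral_congr_fun hP fun p hp => ?_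
  have hz : (p, t) ∈ φ.target := by rw [hPT]; exact ⟨hp, ht⟩
  change ENNReal.ofReal |J (p, t)| * g (φ.symm (p, t)) = _
  rw [hJ, abs_volForm_fderiv_symm hφ hPT hp₀ hz, mul_comm (leafDensity _ _ _),
    ENNReal.ofReal_mul (abs_nonneg _), mul_assoc, mul_comm (g _)]

end AlgLabel

/-! ### Transverse measure of the slices -/

namespace AlgLabel

open Filter Topology

variable {i : AlgLabel} {φ : OpenPartialHomeomorph (Fin 7 → ℝ) ((Fin 6 → ℝ) × (Fin 1 → ℝ))}
  {P : Set (Fin 6 → ℝ)} {T : Set (Fin 1 → ℝ)} {p₀ p : Fin 6 → ℝ}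

theorem casimirMap_image_slice (hφ : IsFoliationChart genericSet i.leaves φ)
    (hPT : φ.target = P ×ˢ T) (hp₀ : p₀ ∈ P) (hp : p ∈ P) {A : Set (Fin 1 → ℝ)} (hA : A ⊆ T) :
    i.casimirMap '' (φ.symm '' ({p} ×ˢ A)) = i.sliceCasimir φ p₀ '' A := by
  have h : ∀ t ∈ A, i.casimirMap (φ.symm (p, t)) = i.sliceCasimir φ p₀ t := fun t ht =>
    funext fun _ => (symm_mem_leafThrough hφ (z := (p₀, t)) (z' := (p, t))
      (hPT ▸ ⟨hp₀, hA ht⟩) (hPT ▸ ⟨hp, hA ht⟩) rfl).2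
  rw [singleton_prod, image_image, image_image]
  exact image_congr h

theorem measurableSet_symm_image_slice (hPT : φ.target = P ×ˢ T) (hp : p ∈ P)
    {A : Set (Fin 1 → ℝ)} (hA : MeasurableSet A) (hAT : A ⊆ T) :
    MeasurableSet (φ.symm '' ({p} ×ˢ A)) := by
  have hsub : {p} ×ˢ A ⊆ φ.symm.source := by
    rw [φ.symm_source, hPT]
    exact prod_mono (singleton_subset_iff.2 hp) hAT
  exact ((measurableSet_singleton p).prod hA).image_of_continuousOn_injOn
    (φ.symm.continuousOn.mono hsub) (φ.symm.injOn.mono hsub)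

/-- The measure in the transverse coordinates is the transverse measure of the slices. -/
theorem chartMeasure_apply_eq (hφ : IsFoliationChart genericSet i.leaves φ)
    (hPT : φ.target = P ×ˢ T) (hT : IsOpen T) (hp₀ : p₀ ∈ P) (hp : p ∈ P) {A : Set (Fin 1 → ℝ)}
    (hA : MeasurableSet A) (hAT : A ⊆ T) :
    i.chartMeasure φ p₀ T A = i.leafTransverseMeasure (φ.symm '' ({p} ×ˢ A)) := by
  have htgt : ∀ q ∈ P, ∀ t ∈ T, (q, t) ∈ φ.target := fun q hq t ht => hPT ▸ ⟨hq, ht⟩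
  set S := φ.symm '' ({p} ×ˢ T) with hS
  have hSm : MeasurableSet S := measurableSet_symm_image_slice hPT hp hT.measurableSet subset_rfl
  have hSsrc : S ⊆ φ.source := by
    rintro _ ⟨⟨q, t⟩, ⟨rfl, ht⟩, rfl⟩
    exact φ.map_target (htgt _ hp t ht)
  -- The transverse measure is carried to `T` as a measure, so that its agreement with
  -- `chartMeasure` may be checked locally.
  let m : Measure (Fin 1 → ℝ) := (i.leafTransverseMeasure.restrict S).map fun x => (φ x).2
  have hm : ∀ B ⊆ T, MeasurableSet B → m B = i.leafTransverseMeasure (φ.symm '' ({p} ×ˢ B)) := by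
    intro B hBT hB
    have hφm : AEMeasurable (fun x => (φ x).2) (i.leafTransverseMeasure.restrict S) :=
      (continuous_snd.comp_continuousOn (φ.continuousOn.mono hSsrc)).aemeasurable hSm
    rw [Measure.map_apply_of_aemeasurable hφm hB, Measure.restrict_apply' hSm]
    congr 1
    ext x
    constructor
    · rintro ⟨hx, ⟨q, t⟩, ⟨rfl, ht⟩, rfl⟩
      rw [mem_preimage, φ.right_inv (htgt _ hp t ht)] at hx
      exact ⟨(q, t), ⟨rfl, hx⟩, rfl⟩
    · rintro ⟨⟨q, t⟩, ⟨rfl, ht⟩, rfl⟩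
      refine ⟨?_, ⟨(q, t), ⟨rfl, hBT ht⟩, rfl⟩⟩
      rw [mem_preimage, φ.right_inv (htgt _ hp t (hBT ht))]
      exact ht
  -- Around each `t` the slice is a section: `f` is injective along it by the inverse function
  -- theorem, and it stays in one quadrant by continuity.
  have hloc : ∀ t ∈ T, ∃ U : Set (Fin 1 → ℝ), IsOpen U ∧ t ∈ U ∧ U ⊆ T ∧
      InjOn (i.sliceCasimir φ p₀) U ∧
      ∀ s ∈ U, signPair (φ.symm (p, s)) = signPair (φ.symm (p, t)) := by
    intro t ht
    obtain ⟨U, hU, hUi⟩ := ((contDiffAt_sliceCasimir hφ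
      (htgt _ hp₀ t ht)).hasStrictFDerivAt (by simp)).exists_injOn_of_injective
      (fderiv_sliceCasimir_injective hφ hPT hp₀ ht) rfl
    have hc : ContinuousAt (fun s => φ.symm (p, s)) t :=
      ContinuousAt.comp (g := φ.symm) (φ.continuousAt_symm (htgt _ hp t ht)) (by fun_prop)
    have hW := hc ((isOpen_setOf_signPair_eq (hφ.symm_mem (htgt _ hp t ht))).mem_nhds rfl)
    obtain ⟨U', hU', ho, htU⟩ := mem_nhds_iff.1 (inter_mem (inter_mem hU hW) (hT.mem_nhds ht))
    exact ⟨U', ho, htU, fun s hs => (hU' hs).2, hUi.mono fun s hs => (hU' hs).1.1,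
      fun s hs => (hU' hs).1.2⟩
  choose! U hUo htU hUT hUi hUs using hloc
  -- By the Lindelöf property countably many of these neighbourhoods cover `T`, which suffices for
  -- equality of measures.
  obtain ⟨c, hcT, hc, hcov⟩ := TopologicalSpace.countable_cover_nhdsWithin
    fun t ht => mem_nhdsWithin_of_mem_nhds ((hUo t ht).mem_nhds (htU t ht))
  have hrestr : (i.chartMeasure φ p₀ T).restrict (⋃ t ∈ c, U t) = m.restrict (⋃ t ∈ c, U t) := by
    refine (Measure.restrict_biUnion_congr hc).2 fun t ht => Measure.ext fun B hB => ?_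
    have ht' := hcT ht
    have hBU : MeasurableSet (B ∩ U t) := hB.inter (hUo t ht').measurableSet
    have hBT : B ∩ U t ⊆ T := inter_subset_right.trans (hUT t ht')
    have hsec : IsLeafSection genericSet signPair i.casimirMap (φ.symm '' ({p} ×ˢ (B ∩ U t))) := by
      refine ⟨measurableSet_symm_image_slice hPT hp hBU hBT, ?_, ?_, ?_⟩
      · rintro _ ⟨⟨q, s⟩, ⟨rfl, hs⟩, rfl⟩
        exact hφ.symm_mem (htgt _ hp s (hBT hs))
      · rintro _ ⟨⟨q, s⟩, ⟨rfl, hs⟩, rfl⟩ _ ⟨⟨q', s'⟩, ⟨hq', hs'⟩, rfl⟩ he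
        obtain rfl : q' = q := hq'
        have h : ∀ r ∈ B ∩ U t, i.casimirMap (φ.symm (q', r)) = i.sliceCasimir φ p₀ r :=
          fun r hr => funext fun _ => (symm_mem_leafThrough hφ (htgt _ hp₀ r (hBT hr))
            (htgt _ hp r (hBT hr)) rfl).2
        rw [h s hs, h s' hs'] at he
        exact congrArg (fun r => φ.symm (q', r)) (hUi t ht' hs.2 hs'.2 he)
      · rintro _ ⟨⟨q, s⟩, ⟨rfl, hs⟩, rfl⟩ _ ⟨⟨q', s'⟩, ⟨hq', hs'⟩, rfl⟩
        obtain rfl : q' = q := hq'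
        rw [hUs t ht' s hs.2, hUs t ht' s' hs'.2]
    rw [Measure.restrict_apply hB, Measure.restrict_apply hB, hm _ hBT hBU, leafTransverseMeasure,
      transverseMeasure_section i.continuousOn_casimirMap hsec,
      casimirMap_image_slice hφ hPT hp₀ hp hBT, chartMeasure, withDensity_apply _ hBU,
      Measure.restrict_restrict hBU, inter_eq_left.2 hBT]
    -- On a section both sides are the Lebesgue measure of the values of `f`: change of variables in
    -- one dimension.
    exact lintegral_abs_det_fderiv_eq_addHaar_image volume hBU
      (fun s hs => ((contDiffAt_sliceCasimir hφ (htgt _ hp₀ s (hBT hs))).differentiableAt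
        (by simp)).hasFDerivAt.hasFDerivWithinAt) ((hUi t ht').mono inter_subset_right)
  have hA' := congrArg (fun μ : Measure (Fin 1 → ℝ) => μ A) hrestr
  simp only [Measure.restrict_apply hA, inter_eq_left.2 (hAT.trans hcov)] at hA'
  rw [hA', hm A hAT hA]

theorem correspondsTo_leafTransverseMeasure (i : AlgLabel) :
    CorrespondsTo 1 genericSet i.leaves i.leafTransverseMeasure
      (fun x => kerVector (fderiv ℝ i.casimir x)) (volume.restrict genericSet) := by
  intro φ hφ
  obtain ⟨P, T, hPT⟩ := hφ.target_eq
  rcases φ.target.eq_empty_or_nonempty with hempty | ⟨⟨p₀, t₀⟩, hz₀⟩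
  -- An empty chart offers no base point `p₀`; the zero measure serves.
  · refine ⟨0, fun g _ => ?_, fun p A _ hA => ?_⟩
    · rw [← φ.symm_image_target_eq_source, hempty]
      simp
    · rw [hempty] at hA
      rw [subset_empty_iff.1 hA]
      simp
  · have h₀ : p₀ ∈ P ∧ t₀ ∈ T := by rw [hPT] at hz₀; exact hz₀
    have hT : IsOpen T := by
      have h : T = (fun t => (p₀, t)) ⁻¹' φ.target := by ext t; simp [hPT, h₀.1]
      rw [h]
      exact φ.open_target.preimage (by fun_prop)
    refine ⟨i.chartMeasure φ p₀ T, disintegratesOver_chartMeasure hφ hPT hT.measurableSet h₀.1,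
      fun p A hA hsub => ?_⟩
    -- For empty `A` the inclusion in the target does not force `p ∈ P`, so this case is separate.
    rcases A.eq_empty_or_nonempty with rfl | ⟨t, ht⟩
    · simp
    · have hmem : ∀ s ∈ A, p ∈ P ∧ s ∈ T := fun s hs => by
        have := hsub (mk_mem_prod (mem_singleton p) hs)
        rw [hPT] at this
        exact this
      exact chartMeasure_apply_eq hφ hPT hT h₀.1 (hmem t ht).1 hA fun s hs => (hmem s hs).2

end AlgLabel
theorem theorem3p5 (i : AlgLabel) {G : Type*} [TopologicalSpace G]
    [ChartedSpace (EuclideanSpace ℝ (Fin 7)) G] [Group G] [LieGroup (𝓡 7) ∞ G]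
    [SimplyConnectedSpace G] (e : GroupLieAlgebra (𝓡 7) G ≃ₗ⁅ℝ⁆ i.Alg) :
    ∃ D : (Fin 7 → ℝ) → Submodule ℝ (Fin 7 → ℝ),
      FormsFoliation 6 genericSet D (genericOrbits e) ∧
      (∀ x ∈ genericSet, ∃ φ : OpenPartialHomeomorph (Fin 7 → ℝ) ((Fin 6 → ℝ) × (Fin 1 → ℝ)),
        IsFoliationChart genericSet (genericOrbits e) φ ∧ x ∈ φ.source) ∧
      ∃ X : (Fin 7 → ℝ) → ⋀[ℝ]^6 (Fin 7 → ℝ),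
        IsLeafVolumeField genericSet D X ∧
        IsInvariantMeasure 1 genericSet (genericOrbits e) X
          ((volume : Measure (Fin 7 → ℝ)).restrict genericSet) ∧
        ∃ Λ : Set (Fin 7 → ℝ) → ℝ≥0∞,
          IsTransverseMeasure 1 genericSet D (genericOrbits e) Λ ∧
          CorrespondsTo 1 genericSet (genericOrbits e) Λ X
            ((volume : Measure (Fin 7 → ℝ)).restrict genericSet) := by
  have h : genericOrbits e = i.leaves := genericOrbits_eq e
  rw [h]
  have hc := i.correspondsTo_leafTransverseMeasure
  refine ⟨i.leafTangent, i.formsFoliation_leaves,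
    fun x hx => ⟨i.quadrantChart hx, i.isFoliationChart_quadrantChart hx, rfl⟩,
    fun x => kerVector (fderiv ℝ i.casimir x), i.isLeafVolumeField_kerVector, fun φ hφ => ?_,
    i.leafTransverseMeasure, i.isTransverseMeasure_leafTransverseMeasure, hc⟩
  -- Invariance of Lebesgue measure is the disintegration part of the correspondence with the
  -- transverse measure.
  obtain ⟨ν, hν, -⟩ := hc φ hφ
  exact ⟨ν, hν⟩
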